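/- Let $\mathrm{Y}(\mathfrak{sl}_2)$ be the associative unital algebra over $\mathbb{C}$ with generators $e^{(r)},h^{(r)},f^{(r)}$ ($r=0,1,2,\dots$) and the defining relations, for all $r,s\ge 0$, $$[h^{(r)},h^{(s)}]=0,\quad [e^{(r)},f^{(s)}]=h^{(r+s)},\quad [h^{(0)},e^{(s)}]=2e^{(s)},\quad [h^{(0)},f^{(s)}]=-2f^{(s)},$$ $$[h^{(r+1)},e^{(s)}]-[h^{(r)},e^{(s+1)}]=h^{(r)}e^{(s)}+e^{(s)}h^{(r)},\quad [h^{(r+1)},f^{(s)}]-[h^{(r)},f^{(s+1)}]=-(h^{(r)}f^{(s)}+f^{(s)}h^{(r)}),$$ $$[e^{(r+1)},e^{(s)}]-[e^{(r)},e^{(s+1)}]=e^{(r)}e^{(s)}+e^{(s)}e^{(r)},\quad [f^{(r+1)},f^{(s)}]-[f^{(r)},f^{(s+1)}]=-(f^{(r)}f^{(s)}+f^{(s)}f^{(r)}).$$ For a formal series $\mu(u)=1+\mu^{(0)}u^{-1}+\mu^{(1)}u^{-2}+\cdots$ with complex coefficients, the Verma module $M(\mu(u))$ is the quotient of $\mathrm{Y}(\mathfrak{sl}_2)$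 by the left ideal generated by all $e^{(r)}$ and $h^{(r)}-\mu^{(r)}$, $r\ge 0$; its highest vector $1_\mu$ is the image of $1$. Let $\mathrm{Y}(\mathfrak{gl}_2)$ be the associative unital algebra over $\mathbb{C}$ with generators $t_{ij}^{(1)},t_{ij}^{(2)},\dots$ ($i,j\in\{1,2\}$) and the defining relations $$[t_{ij}^{(r+1)},t_{kl}^{(s)}]-[t_{ij}^{(r)},t_{kl}^{(s+1)}]=t_{kj}^{(r)}t_{il}^{(s)}-t_{kj}^{(s)}t_{il}^{(r)},\qquad r,s\ge 0,\quad t_{ij}^{(0)}=\delta_{ij},$$ and put $t_{ij}(u)=\sum_{r\ge 0}t_{ij}^{(r)}u^{-r}$. For formal series $\lambda_i(u)=1+\lambda_i^{(1)}u^{-1}+\lambda_i^{(2)}u^{-2}+\cdots$ ($i=1,2$) with complex coefficients, the Verma module $M(\lambda_1(u),\lambda_2(u))$ is the quotient of $\mathrm{Y}(\mathfrak{gl}_2)$ by the left ideal generated by all $t_{12}^{(r)}$, $t_{11}^{(r)}-\lambda_1^{(r)}$ and $t_{22}^{(r)}-\lambda_2^{(r)}$, $r\ge 1$; its highest vector $1_\lambda$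 is the image of $1$. A module is called reducible if it has a submodule other than zero and itself. The following statements hold. 1. For every $\mu(u)$ as above, the $\mathrm{Y}(\mathfrak{sl}_2)$-module $M(\mu(u))$ is reducible if and only if $\mu(u)$ is the Laurent expansion at $u=\infty$ of a rational function in $u$. 2. For all $\lambda_1(u),\lambda_2(u)$ as above, the $\mathrm{Y}(\mathfrak{gl}_2)$-module $M(\lambda_1(u),\lambda_2(u))$ is reducible if and only if $\lambda_1(u)/\lambda_2(u)$ is the Laurent expansion at $u=\infty$ of a rational function in $u$. 3. There is an algebra homomorphism $\mathrm{Y}(\mathfrak{sl}_2)\to\mathrm{Y}(\mathfrak{gl}_2)$ under which, for every $r\ge 0$, the images of $e^{(r)}$, $f^{(r)}$, $h^{(r)}$ are the coefficients of $u^{-r-1}$ in the series $t_{22}(u)^{-1}t_{12}(u)$, $\;t_{21}(u)t_{22}(u)^{-1}$, and $\;t_{11}(u)t_{22}(u)^{-1}-t_{21}(u)t_{22}(u)^{-1}t_{12}(u)t_{22}(u)^{-1}$, respectively; and for all $\lambda_1(u),\lambda_2(u)$ as above, the restriction of $M(\lambda_1(u),\lambda_2(u))$ along this homomorphism is isomorphic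 to the $\mathrm{Y}(\mathfrak{sl}_2)$-module $M(\mu(u))$ with $\mu(u)=\lambda_1(u)/\lambda_2(u)$, by an isomorphism that takes $1_\mu$ to $1_\lambda$. 4. Let $\mu(u)$ be the Laurent expansion at $u=\infty$ of $P(u)/Q(u)$, where $P(u)$ and $Q(u)$ are monic polynomials of the same degree $p$. Then for every $s\ge p$ there are constants $c_0,\dots,c_{s-1}\in\mathbb{C}$ such that the vector $$\zeta=c_0f^{(0)}1_\mu+\cdots+c_{s-1}f^{(s-1)}1_\mu+f^{(s)}1_\mu\in M(\mu(u))$$ is nonzero and satisfies $e^{(r)}\zeta=0$ for all $r\ge 0$. -/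

import Mathlib

namespace YangianVerma

open PowerSeries Polynomial

noncomputable section

/-! ### The Yangian of `sl₂` (Drinfeld's second presentation) -/

/-- The generators `e^{(r)}, h^{(r)}, f^{(r)}`, `r ≥ 0`, of the Yangian of `sl₂`. -/
inductive SlGen : Type
  | e (r : ℕ) : SlGen
  | h (r : ℕ) : SlGen
  | f (r : ℕ) : SlGen

/-- The generators as elements of the free associative algebra. -/
abbrev slFree (x : SlGen) : FreeAlgebra ℂ SlGen := FreeAlgebra.ι ℂ x

open SlGen in
/-- The defining relations of `Y(sl₂)`; the Cartan matrix is `(2)` and `d₁ = 1`. -/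
inductive SlRel : FreeAlgebra ℂ SlGen → FreeAlgebra ℂ SlGen → Prop
  | hh (r s : ℕ) : SlRel ⁅slFree (h r), slFree (h s)⁆ 0
  | ef (r s : ℕ) : SlRel ⁅slFree (e r), slFree (f s)⁆ (slFree (h (r + s)))
  | h0e (s : ℕ) : SlRel ⁅slFree (h 0), slFree (e s)⁆ (2 * slFree (e s))
  | h0f (s : ℕ) : SlRel ⁅slFree (h 0), slFree (f s)⁆ (-(2 * slFree (f s)))
  | he (r s : ℕ) : SlRel
      (⁅slFree (h (r + 1)), slFree (e s)⁆ - ⁅slFree (h r), slFree (e (s + 1))⁆)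
      (slFree (h r) * slFree (e s) + slFree (e s) * slFree (h r))
  | hf (r s : ℕ) : SlRel
      (⁅slFree (h (r + 1)), slFree (f s)⁆ - ⁅slFree (h r), slFree (f (s + 1))⁆)
      (-(slFree (h r) * slFree (f s) + slFree (f s) * slFree (h r)))
  | ee (r s : ℕ) : SlRel
      (⁅slFree (e (r + 1)), slFree (e s)⁆ - ⁅slFree (e r), slFree (e (s + 1))⁆)
      (slFree (e r) * slFree (e s) + slFree (e s) * slFree (e r))
  | ff (r s : ℕ) : SlRel
      (⁅slFree (f (r + 1)), slFree (f s)⁆ - ⁅slFree (f r), slFree (f (s + 1))⁆)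
      (-(slFree (f r) * slFree (f s) + slFree (f s) * slFree (f r)))

/-- The Yangian `Y(sl₂)` over `ℂ`. -/
abbrev YSl : Type := RingQuot SlRel

/-- A generator of `Y(sl₂)`. -/
def slGen (x : SlGen) : YSl := RingQuot.mkAlgHom ℂ SlRel (slFree x)

/-- The generator `e^{(r)}` of `Y(sl₂)`. -/
def slE (r : ℕ) : YSl := slGen (.e r)

/-- The generator `h^{(r)}` of `Y(sl₂)`. -/
def slH (r : ℕ) : YSl := slGen (.h r)

/-- The generator `f^{(r)}` of `Y(sl₂)`. -/
def slF (r : ℕ) : YSl := slGen (.f r)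

/-! Series in `u⁻¹` are power series in a variable `X` that stands for `u⁻¹`. So
`μ(u) = 1 + μ^{(0)} u⁻¹ + μ^{(1)} u⁻² + ⋯` is a power series with constant coefficient `1`
and `μ^{(r)} = coeff (r + 1) μ`. -/

/-- The left ideal of `Y(sl₂)` generated by all `e^{(r)}` and `h^{(r)} - μ^{(r)}`. -/
def slVermaIdeal (μ : ℂ⟦X⟧) : Submodule YSl YSl :=
  Submodule.span YSl
    (Set.range slE ∪ Set.range fun r : ℕ => slH r - algebraMap ℂ YSl (coeff (r + 1) μ))

/-- The Verma module `M(μ(u))` over `Y(sl₂)`. -/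
abbrev SlVerma (μ : ℂ⟦X⟧) : Type := YSl ⧸ slVermaIdeal μ

/-- The highest vector `1_μ` of `M(μ(u))`. -/
def slHighest (μ : ℂ⟦X⟧) : SlVerma μ := Submodule.Quotient.mk 1

/-! ### The Yangian of `gl₂` -/

/-- The elements `t_{ij}^{(r)}`, `r ≥ 0`, of the free algebra, where `t_{ij}^{(0)} = δ_{ij}` and
the free generator with index `(i, j, r)` stands for `t_{ij}^{(r+1)}`.
The indices `1, 2` of the generators are `0, 1 : Fin 2`. -/
def glFree (i j : Fin 2) : ℕ → FreeAlgebra ℂ (Fin 2 × Fin 2 × ℕ)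
  | 0 => if i = j then 1 else 0
  | r + 1 => FreeAlgebra.ι ℂ (i, j, r)

/-- The defining relations of `Y(gl₂)`. -/
inductive GlRel :
    FreeAlgebra ℂ (Fin 2 × Fin 2 × ℕ) → FreeAlgebra ℂ (Fin 2 × Fin 2 × ℕ) → Prop
  | rtt (i j k l : Fin 2) (r s : ℕ) : GlRel
      (⁅glFree i j (r + 1), glFree k l s⁆ - ⁅glFree i j r, glFree k l (s + 1)⁆)
      (glFree k j r * glFree i l s - glFree k j s * glFree i l r)

/-- The Yangian `Y(gl₂)` over `ℂ`. -/
abbrev YGl : Type := RingQuot GlRel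

/-- The element `t_{ij}^{(r)}` of `Y(gl₂)`, `r ≥ 0`, with `t_{ij}^{(0)} = δ_{ij}`. -/
def glT (i j : Fin 2) (r : ℕ) : YGl := RingQuot.mkAlgHom ℂ GlRel (glFree i j r)

/-- The generating series `t_{ij}(u) = δ_{ij} + t_{ij}^{(1)} u⁻¹ + t_{ij}^{(2)} u⁻² + ⋯`. -/
def glSeries (i j : Fin 2) : YGl⟦X⟧ := PowerSeries.mk (glT i j)

/-- The series `t_{22}(u)⁻¹`: the two-sided inverse of `t_{22}(u)`, which has constant
coefficient `1`. -/
def glSeriesInv : YGl⟦X⟧ := PowerSeries.invOfUnit (glSeries 1 1) 1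

theorem glSeries_mul_inv : glSeries 1 1 * glSeriesInv = 1 :=
  PowerSeries.mul_invOfUnit _ _ (by simp [glSeries, glT, glFree])

theorem glSeriesInv_mul : glSeriesInv * glSeries 1 1 = 1 :=
  PowerSeries.invOfUnit_mul _ _ (by simp [glSeries, glT, glFree])

/-- The series `e(u) = t_{22}(u)⁻¹ t_{12}(u)`. -/
def glSeriesE : YGl⟦X⟧ := glSeriesInv * glSeries 0 1

/-- The series `f(u) = t_{21}(u) t_{22}(u)⁻¹`. -/
def glSeriesF : YGl⟦X⟧ := glSeries 1 0 * glSeriesInv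

/-- The series `h(u) = t_{11}(u) t_{22}(u)⁻¹ - t_{21}(u) t_{22}(u)⁻¹ t_{12}(u) t_{22}(u)⁻¹`. -/
def glSeriesH : YGl⟦X⟧ :=
  glSeries 0 0 * glSeriesInv - glSeries 1 0 * glSeriesInv * glSeries 0 1 * glSeriesInv

/-- The left ideal of `Y(gl₂)` generated by `t_{12}^{(r)}`, `t_{11}^{(r)} - λ₁^{(r)}` and
`t_{22}^{(r)} - λ₂^{(r)}` for `r ≥ 1`. -/
def glVermaIdeal (l₁ l₂ : ℂ⟦X⟧) : Submodule YGl YGl :=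
  Submodule.span YGl
    ((Set.range fun r : ℕ => glT 0 1 (r + 1)) ∪
      (Set.range fun r : ℕ => glT 0 0 (r + 1) - algebraMap ℂ YGl (coeff (r + 1) l₁)) ∪
      (Set.range fun r : ℕ => glT 1 1 (r + 1) - algebraMap ℂ YGl (coeff (r + 1) l₂)))

/-- The Verma module `M(λ₁(u), λ₂(u))` over `Y(gl₂)`. -/
abbrev GlVerma (l₁ l₂ : ℂ⟦X⟧) : Type := YGl ⧸ glVermaIdeal l₁ l₂

/-- The highest vector `1_λ` of `M(λ₁(u), λ₂(u))`. -/
def glHighest (l₁ l₂ : ℂ⟦X⟧) : GlVerma l₁ l₂ := Submodule.Quotient.mk 1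

/-! ### Reducibility and rationality -/

/-- A module is reducible if it has a submodule other than zero and itself. -/
def IsReducible (R M : Type) [Ring R] [AddCommGroup M] [Module R M] : Prop :=
  ∃ N : Submodule R M, N ≠ ⊥ ∧ N ≠ ⊤

/-- A polynomial in `u` as a Laurent series in `u⁻¹`: the variable `u` goes to the inverse
`single (-1) 1` of the variable of the Laurent series. -/
def polyAtInfinity : ℂ[X] →ₐ[ℂ] LaurentSeries ℂ :=
  Polynomial.aeval (HahnSeries.single (-1 : ℤ) (1 : ℂ))

/-- The series `μ`, in the variable `u⁻¹`, is the Laurent expansion at `u = ∞` of the rational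
function `P(u) / Q(u)`; the quotient is taken in the field of Laurent series in `u⁻¹`. -/
def IsExpansionAtInfinity (μ : ℂ⟦X⟧) (P Q : ℂ[X]) : Prop :=
  Q ≠ 0 ∧ (μ : LaurentSeries ℂ) = polyAtInfinity P / polyAtInfinity Q

/-- The series `μ`, in the variable `u⁻¹`, is the Laurent expansion at `u = ∞` of some rational
function in `u`. -/
def IsRationalSeries (μ : ℂ⟦X⟧) : Prop := ∃ P Q : ℂ[X], IsExpansionAtInfinity μ P Q

end

end YangianVerma

/-! Everything rests on one explicit model of the Verma modules. On functions `F` of finite sets `A`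
of complex numbers, `fOp s` sums a^s ∏ (1 - 1/(a - b)) F(A \ {a}) over the points a of A, the
product being over the other points b; h(u) multiplies by μ(u) ∏ (u - a - 1)/(u - a + 1); and `eOp μ
r` takes the coefficient of u⁻¹ in u^r μ(u) ∏ (1 + 1/(u - a))⁻¹ F(A ∪ {u}), expanded at u = ∞. The
last formula makes sense for functions that are rational in each point, and the span `fSpan` of the
vectors obtained from the indicator of ∅ consists of such functions. On it the relations of Y(sl₂)
hold (`isDrinfeld_fSpan`).

In the Verma module the ordered words in the f^{(s)} span, because commutators of the f^{(s)} lower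
the sum of the indices (`opWord_mem_span_sorted`). In the model they are linearly independent:
letting one point tend to infinity differentiates with respect to the largest letter
(`linearIndependent_sortedWord`). Hence M(μ(u)) embeds in the model, and in fact is `fSpan`
(`slVermaMap_injective`).

If N is a nonzero submodule, take a nonzero vector of N supported on sets with as few points as
possible. Every e^{(r)} lowers this number, so all of them kill the vector. Either the vector is a
multiple of the highest one and N is everything, or for some A the series μ(u) ∏ (1 + 1/(u - a))⁻¹
F(A ∪ {u}) has a nonzero factor F(A ∪ {u}) and no negative powers of u. It is then a polynomial, and
μ(u) is rational (`isRationalSeries_of_isReducible`).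

Conversely, for μ = P/Q and a polynomial R, the vector ∑ Rⱼ f^{(j)} 1_μ is sent by e^{(r)} to the
coefficient of u^{-r-1} in μ(u) R(u) times 1_μ (`IsDrinfeld.e_fVec`). This vanishes for R in the
ideal (Q). These vectors generate a submodule that misses 1_μ, since nothing in the image of the
f^{(s)} has a value at ∅. The multiples u^{s-p} Q(u) give the vectors of the fourth statement.

For Y(gl₂), the Gauss decomposition of the matrix t(u) turns the RTT relations into relations
between currents k, e, f, h and back. One direction (`IsRTT.isGaussCurrents`,
`IsGaussCurrents.isDrinfeld`) gives the homomorphism from Y(sl₂). The other (`isRTT_gaussEntry`)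
makes Y(gl₂) act on the same space `fSpan`, with t₂₂(u) acting as multiplication by λ₂(u) ∏ (u - a +
1)/(u - a). The map from M(λ₁/λ₂) to M(λ₁, λ₂) is injective because its composite with the map to
`fSpan` is, and surjective because the coefficients of f(u) generate M(λ₁, λ₂) from its highest
vector. -/

namespace YangianVerma

/-! ### Matrix entries and Gauss currents at two points: identities in a noncommutative ring. -/

section GaussAlgebra

variable {R B : Type*} [CommRing R] [Ring B] [Algebra R B] {p q : R}

theorem smul_cancel (hp : ∀ b : B, p • b = 0 → b = 0) {x y : B} (h : p • x = p • y) : x = y := by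
  rw [← sub_eq_zero]
  apply hp
  rw [smul_sub, h, sub_self]

/-! Currents at two points: primed letters belong to the second point, and `q / p` is the
inverse of the difference of the points. -/

section FromMatrix

variable {k k' l l' e e' f f' t t' : B}

/-- The relation between t₁₂ and t₂₂, multiplied on the left by the inverse of k'; k and k' commute,
so k' disappears. -/
theorem current_ke (hl' : l' * k' = 1) (hkk : k' * k = k * k')
    (h : (-p) • (k' * e' * k - k * (k' * e')) = q • (k' * (k * e) - k * (k' * e'))) :
    p • (k * e' - e' * k) = q • (k * e - k * e') := by
  have hkk2 : ∀ z, k' * (k * z) = k * (k' * z) := fun z => by rw [← mul_assoc, hkk, mul_assoc]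
  have h2 : ∀ z, l' * (k' * z) = z := fun z => by rw [← mul_assoc, hl', one_mul]
  have h3 : l' * (k * k') = k := by rw [← hkk, h2]
  have h4 : ∀ z, l' * (k * (k' * z)) = k * z := fun z => by rw [← hkk2, h2]
  linear_combination (norm := skip) l' * h
  simp only [mul_sub, mul_smul_comm, mul_assoc, h2, h4, hkk2]
  module

theorem current_kf (hl' : k' * l' = 1) (hkk : k' * k = k * k')
    (h : (-p) • (f' * k' * k - k * (f' * k')) = q • (f' * k' * k - f * k * k')) :
    p • (k * f' - f' * k) = q • (f' * k - f * k) := by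
  linear_combination (norm := skip) h * l'
  simp only [sub_mul, smul_mul_assoc, mul_assoc, hkk, hl', mul_one]
  module

/-- Commutation of ke with k'e' becomes a relation for e and e' once k and k' are collected on the
left with the two k–e relations; then they are cancelled. -/
theorem current_ee
    (hl : l * k = 1) (hl' : l' * k' = 1) (hkk : k' * k = k * k')
    (hke : p • (k * e' - e' * k) = q • (k * e - k * e'))
    (hke' : p • (k' * e - e * k') = q • (k' * e - k' * e'))
    (h : k * e * (k' * e') = k' * e' * (k * e)) :
    p • (e * e' - e' * e) = -(q • ((e - e') * (e - e'))) := by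
  have hkk2 : ∀ z, k' * (k * z) = k * (k' * z) := fun z => by rw [← mul_assoc, hkk, mul_assoc]
  have h2 : ∀ z, l' * (k' * z) = z := fun z => by rw [← mul_assoc, hl', one_mul]
  have h3 : ∀ z, l * (k * z) = z := fun z => by rw [← mul_assoc, hl, one_mul]
  have key : k * k' * (p • (e * e' - e' * e)) = k * k' * -(q • ((e - e') * (e - e'))) := by
    linear_combination (norm := skip) p • h - k' * hke * e + k * hke' * e'
    simp only [mul_sub, sub_mul, mul_smul_comm, smul_mul_assoc, mul_assoc, hkk2, mul_neg]
    module
  have := congrArg (fun z => l' * (l * z)) key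
  simpa only [mul_assoc, h2, h3] using this

theorem current_ff (hl : k * l = 1) (hl' : k' * l' = 1) (hkk : k' * k = k * k')
    (hkf : p • (k * f' - f' * k) = q • (f' * k - f * k))
    (hkf' : p • (k' * f - f * k') = q • (f' * k' - f * k'))
    (h : f * k * (f' * k') = f' * k' * (f * k)) :
    p • (f * f' - f' * f) = q • ((f - f') * (f - f')) := by
  have hkk2 : ∀ z, k' * (k * z) = k * (k' * z) := fun z => by rw [← mul_assoc, hkk, mul_assoc]
  have h2 : ∀ z, k' * (l' * z) = z := fun z => by rw [← mul_assoc, hl', one_mul]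
  have h3 : ∀ z, k * (l * z) = z := fun z => by rw [← mul_assoc, hl, one_mul]
  have key : (p • (f * f' - f' * f)) * (k * k') = (q • ((f - f') * (f - f'))) * (k * k') := by
    linear_combination (norm := skip) p • h - f * hkf * k' + f' * hkf' * k
    simp only [mul_sub, sub_mul, mul_smul_comm, smul_mul_assoc, mul_assoc, hkk]
    module
  have := congrArg (fun z => z * l' * l) key
  simpa only [mul_assoc, h2, h3, hl, hl', mul_one] using this

/-- The reduced diagonal entry `t - f k e` commutes with `k'`. -/
theorem current_dk (hp : ∀ b : B, p • b = 0 → b = 0) (hkk : k' * k = k * k')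
    (hke : p • (k * e' - e' * k) = q • (k * e - k * e'))
    (hkf : p • (k * f' - f' * k) = q • (f' * k - f * k))
    (h' : (-p) • (t' * k - k * t') = q • (f' * k' * (k * e) - f * k * (k' * e'))) :
    k * (t' - f' * k' * e') = (t' - f' * k' * e') * k := by
  have hkk2 : ∀ z, k' * (k * z) = k * (k' * z) := fun z => by rw [← mul_assoc, hkk, mul_assoc]
  apply smul_cancel hp
  linear_combination (norm := skip) h' - hkf * (k' * e') - f' * k' * hke
  simp only [mul_sub, sub_mul, mul_smul_comm, smul_mul_assoc, mul_assoc, hkk2]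
  module

/-- Write t = d + f k e. Moving k to the left and k' to the right of the commutator of e and f'
produces exactly the terms with f k e and f' k' e', so only the diagonal parts d, d' survive.
Dividing by k on the left and k' on the right leaves d'l' and dl, the values of h. -/
theorem current_ef (hp : ∀ b : B, p • b = 0 → b = 0)
    (hl : l * k = 1) (hlr : k * l = 1) (hl' : k' * l' = 1) (hkk : k' * k = k * k')
    {d d' : B} (ht : t = d + f * k * e) (ht' : t' = d' + f' * k' * e')
    (hd : k * d = d * k) (hdk' : k * d' = d' * k)
    (hke : p • (k * e' - e' * k) = q • (k * e - k * e'))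
    (hke' : p • (k' * e - e * k') = q • (k' * e - k' * e'))
    (hkf : p • (k * f' - f' * k) = q • (f' * k - f * k))
    (h : (-p) • (f' * k' * (k * e) - k * e * (f' * k')) = q • (t' * k - t * k')) :
    p • (e * f' - f' * e) = q • (d' * l' - d * l) := by
  subst ht ht'
  have hkk2 : ∀ z, k' * (k * z) = k * (k' * z) := fun z => by rw [← mul_assoc, hkk, mul_assoc]
  have h3 : ∀ z, l * (k * z) = z := fun z => by rw [← mul_assoc, hl, one_mul]
  have hdl : l * d = d * l := by
    have := congrArg (fun z => l * z * l) hd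
    simpa only [mul_assoc, h3, hlr, mul_one] using this.symm
  have key : k * (p • (e * f' - f' * e)) * k' = q • (d' * k - d * k') := by
    apply smul_cancel hp
    linear_combination (norm := skip) p • h + p • (f' * k * hke') - p • (hkf * (e * k'))
      - q • (f' * k' * hke) + q • (f' * k * hke')
    simp only [mul_sub, sub_mul, add_mul, mul_smul_comm, smul_mul_assoc, mul_assoc,
      hkk2]
    module
  have := congrArg (fun z => l * z * l') key
  simp only [mul_assoc, h3, hl', mul_one, mul_sub, sub_mul, mul_smul_comm, smul_mul_assoc] at this ⊢
  rw [this, ← mul_assoc d' k, ← hdk', mul_assoc k, h3, hdl]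

end FromMatrix

/-! ### From the currents back to the matrix entries. -/

section ToMatrix

variable {k k' e e' f f' d d' h h' t t' : B}

theorem matrix_ke (hp : ∀ b : B, p • b = 0 → b = 0) (hkk : k' * k = k * k')
    (hke : p • (k * e' - e' * k) = q • (k * e - k * e'))
    (hke' : p • (k' * e - e * k') = q • (k' * e - k' * e')) :
    p • (k * (k' * e') - k' * e' * k) = q • (k * e * k' - k' * e' * k) := by
  have hkk2 : ∀ z, k' * (k * z) = k * (k' * z) := fun z => by rw [← mul_assoc, hkk, mul_assoc]
  apply smul_cancel hp
  linear_combination (norm := skip) p • (k' * hke) + q • (k * hke') - q • (k' * hke)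
  simp only [mul_sub, mul_smul_comm, mul_assoc, hkk2]
  module

theorem matrix_ek (hkk : k' * k = k * k')
    (hke' : p • (k' * e - e * k') = q • (k' * e - k' * e')) :
    p • (k * e * k' - k' * (k * e)) = q • (k * (k' * e') - k' * (k * e)) := by
  have hkk2 : ∀ z, k' * (k * z) = k * (k' * z) := fun z => by rw [← mul_assoc, hkk, mul_assoc]
  linear_combination (norm := skip) -(k * hke')
  simp only [mul_sub, mul_smul_comm, mul_assoc, hkk2]
  module

theorem matrix_kf (hp : ∀ b : B, p • b = 0 → b = 0) (hkk : k' * k = k * k')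
    (hkf : p • (k * f' - f' * k) = q • (f' * k - f * k))
    (hkf' : p • (k' * f - f * k') = q • (f' * k' - f * k')) :
    p • (k * (f' * k') - f' * k' * k) = q • (k * (f' * k') - k' * (f * k)) := by
  apply smul_cancel hp
  linear_combination (norm := skip) p • (hkf * k') - q • (hkf * k') + q • (hkf' * k)
  simp only [sub_mul, smul_mul_assoc, mul_assoc, hkk]
  module

theorem matrix_fk (hkk : k' * k = k * k')
    (hkf' : p • (k' * f - f * k') = q • (f' * k' - f * k')) :
    p • (f * k * k' - k' * (f * k)) = q • (f * k * k' - f' * k' * k) := by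
  linear_combination (norm := skip) -(hkf' * k)
  simp only [sub_mul, smul_mul_assoc, mul_assoc, hkk]
  module

theorem matrix_ee (hp : ∀ b : B, p • b = 0 → b = 0) (hkk : k' * k = k * k')
    (hke : p • (k * e' - e' * k) = q • (k * e - k * e'))
    (hke' : p • (k' * e - e * k') = q • (k' * e - k' * e'))
    (hee : p • (e * e' - e' * e) = -(q • ((e - e') * (e - e')))) :
    k * e * (k' * e') = k' * e' * (k * e) := by
  have hkk2 : ∀ z, k' * (k * z) = k * (k' * z) := fun z => by rw [← mul_assoc, hkk, mul_assoc]
  apply smul_cancel hp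
  linear_combination (norm := skip) k * k' * hee + k' * hke * e - k * hke' * e'
  simp only [mul_sub, sub_mul, mul_smul_comm, smul_mul_assoc, mul_assoc, hkk2, mul_neg]
  module

theorem matrix_ff (hp : ∀ b : B, p • b = 0 → b = 0) (hkk : k' * k = k * k')
    (hkf : p • (k * f' - f' * k) = q • (f' * k - f * k))
    (hkf' : p • (k' * f - f * k') = q • (f' * k' - f * k'))
    (hff : p • (f * f' - f' * f) = q • ((f - f') * (f - f'))) :
    f * k * (f' * k') = f' * k' * (f * k) := by
  apply smul_cancel hp
  linear_combination (norm := skip) hff * (k * k') + f * hkf * k' - f' * hkf' * k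
  simp only [mul_sub, sub_mul, mul_smul_comm, smul_mul_assoc, mul_assoc, hkk]
  module

theorem matrix_ef (hp : ∀ b : B, p • b = 0 → b = 0) (hkk : k' * k = k * k')
    (ht : t = d + f * k * e) (ht' : t' = d' + f' * k' * e')
    (hkd : h * k = d) (hkd' : h' * k' = d') (hhk : k * h = h * k) (hh'k : k * h' = h' * k)
    (hke : p • (k * e' - e' * k) = q • (k * e - k * e'))
    (hke' : p • (k' * e - e * k') = q • (k' * e - k' * e'))
    (hkf : p • (k * f' - f' * k) = q • (f' * k - f * k))
    (hef : p • (e * f' - f' * e) = q • (h' - h)) :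
    p • (k * e * (f' * k') - f' * k' * (k * e)) = q • (t' * k - t * k') := by
  subst ht ht' hkd hkd'
  have hkk2 : ∀ z, k' * (k * z) = k * (k' * z) := fun z => by rw [← mul_assoc, hkk, mul_assoc]
  have h1 : ∀ z, k * (h * z) = h * (k * z) := fun z => by rw [← mul_assoc, hhk, mul_assoc]
  have h2 : ∀ z, k * (h' * z) = h' * (k * z) := fun z => by rw [← mul_assoc, hh'k, mul_assoc]
  apply smul_cancel hp
  linear_combination (norm := skip) p • (k * hef * k') - p • (f' * k * hke') + p • (hkf * (e * k'))
      + q • (f' * k' * hke) - q • (f' * k * hke')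
  simp only [mul_sub, sub_mul, add_mul, mul_smul_comm, smul_mul_assoc, mul_assoc,
      hkk, hkk2, h1, h2]
  module

/-- The two orders of the factors on the right side are both needed: the RTT relation for t₁₂ and
t₂₁ puts k first, the one for t₂₁ and t₁₂ puts t first. They agree since d' commutes with k and d
with k', while the terms with f k e are handled by the k–e and k–f relations. -/
theorem matrix_ef' (hp : ∀ b : B, p • b = 0 → b = 0) (hkk : k' * k = k * k')
    (ht : t = d + f * k * e) (ht' : t' = d' + f' * k' * e')
    (hdk' : k * d' = d' * k) (hd'k : k' * d = d * k')
    (hke : p • (k * e' - e' * k) = q • (k * e - k * e'))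
    (hke' : p • (k' * e - e * k') = q • (k' * e - k' * e'))
    (hkf : p • (k * f' - f' * k) = q • (f' * k - f * k))
    (hkf' : p • (k' * f - f * k') = q • (f' * k' - f * k'))
    (h : p • (k * e * (f' * k') - f' * k' * (k * e)) = q • (t' * k - t * k')) :
    p • (k * e * (f' * k') - f' * k' * (k * e)) = q • (k * t' - k' * t) := by
  subst ht ht'
  have hkk2 : ∀ z, k' * (k * z) = k * (k' * z) := fun z => by rw [← mul_assoc, hkk, mul_assoc]
  apply smul_cancel hp
  linear_combination (norm := skip) p • h - p • (q • hdk') + p • (q • hd'k)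
    - q • (hkf * (k' * e')) - q • (f' * k' * hke) + q • (hkf' * (k * e)) + q • (f * k * hke')
  simp only [mul_sub, sub_mul, mul_add, add_mul, mul_smul_comm, smul_mul_assoc, mul_assoc,
      hkk2]
  module

end ToMatrix

end GaussAlgebra
end YangianVerma

namespace YangianVerma
open PowerSeries

/-! ### Power series at two points and division by the difference of the points. -/

section TwoPoints

variable {A : Type*} [Ring A]

/-- A series in the variable of the first point. -/
noncomputable def firstPt : A⟦X⟧ →+* A⟦X⟧⟦X⟧ := PowerSeries.C

/-- A series in the variable of the second point. -/
noncomputable def secondPt : A⟦X⟧ →+* A⟦X⟧⟦X⟧ := PowerSeries.map PowerSeries.C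

/-- The coefficient with exponent `n` at the first point and `m` at the second one. -/
noncomputable def coeff₂ (n m : ℕ) : A⟦X⟧⟦X⟧ →+ A where
  toFun b := coeff n (coeff m b)
  map_zero' := by simp
  map_add' := by simp

theorem ext₂ {b c : A⟦X⟧⟦X⟧} (h : ∀ n m, coeff₂ n m b = coeff₂ n m c) : b = c := by
  ext m n
  exact h n m

theorem coeff₂_first_mul_second (a b : A⟦X⟧) (n m : ℕ) :
    coeff₂ n m (firstPt a * secondPt b) = coeff n a * coeff m b := by
  simp [coeff₂, firstPt, secondPt, coeff_C_mul, coeff_mul_C]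

theorem coeff₂_second_mul_first (a b : A⟦X⟧) (n m : ℕ) :
    coeff₂ n m (secondPt b * firstPt a) = coeff m b * coeff n a := by
  simp [coeff₂, firstPt, secondPt, coeff_C_mul, coeff_mul_C]

theorem coeff₂_first_zero (a : A⟦X⟧) (n : ℕ) : coeff₂ n 0 (firstPt a) = coeff n a := by
  simp [coeff₂, firstPt]

theorem coeff₂_first_succ (a : A⟦X⟧) (n m : ℕ) : coeff₂ n (m + 1) (firstPt a) = 0 := by
  simp [coeff₂, firstPt]

theorem coeff₂_second_zero (a : A⟦X⟧) (m : ℕ) : coeff₂ 0 m (secondPt a) = coeff m a := by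
  simp [coeff₂, secondPt]

theorem coeff₂_second_succ (a : A⟦X⟧) (n m : ℕ) : coeff₂ (n + 1) m (secondPt a) = 0 := by
  simp [coeff₂, secondPt]

/-- The variable of the first point, as a central element. -/
noncomputable def firstVar (A : Type*) [Ring A] : Subring.center A⟦X⟧⟦X⟧ :=
  ⟨PowerSeries.C X, by
    rw [Subring.mem_center_iff]
    intro g
    ext m n
    simp [coeff_C_mul, coeff_mul_C, (commute_X _).eq]⟩

/-- The variable of the second point, as a central element. -/
noncomputable def secondVar (A : Type*) [Ring A] : Subring.center A⟦X⟧⟦X⟧ :=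
  ⟨X, by
    rw [Subring.mem_center_iff]
    intro g
    exact (commute_X g).eq⟩

theorem secondVar_smul (b : A⟦X⟧⟦X⟧) : secondVar A • b = X * b := rfl

theorem firstVar_smul (b : A⟦X⟧⟦X⟧) : firstVar A • b = PowerSeries.C X * b := rfl

/-- With `x = u⁻¹` and `y = v⁻¹` for the two points `u`, `v`, the difference `u - v` is
`(y - x) / (x y)`; this is the numerator. -/
noncomputable def diffNum (A : Type*) [Ring A] : Subring.center A⟦X⟧⟦X⟧ :=
  secondVar A - firstVar A

/-- The denominator of the difference of the two points. -/
noncomputable def diffDen (A : Type*) [Ring A] : Subring.center A⟦X⟧⟦X⟧ :=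
  firstVar A * secondVar A

theorem coeff₂_secondVar_succ (b : A⟦X⟧⟦X⟧) (n m : ℕ) :
    coeff₂ n (m + 1) (secondVar A • b) = coeff₂ n m b := by
  simp [coeff₂, secondVar_smul, coeff_succ_X_mul]

theorem coeff₂_secondVar_zero (b : A⟦X⟧⟦X⟧) (n : ℕ) :
    coeff₂ n 0 (secondVar A • b) = 0 := by
  simp [coeff₂, secondVar_smul]

theorem coeff₂_firstVar_succ (b : A⟦X⟧⟦X⟧) (n m : ℕ) :
    coeff₂ (n + 1) m (firstVar A • b) = coeff₂ n m b := by
  simp [coeff₂, firstVar_smul, coeff_C_mul, coeff_succ_X_mul]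

theorem coeff₂_firstVar_zero (b : A⟦X⟧⟦X⟧) (m : ℕ) :
    coeff₂ 0 m (firstVar A • b) = 0 := by
  simp [coeff₂, firstVar_smul, coeff_C_mul]

/-- With x, y the inverses of the two points, this is (y - x) b = x y c read off coefficient by
coefficient; the first row and the first column of the coefficients of b see no contribution of c.
-/
theorem diffNum_smul_eq_iff {b c : A⟦X⟧⟦X⟧} :
    diffNum A • b = diffDen A • c ↔ (∀ m, coeff₂ 0 m b = 0) ∧ (∀ n, coeff₂ n 0 b = 0) ∧
      ∀ n m, coeff₂ (n + 1) m b - coeff₂ n (m + 1) b = coeff₂ n m c := by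
  simp only [diffNum, diffDen, sub_smul, mul_smul]
  constructor
  · intro h
    refine ⟨fun m => ?_, fun n => ?_, fun n m => ?_⟩
    · simpa [coeff₂_secondVar_succ, coeff₂_firstVar_zero] using congrArg (coeff₂ 0 (m + 1)) h
    · simpa [coeff₂_secondVar_zero, coeff₂_firstVar_succ] using congrArg (coeff₂ (n + 1) 0) h
    · simpa [coeff₂_secondVar_succ, coeff₂_firstVar_succ] using
        congrArg (coeff₂ (n + 1) (m + 1)) h
  · rintro ⟨h1, h2, h3⟩
    apply ext₂
    rintro (_ | n) (_ | m)
    · simp [coeff₂_secondVar_zero, coeff₂_firstVar_zero]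
    · simp [coeff₂_secondVar_succ, coeff₂_firstVar_zero, h1]
    · simp [coeff₂_secondVar_zero, coeff₂_firstVar_succ, h2]
    · simp [coeff₂_secondVar_succ, coeff₂_firstVar_succ, h3]

/-- Multiplication by y - x makes the coefficients constant along antidiagonals and zero at the
boundary, so induction on the second exponent applies. This is what allows relations to be checked
after multiplication by u - v. -/
theorem diffNum_regular (b : A⟦X⟧⟦X⟧) (h : diffNum A • b = 0) : b = 0 := by
  have h0 : diffNum A • b = diffDen A • 0 := by rw [h, smul_zero]
  obtain ⟨-, h2, h3⟩ := diffNum_smul_eq_iff.mp h0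
  have key : ∀ m n, coeff₂ n m b = 0 := by
    intro m
    induction m with
    | zero => exact h2
    | succ m ih =>
      intro n
      have := h3 n m
      rw [ih, map_zero, zero_sub, neg_eq_zero] at this
      exact this
  exact ext₂ fun n m => by rw [key, map_zero]

/-- Multiplication by u - v - 1 is injective too: each coefficient is determined by one further
along the antidiagonal and one of lower total degree, and the first row vanishes. -/
theorem diffNum_sub_diffDen_regular (b : A⟦X⟧⟦X⟧) (h : diffNum A • b = diffDen A • b) :
    b = 0 := by
  obtain ⟨h1, h2, h3⟩ := diffNum_smul_eq_iff.mp h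
  have key : ∀ N n m, n + m ≤ N → coeff₂ n m b = 0 := by
    intro N
    induction N with
    | zero =>
      intro n m hnm
      obtain rfl : n = 0 := by omega
      exact h1 m
    | succ N ih =>
      intro n
      induction n with
      | zero => exact fun m _ => h1 m
      | succ n ihn =>
        intro m hm
        have := h3 n m
        rw [ihn (m + 1) (by omega), ih n m (by omega), sub_zero] at this
        exact this
  exact ext₂ fun n m => by rw [key _ n m le_rfl, map_zero]

/-- The ternary relation of generating series, in both orders of the two points. -/
theorem diffNum_smul_commutator {a b c d : A⟦X⟧} (ha : ∀ n, Commute (coeff 0 a) (coeff n b))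
    (hb : ∀ n, Commute (coeff n a) (coeff 0 b))
    (h : ∀ r s, ⁅coeff (r + 1) a, coeff s b⁆ - ⁅coeff r a, coeff (s + 1) b⁆ =
      coeff r c * coeff s d - coeff s c * coeff r d) :
    diffNum A • (firstPt a * secondPt b - secondPt b * firstPt a) =
      diffDen A • (firstPt c * secondPt d - secondPt c * firstPt d) ∧
    (-diffNum A) • (secondPt a * firstPt b - firstPt b * secondPt a) =
      diffDen A • (secondPt c * firstPt d - firstPt c * secondPt d) := by
  constructor
  · rw [diffNum_smul_eq_iff]
    simp only [map_sub, coeff₂_first_mul_second, coeff₂_second_mul_first]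
    exact ⟨fun m => sub_eq_zero.mpr (ha m), fun n => sub_eq_zero.mpr (hb n), h⟩
  · rw [neg_smul, ← smul_neg, diffNum_smul_eq_iff]
    simp only [map_sub, map_neg, coeff₂_first_mul_second, coeff₂_second_mul_first]
    refine ⟨fun m => ?_, fun n => ?_, fun n m => ?_⟩
    · rw [(hb m).eq, sub_self, neg_zero]
    · rw [(ha n).eq, sub_self, neg_zero]
    · rw [← h m n]
      simp only [Ring.lie_def]
      abel

theorem commutator_of_diffNum_smul {a b c d : A⟦X⟧}
    (h : diffNum A • (firstPt a * secondPt b - secondPt b * firstPt a) =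
      diffDen A • (firstPt c * secondPt d - secondPt c * firstPt d)) (r s : ℕ) :
    ⁅coeff (r + 1) a, coeff s b⁆ - ⁅coeff r a, coeff (s + 1) b⁆ =
      coeff r c * coeff s d - coeff s c * coeff r d := by
  have := (diffNum_smul_eq_iff.mp h).2.2 r s
  simpa only [map_sub, coeff₂_first_mul_second, coeff₂_second_mul_first, Ring.lie_def] using this

end TwoPoints
end YangianVerma

namespace YangianVerma

/-! ### Relations with h deduced from the others by means of an index-shifting element. -/

section Coefficients

variable {A : Type*} [Ring A] {e h f : ℕ → A} {ρ : A}

/-- Apply the derivation [ρ, ·] to h n = [e n, f 0]; the two resulting terms are both twice h (n +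
1), with opposite signs. -/
theorem shift_commute_h (hρe : ∀ s, ⁅ρ, e s⁆ = 2 * e (s + 1)) (hρf : ∀ s, ⁅ρ, f s⁆ = -(2 * f (s + 1)))
    (hef : ∀ r s, ⁅e r, f s⁆ = h (r + s)) (n : ℕ) : ⁅ρ, h n⁆ = 0 := by
  have h1 := hef (n + 1) 0
  have h2 := hef n 1
  have h3 := hef n 0
  have h4 := hρe n
  have h5 := hρf 0
  rw [add_zero] at h1 h3
  rw [← h3]
  simp only [Ring.lie_def] at *
  linear_combination (norm := noncomm_ring) h4 * f 0 - f 0 * h4 + e n * h5 - h5 * e n + 2 * h1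
    - 2 * h2

/-- This is the bracket of the e–e relation with f 0. -/
theorem he_symm (hef : ∀ r s, ⁅e r, f s⁆ = h (r + s))
    (hee : ∀ r s, ⁅e (r + 1), e s⁆ - ⁅e r, e (s + 1)⁆ = e r * e s + e s * e r) (r s : ℕ) :
    (⁅h (r + 1), e s⁆ - ⁅h r, e (s + 1)⁆ - (h r * e s + e s * h r)) +
    (⁅h (s + 1), e r⁆ - ⁅h s, e (r + 1)⁆ - (h s * e r + e r * h s)) = 0 := by
  have h1 := hef r 0
  have h2 := hef s 0
  have h3 := hef (r + 1) 0
  have h4 := hef (s + 1) 0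
  have h5 := hee r s
  rw [add_zero] at h1 h2 h3 h4
  rw [← h1, ← h2, ← h3, ← h4]
  simp only [Ring.lie_def] at *
  linear_combination (norm := noncomm_ring) h5 * f 0 - f 0 * h5

theorem hf_symm (hef : ∀ r s, ⁅e r, f s⁆ = h (r + s))
    (hff : ∀ r s, ⁅f (r + 1), f s⁆ - ⁅f r, f (s + 1)⁆ = -(f r * f s + f s * f r)) (r s : ℕ) :
    (⁅h (r + 1), f s⁆ - ⁅h r, f (s + 1)⁆ + (h r * f s + f s * h r)) +
    (⁅h (s + 1), f r⁆ - ⁅h s, f (r + 1)⁆ + (h s * f r + f r * h s)) = 0 := by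
  have h1 := hef 0 r
  have h2 := hef 0 s
  have h3 := hef 0 (r + 1)
  have h4 := hef 0 (s + 1)
  have h5 := hff r s
  rw [zero_add] at h1 h2 h3 h4
  rw [← h1, ← h2, ← h3, ← h4]
  simp only [Ring.lie_def] at *
  linear_combination (norm := noncomm_ring) e 0 * h5 - h5 * e 0

/-- The symmetrized relation of `he_symm` at r = s is twice the desired one. As ρ commutes with all
h and raises the index of e, the bracket with ρ propagates the relation from s = r to all s ≥ r, and
symmetry covers s < r. -/
theorem he_of_shift (h2 : ∀ a : A, 2 * a = 0 → a = 0)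
    (hρe : ∀ s, ⁅ρ, e s⁆ = 2 * e (s + 1)) (hρh : ∀ n, ⁅ρ, h n⁆ = 0)
    (hef : ∀ r s, ⁅e r, f s⁆ = h (r + s))
    (hee : ∀ r s, ⁅e (r + 1), e s⁆ - ⁅e r, e (s + 1)⁆ = e r * e s + e s * e r) (r s : ℕ) :
    ⁅h (r + 1), e s⁆ - ⁅h r, e (s + 1)⁆ = h r * e s + e s * h r := by
  have step : ∀ r s, ⁅h (r + 1), e s⁆ - ⁅h r, e (s + 1)⁆ - (h r * e s + e s * h r) = 0 →
      ⁅h (r + 1), e (s + 1)⁆ - ⁅h r, e (s + 1 + 1)⁆ - (h r * e (s + 1) + e (s + 1) * h r) = 0 := by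
    intro r s h0
    apply h2
    have a1 := hρe s
    have a2 := hρe (s + 1)
    have a3 := hρh r
    have a4 := hρh (r + 1)
    simp only [Ring.lie_def] at *
    linear_combination (norm := noncomm_ring) ρ * h0 - h0 * ρ - h (r + 1) * a1 + a1 * h (r + 1)
      + h r * a2 - a2 * h r + h r * a1 + a1 * h r - a4 * e s + e s * a4 + a3 * e (s + 1)
      - e (s + 1) * a3 + a3 * e s + e s * a3
  have diag : ∀ r d, ⁅h (r + 1), e (r + d)⁆ - ⁅h r, e (r + d + 1)⁆ -
      (h r * e (r + d) + e (r + d) * h r) = 0 := by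
    intro r d
    induction d with
    | zero =>
      apply h2
      rw [two_mul]
      exact he_symm hef hee r r
    | succ d ih => exact step r (r + d) ih
  rw [← sub_eq_zero]
  rcases le_total r s with hrs | hrs
  · obtain ⟨d, rfl⟩ := Nat.exists_eq_add_of_le hrs
    exact diag r d
  · obtain ⟨d, rfl⟩ := Nat.exists_eq_add_of_le hrs
    have := he_symm hef hee (s + d) s
    rwa [diag s d, add_zero] at this

theorem hf_of_shift (h2 : ∀ a : A, 2 * a = 0 → a = 0)
    (hρf : ∀ s, ⁅ρ, f s⁆ = -(2 * f (s + 1))) (hρh : ∀ n, ⁅ρ, h n⁆ = 0)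
    (hef : ∀ r s, ⁅e r, f s⁆ = h (r + s))
    (hff : ∀ r s, ⁅f (r + 1), f s⁆ - ⁅f r, f (s + 1)⁆ = -(f r * f s + f s * f r)) (r s : ℕ) :
    ⁅h (r + 1), f s⁆ - ⁅h r, f (s + 1)⁆ = -(h r * f s + f s * h r) := by
  have step : ∀ r s, ⁅h (r + 1), f s⁆ - ⁅h r, f (s + 1)⁆ + (h r * f s + f s * h r) = 0 →
      ⁅h (r + 1), f (s + 1)⁆ - ⁅h r, f (s + 1 + 1)⁆ + (h r * f (s + 1) + f (s + 1) * h r) = 0 := by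
    intro r s h0
    apply h2
    have a1 := hρf s
    have a2 := hρf (s + 1)
    have a3 := hρh r
    have a4 := hρh (r + 1)
    simp only [Ring.lie_def] at *
    linear_combination (norm := noncomm_ring) h0 * ρ - ρ * h0 + h (r + 1) * a1 - a1 * h (r + 1)
      - h r * a2 + a2 * h r + h r * a1 + a1 * h r + a4 * f s - f s * a4 - a3 * f (s + 1)
      + f (s + 1) * a3 + a3 * f s + f s * a3
  have diag : ∀ r d, ⁅h (r + 1), f (r + d)⁆ - ⁅h r, f (r + d + 1)⁆ +
      (h r * f (r + d) + f (r + d) * h r) = 0 := by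
    intro r d
    induction d with
    | zero =>
      apply h2
      rw [two_mul]
      exact hf_symm hef hff r r
    | succ d ih => exact step r (r + d) ih
  rw [← sub_eq_zero, sub_neg_eq_add]
  rcases le_total r s with hrs | hrs
  · obtain ⟨d, rfl⟩ := Nat.exists_eq_add_of_le hrs
    exact diag r d
  · obtain ⟨d, rfl⟩ := Nat.exists_eq_add_of_le hrs
    have := hf_symm hef hff (s + d) s
    rwa [diag s d, add_zero] at this

/-- Expand h n = [e n, f 0]. For h 0 and h 1 the contributions of e and f cancel. In general the h–e
and h–f relations express [h (r + 2), h n] through [h (r + 1), h (n + 1)], [h r, h (n + 2)] and [h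
r, h n], so two consecutive indices carry the induction. -/
theorem hh_of_he_hf (hef : ∀ r s, ⁅e r, f s⁆ = h (r + s))
    (h0e : ∀ s, ⁅h 0, e s⁆ = 2 * e s) (h0f : ∀ s, ⁅h 0, f s⁆ = -(2 * f s))
    (he : ∀ r s, ⁅h (r + 1), e s⁆ - ⁅h r, e (s + 1)⁆ = h r * e s + e s * h r)
    (hf : ∀ r s, ⁅h (r + 1), f s⁆ - ⁅h r, f (s + 1)⁆ = -(h r * f s + f s * h r)) (r n : ℕ) :
    ⁅h r, h n⁆ = 0 := by
  have c0 : ∀ n, ⁅h 0, h n⁆ = 0 := by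
    intro n
    have a1 := hef n 0
    rw [add_zero] at a1
    have a2 := h0e n
    have a3 := h0f 0
    simp only [Ring.lie_def] at *
    linear_combination (norm := noncomm_ring) a1 * h 0 - h 0 * a1 + a2 * f 0 - f 0 * a2
      + e n * a3 - a3 * e n
  have c1 : ∀ n, ⁅h 1, h n⁆ = 0 := by
    intro n
    have a1 := hef n 0
    have b1 := hef (n + 1) 0
    have b2 := hef n 1
    rw [add_zero] at a1 b1
    have a2 := he 0 n
    have a3 := hf 0 0
    have a4 := h0e n
    have a5 := h0f 0
    have a6 := h0e (n + 1)
    have a7 := h0f 1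
    simp only [Ring.lie_def, zero_add] at *
    linear_combination (norm := noncomm_ring) a1 * h 1 - h 1 * a1 + a2 * f 0 - f 0 * a2
      + e n * a3 - a3 * e n + a6 * f 0 - f 0 * a6 + e n * a7 - a7 * e n + 2 * b1 - 2 * b2
      + a4 * f 0 + f 0 * a4 + e n * a5 + a5 * e n
  have step : ∀ r, (∀ n, ⁅h r, h n⁆ = 0) ∧ ∀ n, ⁅h (r + 1), h n⁆ = 0 := by
    intro r
    induction r with
    | zero => exact ⟨c0, c1⟩
    | succ r ih =>
      refine ⟨ih.2, fun n => ?_⟩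
      have g1 := hef n 0
      have g2 := hef (n + 1) 0
      have g3 := hef n 1
      have g4 := hef (n + 1) 1
      rw [add_zero] at g1 g2
      have i1 := ih.2 (n + 1)
      have i2 := ih.1 n
      have i3 := ih.1 (n + 1 + 1)
      have x1 := he (r + 1) n
      have x0 := he r n
      have y1 := hf (r + 1) 0
      have y0 := hf r 0
      simp only [Ring.lie_def, zero_add] at *
      linear_combination (norm := noncomm_ring) x1 * f 0 + x0 * f 0 - x0 * f 1 + e n * y1
        - e (n + 1) * y0 + e n * y0 - y1 * e n + y0 * e (n + 1) + y0 * e n - f 0 * x1 + f 1 * x0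
        + f 0 * x0 - h (r + 1 + 1) * g1 + g1 * h (r + 1 + 1) + h (r + 1) * (g2 + g3)
        - (g2 + g3) * h (r + 1) + h r * (g1 + g2 - g3 - g4) - (g1 - g2 + g3 - g4) * h r
        + 2 * i1 + i2 - i3
  exact (step r).1 n

end Coefficients
end YangianVerma

namespace YangianVerma
open PowerSeries

/-! ### From the RTT relations to the Gauss currents. -/

/-- The relations of `Y(gl₂)` for a family of elements of a ring. -/
structure IsRTT {A : Type*} [Ring A] (t : Fin 2 → Fin 2 → ℕ → A) : Prop where
  zero : ∀ i j, t i j 0 = if i = j then 1 else 0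
  rel : ∀ i j k l r s, ⁅t i j (r + 1), t k l s⁆ - ⁅t i j r, t k l (s + 1)⁆ =
    t k j r * t i l s - t k j s * t i l r

namespace IsRTT

variable {A : Type*} [Ring A] {t : Fin 2 → Fin 2 → ℕ → A}

theorem commute_zero (ht : IsRTT t) (i j : Fin 2) (a : A) : Commute (t i j 0) a := by
  rw [ht.zero]
  split_ifs
  · exact Commute.one_left a
  · exact Commute.zero_left a

theorem series_rel (ht : IsRTT t) (i j k l : Fin 2) :
    diffNum A • (firstPt (PowerSeries.mk (t i j)) * secondPt (PowerSeries.mk (t k l)) -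
        secondPt (PowerSeries.mk (t k l)) * firstPt (PowerSeries.mk (t i j))) =
      diffDen A • (firstPt (PowerSeries.mk (t k j)) * secondPt (PowerSeries.mk (t i l)) -
        secondPt (PowerSeries.mk (t k j)) * firstPt (PowerSeries.mk (t i l))) ∧
    (-diffNum A) • (secondPt (PowerSeries.mk (t i j)) * firstPt (PowerSeries.mk (t k l)) -
        firstPt (PowerSeries.mk (t k l)) * secondPt (PowerSeries.mk (t i j))) =
      diffDen A • (secondPt (PowerSeries.mk (t k j)) * firstPt (PowerSeries.mk (t i l)) -
        firstPt (PowerSeries.mk (t k j)) * secondPt (PowerSeries.mk (t i l))) := by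
  apply diffNum_smul_commutator
  · intro n
    simpa only [coeff_mk] using ht.commute_zero i j _
  · intro n
    simpa only [coeff_mk] using (ht.commute_zero k l _).symm
  · simpa only [coeff_mk] using ht.rel i j k l

/-- For equal entries the right side of the RTT relation is the commutator itself, so u - v - 1
annihilates it. -/
theorem series_commute (ht : IsRTT t) (i j : Fin 2) : firstPt (PowerSeries.mk (t i j)) * secondPt (PowerSeries.mk (t i j)) =
    secondPt (PowerSeries.mk (t i j)) * firstPt (PowerSeries.mk (t i j)) := by
  rw [← sub_eq_zero]
  exact diffNum_sub_diffDen_regular _ (ht.series_rel i j i j).1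

end IsRTT

section Currents

variable {A : Type*} [Ring A]

/-- The relations of the Gauss currents `k`, `e`, `f`, `h` of a representation of `Y(gl₂)` at two
points. -/
structure IsGaussCurrents (k e f h : A⟦X⟧) : Prop where
  kk : secondPt k * firstPt k = firstPt k * secondPt k
  ke : diffNum A • (firstPt k * secondPt e - secondPt e * firstPt k) =
    diffDen A • (firstPt k * firstPt e - firstPt k * secondPt e)
  kf : diffNum A • (firstPt k * secondPt f - secondPt f * firstPt k) =
    diffDen A • (secondPt f * firstPt k - firstPt f * firstPt k)
  ef : diffNum A • (firstPt e * secondPt f - secondPt f * firstPt e) =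
    diffDen A • (secondPt h - firstPt h)
  ee : diffNum A • (firstPt e * secondPt e - secondPt e * firstPt e) =
    -(diffDen A • ((firstPt e - secondPt e) * (firstPt e - secondPt e)))
  ff : diffNum A • (firstPt f * secondPt f - secondPt f * firstPt f) =
    diffDen A • ((firstPt f - secondPt f) * (firstPt f - secondPt f))

/-- The roles of the points are exchanged in the coefficients. The product k e at a single point
contributes only where the exponent of the other point is zero, hence the case distinction. -/
theorem current_ke_swap {k e : A⟦X⟧}
    (hke : diffNum A • (firstPt k * secondPt e - secondPt e * firstPt k) =
      diffDen A • (firstPt k * firstPt e - firstPt k * secondPt e)) :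
    diffNum A • (secondPt k * firstPt e - firstPt e * secondPt k) =
      diffDen A • (secondPt k * firstPt e - secondPt k * secondPt e) := by
  rw [diffNum_smul_eq_iff] at hke ⊢
  simp only [← map_mul firstPt, ← map_mul secondPt] at hke ⊢
  simp only [map_sub, coeff₂_first_mul_second, coeff₂_second_mul_first] at hke ⊢
  obtain ⟨h1, h2, h3⟩ := hke
  refine ⟨fun m => ?_, fun n => ?_, fun n m => ?_⟩
  · rw [h2 m]
  · rw [h1 n]
  · have := h3 m n
    cases n with
    | zero =>
      rw [coeff₂_first_zero] at this
      rw [coeff₂_second_zero]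
      linear_combination (norm := noncomm_ring) -this
    | succ n =>
      rw [coeff₂_first_succ] at this
      rw [coeff₂_second_succ]
      linear_combination (norm := noncomm_ring) -this

theorem current_kf_swap {k f : A⟦X⟧}
    (hkf : diffNum A • (firstPt k * secondPt f - secondPt f * firstPt k) =
      diffDen A • (secondPt f * firstPt k - firstPt f * firstPt k)) :
    diffNum A • (secondPt k * firstPt f - firstPt f * secondPt k) =
      diffDen A • (secondPt f * secondPt k - firstPt f * secondPt k) := by
  rw [diffNum_smul_eq_iff] at hkf ⊢
  simp only [← map_mul firstPt, ← map_mul secondPt] at hkf ⊢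
  simp only [map_sub, coeff₂_first_mul_second, coeff₂_second_mul_first] at hkf ⊢
  obtain ⟨h1, h2, h3⟩ := hkf
  refine ⟨fun m => ?_, fun n => ?_, fun n m => ?_⟩
  · rw [h2 m]
  · rw [h1 n]
  · have := h3 m n
    cases n with
    | zero =>
      rw [coeff₂_first_zero] at this
      rw [coeff₂_second_zero]
      linear_combination (norm := noncomm_ring) -this
    | succ n =>
      rw [coeff₂_first_succ] at this
      rw [coeff₂_second_succ]
      linear_combination (norm := noncomm_ring) -this

theorem commute_of_firstPt_secondPt {a b : A⟦X⟧}
    (h : firstPt a * secondPt b = secondPt b * firstPt a) : a * b = b * a := by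
  ext n
  rw [coeff_mul, coeff_mul, ← Finset.Nat.sum_antidiagonal_swap]
  refine Finset.sum_congr rfl fun x _ => ?_
  have := congrArg (coeff₂ x.2 x.1) h
  rwa [coeff₂_first_mul_second, coeff₂_second_mul_first] at this

end Currents

/-- With k = t₂₂, e = k⁻¹t₁₂, f = t₂₁k⁻¹ and d = t₁₁ - f k e, each current relation comes from one
RTT relation: (12, 22) for k–e, (21, 22) for k–f, (11, 22) for the commutation of d with k, (21, 12)
for e–f, and the commutation of an entry with itself at the two points for the rest. -/
theorem IsRTT.isGaussCurrents {A : Type*} [Ring A] {t : Fin 2 → Fin 2 → ℕ → A} (ht : IsRTT t)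
    {l : A⟦X⟧} (hl : l * PowerSeries.mk (t 1 1) = 1) (hl' : PowerSeries.mk (t 1 1) * l = 1) :
    IsGaussCurrents (PowerSeries.mk (t 1 1)) (l * PowerSeries.mk (t 0 1)) (PowerSeries.mk (t 1 0) * l)
      (PowerSeries.mk (t 0 0) * l - PowerSeries.mk (t 1 0) * l * PowerSeries.mk (t 0 1) * l) := by
  obtain ⟨k, hk⟩ : ∃ k, k = PowerSeries.mk (t 1 1) := ⟨_, rfl⟩
  obtain ⟨e, he⟩ : ∃ e, e = l * PowerSeries.mk (t 0 1) := ⟨_, rfl⟩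
  obtain ⟨f, hf⟩ : ∃ f, f = PowerSeries.mk (t 1 0) * l := ⟨_, rfl⟩
  obtain ⟨d, hd⟩ : ∃ d, d = PowerSeries.mk (t 0 0) - f * k * e := ⟨_, rfl⟩
  rw [← hk] at hl hl'
  have hke : PowerSeries.mk (t 0 1) = k * e := by rw [he, ← mul_assoc, hl', one_mul]
  have hfk : PowerSeries.mk (t 1 0) = f * k := by rw [hf, mul_assoc, hl, mul_one]
  have ht' : PowerSeries.mk (t 0 0) = d + f * k * e := by rw [hd, sub_add_cancel]
  have hh : PowerSeries.mk (t 0 0) * l - PowerSeries.mk (t 1 0) * l * PowerSeries.mk (t 0 1) * l = d * l := by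
    rw [hke, ← hf, hd]; noncomm_ring
  rw [hh, ← he, ← hf, ← hk]
  have hlF : firstPt l * firstPt k = 1 := by rw [← map_mul, hl, map_one]
  have hlF' : firstPt k * firstPt l = 1 := by rw [← map_mul, hl', map_one]
  have hlS : secondPt l * secondPt k = 1 := by rw [← map_mul, hl, map_one]
  have hlS' : secondPt k * secondPt l = 1 := by rw [← map_mul, hl', map_one]
  have kk := (ht.series_commute 1 1).symm
  have r1 := (ht.series_rel 0 1 1 1).2
  have r2 := (ht.series_rel 1 0 1 1).2
  have r3 := ht.series_commute 0 1
  have r4 := ht.series_commute 1 0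
  have r6 := (ht.series_rel 0 0 1 1).2
  have r7 := (ht.series_rel 1 0 0 1).2
  simp only [← hk, hke, hfk, map_mul firstPt, map_mul secondPt] at kk r1 r2 r3 r4 r6 r7
  have ke := current_ke hlS kk r1
  have kf := current_kf hlS' kk r2
  have hdk := current_dk diffNum_regular kk ke kf r6
  simp only [← map_mul secondPt, ← map_sub secondPt, ← hd] at hdk
  refine ⟨kk, ke, kf, ?_, ?_, ?_⟩
  · rw [map_mul, map_mul]
    refine current_ef diffNum_regular hlF hlF' hlS' kk (d := firstPt d) (d' := secondPt d)
      (t := firstPt (PowerSeries.mk (t 0 0))) (t' := secondPt (PowerSeries.mk (t 0 0))) ?_ ?_ ?_ hdk ke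
      (current_ke_swap ke) kf r7
    · rw [ht']; simp only [map_add, map_mul]
    · rw [ht']; simp only [map_add, map_mul]
    · rw [← map_mul, ← map_mul, commute_of_firstPt_secondPt hdk]
  · exact current_ee hlF hlS kk ke (current_ke_swap ke) r3
  · exact current_ff hlF' hlS' kk kf (current_kf_swap kf) r4

end YangianVerma

namespace YangianVerma
open PowerSeries

/-! ### The Drinfeld relations and the homomorphism to the Yangian of gl₂. -/

/-- The relations of `Y(sl₂)` for families of elements of a ring. -/
structure IsDrinfeld {A : Type*} [Ring A] (e h f : ℕ → A) : Prop where
  hh : ∀ r s, ⁅h r, h s⁆ = 0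
  ef : ∀ r s, ⁅e r, f s⁆ = h (r + s)
  h0e : ∀ s, ⁅h 0, e s⁆ = 2 * e s
  h0f : ∀ s, ⁅h 0, f s⁆ = -(2 * f s)
  he : ∀ r s, ⁅h (r + 1), e s⁆ - ⁅h r, e (s + 1)⁆ = h r * e s + e s * h r
  hf : ∀ r s, ⁅h (r + 1), f s⁆ - ⁅h r, f (s + 1)⁆ = -(h r * f s + f s * h r)
  ee : ∀ r s, ⁅e (r + 1), e s⁆ - ⁅e r, e (s + 1)⁆ = e r * e s + e s * e r
  ff : ∀ r s, ⁅f (r + 1), f s⁆ - ⁅f r, f (s + 1)⁆ = -(f r * f s + f s * f r)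

theorem isDrinfeld_slGen : IsDrinfeld slE slH slF where
  hh r s := by
    simpa [slH, slGen, Ring.lie_def] using RingQuot.mkAlgHom_rel ℂ (SlRel.hh r s)
  ef r s := by
    simpa [slE, slF, slH, slGen, Ring.lie_def] using RingQuot.mkAlgHom_rel ℂ (SlRel.ef r s)
  h0e s := by
    have := RingQuot.mkAlgHom_rel ℂ (SlRel.h0e s)
    rw [two_mul] at this ⊢
    simpa [slE, slH, slGen, Ring.lie_def] using this
  h0f s := by
    have := RingQuot.mkAlgHom_rel ℂ (SlRel.h0f s)
    rw [two_mul] at this ⊢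
    simpa [slF, slH, slGen, Ring.lie_def] using this
  he r s := by
    simpa [slE, slH, slGen, Ring.lie_def] using RingQuot.mkAlgHom_rel ℂ (SlRel.he r s)
  hf r s := by
    simpa [slF, slH, slGen, Ring.lie_def] using RingQuot.mkAlgHom_rel ℂ (SlRel.hf r s)
  ee r s := by
    simpa [slE, slGen, Ring.lie_def] using RingQuot.mkAlgHom_rel ℂ (SlRel.ee r s)
  ff r s := by
    simpa [slF, slGen, Ring.lie_def] using RingQuot.mkAlgHom_rel ℂ (SlRel.ff r s)

/-- A family of elements indexed by the generators of `Y(sl₂)`. -/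
def slFamily {A : Type*} (e h f : ℕ → A) : SlGen → A
  | .e r => e r
  | .h r => h r
  | .f r => f r

/-- The homomorphism from `Y(sl₂)` given by elements that satisfy its relations. -/
noncomputable def slLift {A : Type*} [Ring A] [Algebra ℂ A] {e h f : ℕ → A}
    (H : IsDrinfeld e h f) : YSl →ₐ[ℂ] A :=
  RingQuot.liftAlgHom ℂ ⟨FreeAlgebra.lift ℂ (slFamily e h f), by
    intro x y hxy
    cases hxy with
    | hh r s => simpa [slFamily, Ring.lie_def] using H.hh r s
    | ef r s => simpa [slFamily, Ring.lie_def] using H.ef r s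
    | h0e s => simpa [slFamily, Ring.lie_def, two_mul] using H.h0e s
    | h0f s => simpa [slFamily, Ring.lie_def, two_mul] using H.h0f s
    | he r s => simpa [slFamily, Ring.lie_def] using H.he r s
    | hf r s => simpa [slFamily, Ring.lie_def] using H.hf r s
    | ee r s => simpa [slFamily, Ring.lie_def] using H.ee r s
    | ff r s => simpa [slFamily, Ring.lie_def] using H.ff r s⟩

section

variable {A : Type*} [Ring A] [Algebra ℂ A] {e h f : ℕ → A} (H : IsDrinfeld e h f)

theorem slLift_slE (r : ℕ) : slLift H (slE r) = e r := by
  simp [slLift, slE, slGen, slFamily]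

theorem slLift_slH (r : ℕ) : slLift H (slH r) = h r := by
  simp [slLift, slH, slGen, slFamily]

theorem slLift_slF (r : ℕ) : slLift H (slF r) = f r := by
  simp [slLift, slF, slGen, slFamily]

end

theorem isRTT_glT : IsRTT glT where
  zero i j := by
    simp only [glT, glFree]
    split_ifs <;> simp
  rel i j k l r s := by
    simpa [glT, Ring.lie_def] using RingQuot.mkAlgHom_rel ℂ (GlRel.rtt i j k l r s)

theorem lift_glFree {A : Type*} [Ring A] [Algebra ℂ A] {t : Fin 2 → Fin 2 → ℕ → A} (ht : IsRTT t)
    (i j : Fin 2) (r : ℕ) :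
    FreeAlgebra.lift ℂ (fun x : Fin 2 × Fin 2 × ℕ => t x.1 x.2.1 (x.2.2 + 1)) (glFree i j r) =
      t i j r := by
  cases r with
  | zero =>
    rw [ht.zero, glFree]
    split_ifs <;> simp
  | succ r => simp [glFree]

/-- The homomorphism from `Y(gl₂)` given by elements that satisfy its relations. -/
noncomputable def glLift {A : Type*} [Ring A] [Algebra ℂ A] {t : Fin 2 → Fin 2 → ℕ → A}
    (ht : IsRTT t) : YGl →ₐ[ℂ] A :=
  RingQuot.liftAlgHom ℂ
    ⟨FreeAlgebra.lift ℂ (fun x : Fin 2 × Fin 2 × ℕ => t x.1 x.2.1 (x.2.2 + 1)), by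
      intro x y hxy
      cases hxy with
      | rtt i j k l r s =>
        simpa [lift_glFree ht, Ring.lie_def] using ht.rel i j k l r s⟩

theorem glLift_glT {A : Type*} [Ring A] [Algebra ℂ A] {t : Fin 2 → Fin 2 → ℕ → A}
    (ht : IsRTT t) (i j : Fin 2) (r : ℕ) : glLift ht (glT i j r) = t i j r := by
  rw [glLift, glT, RingQuot.liftAlgHom_mkAlgHom_apply, lift_glFree ht]

namespace IsGaussCurrents

variable {A : Type*} [Ring A] {k e f h : A⟦X⟧}

theorem coeff_ke (H : IsGaussCurrents k e f h) (n s : ℕ) :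
    ⁅coeff (n + 1) k, coeff (s + 1) e⁆ - ⁅coeff n k, coeff (s + 2) e⁆ =
      -(coeff n k * coeff (s + 1) e) := by
  have := (diffNum_smul_eq_iff.mp H.ke).2.2 n (s + 1)
  rw [← map_mul firstPt] at this
  simpa only [map_sub, coeff₂_first_mul_second, coeff₂_second_mul_first, coeff₂_first_succ,
    zero_sub, Ring.lie_def] using this

theorem coeff_kf (H : IsGaussCurrents k e f h) (n s : ℕ) :
    ⁅coeff (n + 1) k, coeff (s + 1) f⁆ - ⁅coeff n k, coeff (s + 2) f⁆ =
      coeff (s + 1) f * coeff n k := by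
  have := (diffNum_smul_eq_iff.mp H.kf).2.2 n (s + 1)
  rw [← map_mul firstPt] at this
  simpa only [map_sub, coeff₂_first_mul_second, coeff₂_second_mul_first, coeff₂_first_succ,
    sub_zero, Ring.lie_def] using this

theorem coeff_ee (H : IsGaussCurrents k e f h) (r s : ℕ) :
    ⁅coeff (r + 2) e, coeff (s + 1) e⁆ - ⁅coeff (r + 1) e, coeff (s + 2) e⁆ =
      coeff (r + 1) e * coeff (s + 1) e + coeff (s + 1) e * coeff (r + 1) e := by
  have h0 := H.ee
  rw [← smul_neg] at h0
  have := (diffNum_smul_eq_iff.mp h0).2.2 (r + 1) (s + 1)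
  simp only [sub_mul, mul_sub, ← map_mul firstPt, ← map_mul secondPt] at this
  simp only [map_sub, map_neg, coeff₂_first_mul_second, coeff₂_second_mul_first,
    coeff₂_first_succ, coeff₂_second_succ] at this
  simp only [Ring.lie_def]
  linear_combination (norm := noncomm_ring) this

theorem coeff_ff (H : IsGaussCurrents k e f h) (r s : ℕ) :
    ⁅coeff (r + 2) f, coeff (s + 1) f⁆ - ⁅coeff (r + 1) f, coeff (s + 2) f⁆ =
      -(coeff (r + 1) f * coeff (s + 1) f + coeff (s + 1) f * coeff (r + 1) f) := by
  have := (diffNum_smul_eq_iff.mp H.ff).2.2 (r + 1) (s + 1)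
  simp only [sub_mul, mul_sub, ← map_mul firstPt, ← map_mul secondPt] at this
  simp only [map_sub, coeff₂_first_mul_second, coeff₂_second_mul_first,
    coeff₂_first_succ, coeff₂_second_succ] at this
  simp only [Ring.lie_def]
  linear_combination (norm := noncomm_ring) this

/-- The right side of the e–f current relation has coefficients only in the first row and column. So
the bracket depends only on r + s, and the first row identifies it. -/
theorem coeff_ef (H : IsGaussCurrents k e f h) (he : coeff 0 e = 0) (r s : ℕ) :
    ⁅coeff (r + 1) e, coeff (s + 1) f⁆ = coeff (r + s + 1) h := by
  induction r generalizing s with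
  | zero =>
    have := (diffNum_smul_eq_iff.mp H.ef).2.2 0 (s + 1)
    simpa [map_sub, coeff₂_first_mul_second, coeff₂_second_mul_first, coeff₂_first_succ,
      coeff₂_second_zero, he, Ring.lie_def, -coeff_zero_eq_constantCoeff] using this
  | succ r ih =>
    have := (diffNum_smul_eq_iff.mp H.ef).2.2 (r + 1) (s + 1)
    simp only [map_sub, coeff₂_first_mul_second, coeff₂_second_mul_first, coeff₂_first_succ,
      coeff₂_second_succ, sub_self] at this
    rw [Nat.add_right_comm r 1 s, add_assoc r s 1, ← ih (s + 1)]
    exact sub_eq_zero.mp this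

/-- The coefficients of k supply the shifting element ρ; with it all relations that involve h reduce
to [e, f] = h, the e–e and f–f relations, and the action of the first coefficient of h on the first
coefficients of e and f. -/
theorem isDrinfeld [Algebra ℂ A] (H : IsGaussCurrents k e f h) (hk : coeff 0 k = 1)
    (he : coeff 0 e = 0)
    (h0e : ⁅coeff 1 h, coeff 1 e⁆ = 2 * coeff 1 e) (h0f : ⁅coeff 1 h, coeff 1 f⁆ = -(2 * coeff 1 f)) :
    IsDrinfeld (fun r => coeff (r + 1) e) (fun r => coeff (r + 1) h)
      (fun r => coeff (r + 1) f) := by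
  have two : ∀ a : A, 2 * a = 0 → a = 0 := by
    intro a ha
    have h1 : (2 : ℂ) • a = 0 := by rwa [two_smul, ← two_mul]
    exact (smul_eq_zero.mp h1).resolve_left two_ne_zero
  have ke0 := fun s => H.coeff_ke 0 s
  have ke1 := fun s => H.coeff_ke 1 s
  have kf0 := fun s => H.coeff_kf 0 s
  have kf1 := fun s => H.coeff_kf 1 s
  rw [hk] at ke0 kf0
  -- The second coefficient of k sends e^{(s)} to -e^{(s+1)} minus a product with the first
  -- coefficient of k; the quadratic and linear terms remove this product, so that ρ shifts the
  -- indices exactly.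
  set ρ := coeff 1 k * coeff 1 k - coeff 1 k - 2 * coeff 2 k with hρ
  have hρe : ∀ s, ⁅ρ, coeff (s + 1) e⁆ = 2 * coeff (s + 1 + 1) e := by
    intro s
    have a1 := ke0 s
    have a2 := ke0 (s + 1)
    have a3 := ke1 s
    simp only [Ring.lie_def, hρ, Nat.reduceAdd, add_assoc] at *
    linear_combination (norm := noncomm_ring) coeff 1 k * a1 + a1 * coeff 1 k - 2 * a3
      - 2 * a2
  have hρf : ∀ s, ⁅ρ, coeff (s + 1) f⁆ = -(2 * coeff (s + 1 + 1) f) := by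
    intro s
    have a1 := kf0 s
    have a2 := kf0 (s + 1)
    have a3 := kf1 s
    simp only [Ring.lie_def, hρ, Nat.reduceAdd, add_assoc] at *
    linear_combination (norm := noncomm_ring) coeff 1 k * a1 + a1 * coeff 1 k - 2 * a3
      - 2 * a2
  have ef := H.coeff_ef he
  have hρh := fun n => shift_commute_h (e := fun r => coeff (r + 1) e)
    (h := fun r => coeff (r + 1) h) (f := fun r => coeff (r + 1) f) hρe hρf ef n
  have HE := fun r s => he_of_shift (e := fun r => coeff (r + 1) e)
    (h := fun r => coeff (r + 1) h) (f := fun r => coeff (r + 1) f) two hρe hρh ef H.coeff_ee r s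
  have HF := fun r s => hf_of_shift (e := fun r => coeff (r + 1) e)
    (h := fun r => coeff (r + 1) h) (f := fun r => coeff (r + 1) f) two hρf hρh ef H.coeff_ff r s
  -- Since ρ commutes with the first coefficient of h, bracketing with ρ passes from s to s + 1.
  have H0E : ∀ s, ⁅coeff 1 h, coeff (s + 1) e⁆ = 2 * coeff (s + 1) e := by
    intro s
    induction s with
    | zero => exact h0e
    | succ s ih =>
      rw [← sub_eq_zero]
      apply two
      have a1 := hρe s
      have a2 := hρh 0
      simp only [Ring.lie_def, zero_add] at *
      linear_combination (norm := noncomm_ring) ρ * ih - ih * ρ - coeff 1 h * a1 + a1 * coeff 1 h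
        - a2 * coeff (s + 1) e + coeff (s + 1) e * a2 + 2 * a1
  have H0F : ∀ s, ⁅coeff 1 h, coeff (s + 1) f⁆ = -(2 * coeff (s + 1) f) := by
    intro s
    induction s with
    | zero => exact h0f
    | succ s ih =>
      rw [← sub_eq_zero]
      apply two
      have a1 := hρf s
      have a2 := hρh 0
      simp only [Ring.lie_def, zero_add] at *
      linear_combination (norm := noncomm_ring) ih * ρ - ρ * ih + coeff 1 h * a1 - a1 * coeff 1 h
        + a2 * coeff (s + 1) f - coeff (s + 1) f * a2 + 2 * a1
  exact ⟨fun r s => hh_of_he_hf (e := fun r => coeff (r + 1) e)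
    (h := fun r => coeff (r + 1) h) (f := fun r => coeff (r + 1) f) ef H0E H0F HE HF r s, ef, H0E, H0F, HE, HF, H.coeff_ee, H.coeff_ff⟩

end IsGaussCurrents

theorem isGaussCurrents_glSeries : IsGaussCurrents (glSeries 1 1) glSeriesE glSeriesF glSeriesH :=
  isRTT_glT.isGaussCurrents glSeriesInv_mul glSeries_mul_inv

theorem constantCoeff_glSeries (i j : Fin 2) :
    constantCoeff (glSeries i j) = if i = j then 1 else 0 := by
  rw [← coeff_zero_eq_constantCoeff_apply, glSeries, coeff_mk, isRTT_glT.zero]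

theorem constantCoeff_glSeriesInv : constantCoeff glSeriesInv = 1 := by
  simp [glSeriesInv]

theorem coeff_one_glSeriesE : coeff 1 glSeriesE = glT 0 1 1 := by
  rw [glSeriesE, coeff_mul, Finset.Nat.sum_antidiagonal_eq_sum_range_succ_mk]
  simp [Finset.sum_range_succ, constantCoeff_glSeries, constantCoeff_glSeriesInv]
  simp [glSeries]

theorem coeff_one_glSeriesF : coeff 1 glSeriesF = glT 1 0 1 := by
  rw [glSeriesF, coeff_mul, Finset.Nat.sum_antidiagonal_eq_sum_range_succ_mk]
  simp [Finset.sum_range_succ, constantCoeff_glSeries, constantCoeff_glSeriesInv]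
  simp [glSeries]

theorem isDrinfeld_glSeries : IsDrinfeld (fun r => coeff (r + 1) glSeriesE)
    (fun r => coeff (r + 1) glSeriesH) (fun r => coeff (r + 1) glSeriesF) := by
  have he : coeff 0 glSeriesE = 0 := by
    simp [glSeriesE, constantCoeff_glSeries]
  have h1 : coeff 1 glSeriesH = glT 0 0 1 - glT 1 1 1 := by
    have h2 := isGaussCurrents_glSeries.coeff_ef he 0 0
    rw [zero_add, coeff_one_glSeriesE, coeff_one_glSeriesF] at h2
    have h3 := isRTT_glT.rel 0 1 1 0 0 1
    simp only [isRTT_glT.zero, zero_add] at h3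
    rw [← h2]
    simpa [Ring.lie_def] using h3
  refine isGaussCurrents_glSeries.isDrinfeld ?_ he ?_ ?_
  · rw [coeff_zero_eq_constantCoeff_apply, constantCoeff_glSeries, if_pos rfl]
  · have h3 := isRTT_glT.rel 0 0 0 1 0 1
    have h4 := isRTT_glT.rel 1 1 0 1 0 1
    simp only [isRTT_glT.zero, zero_add, Ring.lie_def] at h3 h4
    rw [h1, coeff_one_glSeriesE, Ring.lie_def, sub_mul, mul_sub]
    simp at h3 h4
    linear_combination (norm := noncomm_ring) h3 - h4
  · have h3 := isRTT_glT.rel 0 0 1 0 0 1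
    have h4 := isRTT_glT.rel 1 1 1 0 0 1
    simp only [isRTT_glT.zero, zero_add, Ring.lie_def] at h3 h4
    rw [h1, coeff_one_glSeriesF, Ring.lie_def, sub_mul, mul_sub]
    simp at h3 h4
    linear_combination (norm := noncomm_ring) h3 - h4

/-- The homomorphism from `Y(sl₂)` to `Y(gl₂)`. -/
noncomputable def slToGl : YSl →ₐ[ℂ] YGl := slLift isDrinfeld_glSeries

theorem slToGl_slE (r : ℕ) : slToGl (slE r) = coeff (r + 1) glSeriesE := slLift_slE _ r

theorem slToGl_slH (r : ℕ) : slToGl (slH r) = coeff (r + 1) glSeriesH := slLift_slH _ r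

theorem slToGl_slF (r : ℕ) : slToGl (slF r) = coeff (r + 1) glSeriesF := slLift_slF _ r

end YangianVerma

namespace YangianVerma
open PowerSeries

/-! ### All RTT relations from a few of them. -/

section FromGaussCurrents

variable {A : Type*} [Ring A]

theorem ring_lie_mul (x a b : A) : ⁅x, a * b⁆ = ⁅x, a⁆ * b + a * ⁅x, b⁆ := by
  simp only [Ring.lie_def]; noncomm_ring

theorem ring_lie_sub (x a b : A) : ⁅x, a - b⁆ = ⁅x, a⁆ - ⁅x, b⁆ := by
  simp only [Ring.lie_def]; noncomm_ring

theorem ring_lie_lie (x a b : A) : ⁅x, ⁅a, b⁆⁆ = ⁅⁅x, a⁆, b⁆ + ⁅a, ⁅x, b⁆⁆ := by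
  simp only [Ring.lie_def]; noncomm_ring

/-- The relation of `Y(gl₂)` for two entries. -/
def EntryRel (t : Fin 2 → Fin 2 → ℕ → A) (i j k l : Fin 2) : Prop :=
  ∀ r s, ⁅t i j (r + 1), t k l s⁆ - ⁅t i j r, t k l (s + 1)⁆ = t k j r * t i l s - t k j s * t i l r

theorem EntryRel.one {t : Fin 2 → Fin 2 → ℕ → A} (h0 : ∀ i j, t i j 0 = if i = j then 1 else 0)
    {i j k l : Fin 2} (h : EntryRel t i j k l) (s : ℕ) :
    ⁅t i j 1, t k l s⁆ = (if k = j then t i l s else 0) - (if i = l then t k j s else 0) := by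
  have := h 0 s
  rw [h0 i j, h0 k j, h0 i l] at this
  rw [zero_add] at this
  split_ifs at this ⊢ <;> simpa [Ring.lie_def] using this

/-- The given relations are those without `t 0 0` on the left, plus the brackets of `t 0 0 1` with
the off-diagonal entries. The elements `t 0 1 1` and `t 1 0 1` act on all entries by the commutators
of gl₂, so bracketing a known relation with one of them yields a missing one up to known ones. -/
theorem isRTT_of_entryRel {t : Fin 2 → Fin 2 → ℕ → A}
    (h0 : ∀ i j, t i j 0 = if i = j then 1 else 0)
    (hkk : ∀ r s, t 1 1 r * t 1 1 s = t 1 1 s * t 1 1 r)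
    (hee : ∀ r s, t 0 1 r * t 0 1 s = t 0 1 s * t 0 1 r)
    (hff : ∀ r s, t 1 0 r * t 1 0 s = t 1 0 s * t 1 0 r)
    (hke : EntryRel t 1 1 0 1) (hek : EntryRel t 0 1 1 1)
    (hkf : EntryRel t 1 1 1 0) (hfk : EntryRel t 1 0 1 1)
    (hef : EntryRel t 0 1 1 0) (hfe : EntryRel t 1 0 0 1)
    (hde : ∀ s, ⁅t 0 0 1, t 0 1 s⁆ = t 0 1 s) (hdf : ∀ s, ⁅t 0 0 1, t 1 0 s⁆ = -t 1 0 s) :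
    IsRTT t := by
  have e11 : ∀ s, ⁅t 0 1 1, t 1 1 s⁆ = t 0 1 s := fun s => by simpa using hek.one h0 s
  have e10 : ∀ s, ⁅t 0 1 1, t 1 0 s⁆ = t 0 0 s - t 1 1 s := fun s => by simpa using hef.one h0 s
  have e01 : ∀ s, ⁅t 0 1 1, t 0 1 s⁆ = 0 := fun s => by rw [Ring.lie_def, hee, sub_self]
  have f11 : ∀ s, ⁅t 1 0 1, t 1 1 s⁆ = -t 1 0 s := fun s => by simpa using hfk.one h0 s
  have f01 : ∀ s, ⁅t 1 0 1, t 0 1 s⁆ = t 1 1 s - t 0 0 s := fun s => by simpa using hfe.one h0 s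
  have f10 : ∀ s, ⁅t 1 0 1, t 1 0 s⁆ = 0 := fun s => by rw [Ring.lie_def, hff, sub_self]
  -- Here `t 0 0 s` is replaced by `t 1 1 s` minus the bracket of `t 1 0 1` with `t 0 1 s`, and the
  -- Jacobi identity is used.
  have e00 : ∀ s, ⁅t 0 1 1, t 0 0 s⁆ = -t 0 1 s := by
    intro s
    have a1 := f01 s
    have a2 := f01 1
    have a3 := e11 s
    have a4 := hde s
    have a5 := hke.one h0 s
    have a6 := hee 1 s
    simp [Ring.lie_def] at *
    linear_combination (norm := noncomm_ring) t 0 1 1 * a1 - a1 * t 0 1 1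
      + a2 * t 0 1 s - t 0 1 s * a2 + a3 - a4 + a5 - t 1 0 1 * a6 + a6 * t 1 0 1
  have f00 : ∀ s, ⁅t 1 0 1, t 0 0 s⁆ = t 1 0 s := by
    intro s
    have a1 := e10 s
    have a2 := e10 1
    have a3 := f11 s
    have a4 := hdf s
    have a5 := hkf.one h0 s
    have a6 := hff 1 s
    simp [Ring.lie_def] at *
    linear_combination (norm := noncomm_ring) a1 * t 1 0 1 - t 1 0 1 * a1
      - a2 * t 1 0 s + t 1 0 s * a2 + a3 - a4 + a5 + t 0 1 1 * a6 - a6 * t 0 1 1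
  have kk : EntryRel t 1 1 1 1 := by
    intro r s
    simp only [Ring.lie_def, hkk _ s, hkk _ (s + 1), sub_self]
  have ee : EntryRel t 0 1 0 1 := by
    intro r s
    simp only [Ring.lie_def, hee _ s, hee _ (s + 1), sub_self]
  have ff : EntryRel t 1 0 1 0 := by
    intro r s
    simp only [Ring.lie_def, hff _ s, hff _ (s + 1), sub_self]
  have r1100 : EntryRel t 1 1 0 0 := by
    intro r s
    have a := congrArg (fun z => ⁅t 1 0 1, z⁆) (hke r s)
    have b := hfe r s
    have c := hkk r s
    have c1 := hkk (r + 1) s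
    have c2 := hkk r (s + 1)
    simp only [ring_lie_sub, ring_lie_lie, ring_lie_mul, f11, f01] at a
    simp only [Ring.lie_def] at *
    linear_combination (norm := noncomm_ring) -a - b + c1 - c2 - c
  have r0011 : EntryRel t 0 0 1 1 := by
    intro r s
    have a := congrArg (fun z => ⁅t 0 1 1, z⁆) (hfk r s)
    have b := hfe r s
    have c := hkk r s
    have c1 := hkk (r + 1) s
    have c2 := hkk r (s + 1)
    simp only [ring_lie_sub, ring_lie_lie, ring_lie_mul, e11, e10] at a
    simp only [Ring.lie_def] at *
    linear_combination (norm := noncomm_ring) a - b + c1 - c2 - c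
  have r0001 : EntryRel t 0 0 0 1 := by
    intro r s
    have a := congrArg (fun z => ⁅t 0 1 1, z⁆) (hfe r s)
    have b := hke r s
    simp only [ring_lie_sub, ring_lie_lie, ring_lie_mul, e11, e10, e00, e01] at a
    simp only [Ring.lie_def] at *
    linear_combination (norm := noncomm_ring) a + b
  have r0100 : EntryRel t 0 1 0 0 := by
    intro r s
    have a := congrArg (fun z => ⁅t 0 1 1, z⁆) (hef r s)
    have b := hek r s
    simp only [ring_lie_sub, ring_lie_lie, ring_lie_mul, e11, e10, e00, e01] at a
    simp only [Ring.lie_def] at *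
    linear_combination (norm := noncomm_ring) a + b
  have r0010 : EntryRel t 0 0 1 0 := by
    intro r s
    have a := congrArg (fun z => ⁅t 1 0 1, z⁆) (hef r s)
    have b := hkf r s
    simp only [ring_lie_sub, ring_lie_lie, ring_lie_mul, f11, f10, f00, f01] at a
    simp only [Ring.lie_def] at *
    linear_combination (norm := noncomm_ring) b - a
  have r1000 : EntryRel t 1 0 0 0 := by
    intro r s
    have a := congrArg (fun z => ⁅t 1 0 1, z⁆) (hfe r s)
    have b := hfk r s
    simp only [ring_lie_sub, ring_lie_lie, ring_lie_mul, f11, f10, f00, f01] at a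
    simp only [Ring.lie_def] at *
    linear_combination (norm := noncomm_ring) b - a
  have r0000 : EntryRel t 0 0 0 0 := by
    intro r s
    have a := congrArg (fun z => ⁅t 0 1 1, z⁆) (r0010 r s)
    have b := hef r s
    have c := r0011 r s
    simp only [ring_lie_sub, ring_lie_lie, ring_lie_mul, e10, e00] at a
    simp only [Ring.lie_def] at *
    linear_combination (norm := noncomm_ring) a + b + c
  refine ⟨h0, fun i j k l => ?_⟩
  fin_cases i <;> fin_cases j <;> fin_cases k <;> fin_cases l
  exacts [r0000, r0001, r0010, r0011, r0100, ee, hef, hek, r1000, hfe, ff, hfk, r1100, hke, hkf, kk]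

end FromGaussCurrents
end YangianVerma

namespace YangianVerma
open PowerSeries

/-! ### From Gauss currents to the RTT relations. -/

section GaussEntries

variable {A : Type*} [Ring A]

/-- The entries of the generating matrix of `Y(gl₂)` in terms of the Gauss currents. -/
noncomputable def gaussEntry (k h e f : A⟦X⟧) : Fin 2 → Fin 2 → A⟦X⟧ :=
  ![![h * k + f * k * e, k * e], ![f * k, k]]

theorem coeff_mul_range (a b : A⟦X⟧) (n : ℕ) :
    coeff n (a * b) = ∑ i ∈ Finset.range n, coeff i a * coeff (n - i) b + coeff n a * coeff 0 b := by
  rw [coeff_mul, Finset.Nat.sum_antidiagonal_eq_sum_range_succ_mk, Finset.sum_range_succ,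
    Nat.sub_self]

theorem coeff_mul_range' (a b : A⟦X⟧) (n : ℕ) :
    coeff n (a * b) = ∑ i ∈ Finset.range n, coeff (n - i) a * coeff i b + coeff 0 a * coeff n b := by
  rw [coeff_mul, ← Finset.Nat.sum_antidiagonal_swap,
    Finset.Nat.sum_antidiagonal_eq_sum_range_succ_mk, Finset.sum_range_succ]
  simp

variable {k h e f : A⟦X⟧}

/-- Telescoping the recursion down to coefficient 0 of k, which is central. For s = 0 and vanishing
constant term of e, the sum is the coefficient of the product k e. -/
theorem lie_coeff_ke (hk : coeff 0 k = 1)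
    (hke : ∀ n s, ⁅coeff (n + 1) k, coeff (s + 1) e⁆ - ⁅coeff n k, coeff (s + 2) e⁆ =
      -(coeff n k * coeff (s + 1) e)) (n s : ℕ) :
    ⁅coeff n k, coeff (s + 1) e⁆ =
      -∑ i ∈ Finset.range n, coeff i k * coeff (s + (n - i)) e := by
  induction n generalizing s with
  | zero => simp [hk, Ring.lie_def, -coeff_zero_eq_constantCoeff]
  | succ n ih =>
    have h1 : ∑ i ∈ Finset.range n, coeff i k * coeff (s + (n + 1 - i)) e =
        ∑ i ∈ Finset.range n, coeff i k * coeff (s + 1 + (n - i)) e := by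
      refine Finset.sum_congr rfl fun i hi => ?_
      have := Finset.mem_range.mp hi
      congr 3
      omega
    have h2 := ih (s + 1)
    rw [Finset.sum_range_succ, h1, Nat.add_sub_cancel_left, neg_add, ← h2, ← hke n s]
    abel

theorem lie_coeff_kf (hk : coeff 0 k = 1)
    (hkf : ∀ n s, ⁅coeff (n + 1) k, coeff (s + 1) f⁆ - ⁅coeff n k, coeff (s + 2) f⁆ =
      coeff (s + 1) f * coeff n k) (n s : ℕ) :
    ⁅coeff n k, coeff (s + 1) f⁆ =
      ∑ i ∈ Finset.range n, coeff (s + (n - i)) f * coeff i k := by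
  induction n generalizing s with
  | zero => simp [hk, Ring.lie_def, -coeff_zero_eq_constantCoeff]
  | succ n ih =>
    have h1 : ∑ i ∈ Finset.range n, coeff (s + (n + 1 - i)) f * coeff i k =
        ∑ i ∈ Finset.range n, coeff (s + 1 + (n - i)) f * coeff i k := by
      refine Finset.sum_congr rfl fun i hi => ?_
      have := Finset.mem_range.mp hi
      congr 3
      omega
    have h2 := ih (s + 1)
    rw [Finset.sum_range_succ, h1, Nat.add_sub_cancel_left, ← h2, ← hkf n s]
    abel

/-- The anticommutator relation of a current with itself gives its square. -/
theorem two_mul_bracket_one {b : ℕ → ℕ → A} (he : coeff 0 e = 0) (hb0 : ∀ n, b 0 n = 0)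
    (hb : ∀ r s, b r s = -b s r)
    (hee : ∀ r s, b (r + 2) (s + 1) - b (r + 1) (s + 2) =
      coeff (r + 1) e * coeff (s + 1) e + coeff (s + 1) e * coeff (r + 1) e) (n : ℕ) :
    2 * b n 1 = 2 * coeff n (e * e) := by
  -- Telescoping along the antidiagonal down to the bracket with first index 1. For s = 0 that
  -- bracket is the negative of the left side, which explains the factor 2 in the conclusion.
  have key : ∀ n s, b (n + 1) (s + 1) = b 1 (s + n + 1) +
      ∑ i ∈ Finset.range n, (coeff (i + 1) e * coeff (s + n - i) e +
        coeff (s + n - i) e * coeff (i + 1) e) := by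
    intro n
    induction n with
    | zero => intro s; simp
    | succ n ih =>
      intro s
      have h1 : ∑ i ∈ Finset.range n, (coeff (i + 1) e * coeff (s + (n + 1) - i) e +
          coeff (s + (n + 1) - i) e * coeff (i + 1) e) =
          ∑ i ∈ Finset.range n, (coeff (i + 1) e * coeff (s + 1 + n - i) e +
          coeff (s + 1 + n - i) e * coeff (i + 1) e) := by
        refine Finset.sum_congr rfl fun i _ => ?_
        rw [add_right_comm s 1 n, add_assoc s n 1]
      have h2 := ih (s + 1)
      have h3 : s + (n + 1) - n = s + 1 := by omega
      have h4 : s + (n + 1) + 1 = s + 1 + n + 1 := by omega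
      rw [Finset.sum_range_succ, h1, h3, h4, ← add_assoc, ← h2, ← hee n s]
      abel
  cases n with
  | zero => rw [hb0, coeff_mul_range, he]; simp
  | succ n =>
    have h1 := key n 0
    have h2 : ∑ i ∈ Finset.range n, coeff (n - i) e * coeff (i + 1) e =
        ∑ i ∈ Finset.range n, coeff (i + 1) e * coeff (n - i) e := by
      rw [← Finset.sum_range_reflect]
      refine Finset.sum_congr rfl fun i hi => ?_
      have := Finset.mem_range.mp hi
      congr 3 <;> omega
    have h3 : coeff (n + 1) (e * e) = ∑ i ∈ Finset.range n, coeff (i + 1) e * coeff (n - i) e := by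
      rw [coeff_mul_range, Finset.sum_range_succ', he, mul_zero, zero_mul, add_zero, add_zero]
      refine Finset.sum_congr rfl fun i hi => ?_
      rw [Nat.add_sub_add_right]
    simp only [zero_add, Finset.sum_add_distrib] at h1
    rw [h2, ← h3, hb 1] at h1
    linear_combination (norm := noncomm_ring) h1

/-- The two-point relations contain more than the recursions between positive indices: in the first
row and column the products k e, f k, e² and f² at one point appear. These are recovered by
telescoping the recursions. -/
theorem isGaussCurrents_of_coeff [Algebra ℂ A] (hk : coeff 0 k = 1) (he : coeff 0 e = 0)
    (hf : coeff 0 f = 0) (hkk : ∀ r s, coeff r k * coeff s k = coeff s k * coeff r k)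
    (hke : ∀ n s, ⁅coeff (n + 1) k, coeff (s + 1) e⁆ - ⁅coeff n k, coeff (s + 2) e⁆ =
      -(coeff n k * coeff (s + 1) e))
    (hkf : ∀ n s, ⁅coeff (n + 1) k, coeff (s + 1) f⁆ - ⁅coeff n k, coeff (s + 2) f⁆ =
      coeff (s + 1) f * coeff n k)
    (hef : ∀ r s, ⁅coeff (r + 1) e, coeff (s + 1) f⁆ = coeff (r + s + 1) h)
    (hee : ∀ r s, ⁅coeff (r + 2) e, coeff (s + 1) e⁆ - ⁅coeff (r + 1) e, coeff (s + 2) e⁆ =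
      coeff (r + 1) e * coeff (s + 1) e + coeff (s + 1) e * coeff (r + 1) e)
    (hff : ∀ r s, ⁅coeff (r + 2) f, coeff (s + 1) f⁆ - ⁅coeff (r + 1) f, coeff (s + 2) f⁆ =
      -(coeff (r + 1) f * coeff (s + 1) f + coeff (s + 1) f * coeff (r + 1) f)) :
    IsGaussCurrents k e f h := by
  have two : ∀ a b : A, 2 * a = 2 * b → a = b := by
    intro a b hab
    have h1 : (2 : ℂ) • (a - b) = 0 := by
      rw [two_smul, ← two_mul, mul_sub, hab, sub_self]
    exact sub_eq_zero.mp ((smul_eq_zero.mp h1).resolve_left two_ne_zero)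
  have he2 : ∀ n, ⁅coeff n e, coeff 1 e⁆ = coeff n (e * e) := fun n =>
    two _ _ (two_mul_bracket_one (b := fun r s => ⁅coeff r e, coeff s e⁆) he
      (fun n => by simp [he, Ring.lie_def, -coeff_zero_eq_constantCoeff])
      (fun r s => by simp [Ring.lie_def]) hee n)
  have hf2 : ∀ n, ⁅coeff 1 f, coeff n f⁆ = coeff n (f * f) := fun n =>
    two _ _ (two_mul_bracket_one (b := fun r s => ⁅coeff s f, coeff r f⁆) hf
      (fun n => by simp [hf, Ring.lie_def, -coeff_zero_eq_constantCoeff])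
      (fun r s => by simp [Ring.lie_def])
      (fun r s => by
        have := hff s r
        simp only [Ring.lie_def] at *
        linear_combination (norm := noncomm_ring) -this) n)
  have comm0 : ∀ a b : A⟦X⟧, (coeff 0 a = 0 ∨ coeff 0 a = 1) → ∀ n,
      coeff 0 a * coeff n b - coeff n b * coeff 0 a = 0 := by
    rintro a b (h0 | h0) n <;> simp [h0, -coeff_zero_eq_constantCoeff]
  have comm1 : ∀ a b : A⟦X⟧, (coeff 0 a = 0 ∨ coeff 0 a = 1) → ∀ n,
      coeff n b * coeff 0 a - coeff 0 a * coeff n b = 0 := by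
    rintro a b (h0 | h0) n <;> simp [h0, -coeff_zero_eq_constantCoeff]
  refine ⟨?_, ?_, ?_, ?_, ?_, ?_⟩
  · apply ext₂
    intro n m
    rw [coeff₂_first_mul_second, coeff₂_second_mul_first, hkk]
  · rw [diffNum_smul_eq_iff]
    simp only [← map_mul firstPt]
    simp only [map_sub, coeff₂_first_mul_second, coeff₂_second_mul_first]
    refine ⟨comm0 _ _ (Or.inr hk), comm1 _ _ (Or.inl he), fun n m => ?_⟩
    cases m with
    | zero =>
      have h1 := lie_coeff_ke hk hke n 0
      simp only [zero_add] at h1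
      have h2 := coeff_mul_range k e n
      rw [← neg_eq_iff_eq_neg.mpr h1, he, mul_zero, add_zero] at h2
      rw [coeff₂_first_zero, h2, he]
      simp only [Ring.lie_def]
      noncomm_ring
    | succ m =>
      rw [coeff₂_first_succ, zero_sub]
      exact hke n m
  · rw [diffNum_smul_eq_iff]
    simp only [← map_mul firstPt]
    simp only [map_sub, coeff₂_first_mul_second, coeff₂_second_mul_first]
    refine ⟨comm0 _ _ (Or.inr hk), comm1 _ _ (Or.inl hf), fun n m => ?_⟩
    cases m with
    | zero =>
      have h1 := lie_coeff_kf hk hkf n 0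
      simp only [zero_add] at h1
      have h2 := coeff_mul_range' f k n
      rw [← h1, hf, zero_mul, add_zero] at h2
      rw [coeff₂_first_zero, h2, hf]
      simp only [Ring.lie_def]
      noncomm_ring
    | succ m =>
      rw [coeff₂_first_succ, sub_zero]
      exact hkf n m
  · rw [diffNum_smul_eq_iff]
    simp only [map_sub, coeff₂_first_mul_second, coeff₂_second_mul_first]
    refine ⟨comm0 _ _ (Or.inl he), comm1 _ _ (Or.inl hf), fun n m => ?_⟩
    cases n with
    | zero =>
      cases m with
      | zero =>
        rw [coeff₂_first_zero, coeff₂_second_zero, he, hf]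
        simp
      | succ m =>
        have := hef 0 m
        rw [zero_add, zero_add] at this
        rw [coeff₂_first_succ, coeff₂_second_zero, he, ← this]
        simp [Ring.lie_def]
    | succ n =>
      cases m with
      | zero =>
        have := hef n 0
        rw [zero_add, add_zero] at this
        rw [coeff₂_first_zero, coeff₂_second_succ, hf, ← this]
        simp [Ring.lie_def]
      | succ m =>
        have h1 := hef (n + 1) m
        have h2 := hef n (m + 1)
        rw [Nat.add_right_comm n 1 m, add_assoc n m 1, ← h2] at h1
        rw [coeff₂_first_succ, coeff₂_second_succ, sub_zero]
        exact sub_eq_zero.mpr h1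
  · rw [← smul_neg, diffNum_smul_eq_iff]
    simp only [sub_mul, mul_sub, ← map_mul firstPt, ← map_mul secondPt]
    simp only [map_sub, map_neg, coeff₂_first_mul_second, coeff₂_second_mul_first]
    refine ⟨comm0 _ _ (Or.inl he), comm1 _ _ (Or.inl he), fun n m => ?_⟩
    have he2n := he2 n
    have he2m := he2 m
    rcases n with _ | n <;> rcases m with _ | m <;>
      simp only [coeff₂_first_zero, coeff₂_second_zero, coeff₂_first_succ, coeff₂_second_succ,
        he, Ring.lie_def, zero_add, add_assoc, Nat.reduceAdd] at *
    · linear_combination (norm := noncomm_ring) -2 * he2n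
    · linear_combination (norm := noncomm_ring) -he2m
    · linear_combination (norm := noncomm_ring) -he2n
    · linear_combination (norm := noncomm_ring) hee n m
  · rw [diffNum_smul_eq_iff]
    simp only [sub_mul, mul_sub, ← map_mul firstPt, ← map_mul secondPt]
    simp only [map_sub, coeff₂_first_mul_second, coeff₂_second_mul_first]
    refine ⟨comm0 _ _ (Or.inl hf), comm1 _ _ (Or.inl hf), fun n m => ?_⟩
    have hf2n := hf2 n
    have hf2m := hf2 m
    rcases n with _ | n <;> rcases m with _ | m <;>
      simp only [coeff₂_first_zero, coeff₂_second_zero, coeff₂_first_succ, coeff₂_second_succ,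
        hf, Ring.lie_def, zero_add, add_assoc, Nat.reduceAdd] at *
    · linear_combination (norm := noncomm_ring) 2 * hf2n
    · linear_combination (norm := noncomm_ring) hf2m
    · linear_combination (norm := noncomm_ring) hf2n
    · linear_combination (norm := noncomm_ring) hff n m

theorem current_ef_swap
    (hef : diffNum A • (firstPt e * secondPt f - secondPt f * firstPt e) =
      diffDen A • (secondPt h - firstPt h)) :
    (-diffNum A) • (secondPt e * firstPt f - firstPt f * secondPt e) =
      diffDen A • (firstPt h - secondPt h) := by
  rw [neg_smul, ← smul_neg]
  rw [diffNum_smul_eq_iff] at hef ⊢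
  simp only [map_sub, map_neg, coeff₂_first_mul_second, coeff₂_second_mul_first] at hef ⊢
  obtain ⟨h1, h2, h3⟩ := hef
  refine ⟨fun m => ?_, fun n => ?_, fun n m => ?_⟩
  · rw [h2 m, neg_zero]
  · rw [h1 n, neg_zero]
  · have := h3 m n
    cases n <;> cases m <;>
      simp only [coeff₂_first_zero, coeff₂_second_zero, coeff₂_first_succ, coeff₂_second_succ]
        at this ⊢ <;>
      linear_combination (norm := noncomm_ring) this

/-- This is the Gauss decomposition in reverse. It requires in addition that h commutes with k, so
that the diagonal part h k of the entry t₁₁ commutes with k at the other point. -/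
theorem isRTT_gaussEntry [Algebra ℂ A] (hk : coeff 0 k = 1) (hh : coeff 0 h = 1)
    (he : coeff 0 e = 0) (hf : coeff 0 f = 0)
    (hkk : ∀ r s, coeff r k * coeff s k = coeff s k * coeff r k)
    (hhk : ∀ r s, coeff r h * coeff s k = coeff s k * coeff r h)
    (hke : ∀ n s, ⁅coeff (n + 1) k, coeff (s + 1) e⁆ - ⁅coeff n k, coeff (s + 2) e⁆ =
      -(coeff n k * coeff (s + 1) e))
    (hkf : ∀ n s, ⁅coeff (n + 1) k, coeff (s + 1) f⁆ - ⁅coeff n k, coeff (s + 2) f⁆ =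
      coeff (s + 1) f * coeff n k)
    (D : IsDrinfeld (fun r => coeff (r + 1) e) (fun r => coeff (r + 1) h)
      (fun r => coeff (r + 1) f)) :
    IsRTT fun i j r => coeff r (gaussEntry k h e f i j) := by
  have G : IsGaussCurrents k e f h :=
    isGaussCurrents_of_coeff hk he hf hkk hke hkf D.ef D.ee D.ff
  obtain ⟨t, ht⟩ : ∃ t, t = h * k + f * k * e := ⟨_, rfl⟩
  have ke' := current_ke_swap G.ke
  have kf' := current_kf_swap G.kf
  have hhk₂ : secondPt h * firstPt k = firstPt k * secondPt h := by
    apply ext₂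
    intro n m
    rw [coeff₂_first_mul_second, coeff₂_second_mul_first, hhk]
  have hhk₁ : secondPt k * firstPt h = firstPt h * secondPt k := by
    apply ext₂
    intro n m
    rw [coeff₂_first_mul_second, coeff₂_second_mul_first, hhk]
  have hhk' : k * h = h * k := commute_of_firstPt_secondPt hhk₂.symm
  have hF : firstPt t = firstPt (h * k) + firstPt f * firstPt k * firstPt e := by
    rw [ht]; simp only [map_add, map_mul]
  have hS : secondPt t = secondPt (h * k) + secondPt f * secondPt k * secondPt e := by
    rw [ht]; simp only [map_add, map_mul]
  have reg' : ∀ b : A⟦X⟧⟦X⟧, (-diffNum A) • b = 0 → b = 0 := fun b hb =>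
    diffNum_regular b (by rw [← neg_eq_zero, ← neg_smul, hb])
  have R1 := matrix_ke diffNum_regular G.kk G.ke ke'
  have R2 := matrix_ek G.kk ke'
  have R3 := matrix_kf diffNum_regular G.kk G.kf kf'
  have R4 := matrix_fk G.kk kf'
  have R5 := matrix_ee diffNum_regular G.kk G.ke ke' G.ee
  have R6 := matrix_ff diffNum_regular G.kk G.kf kf' G.ff
  have R7 := matrix_ef diffNum_regular G.kk hF hS (map_mul firstPt h k).symm
    (map_mul secondPt h k).symm
    (by rw [← map_mul, ← map_mul, hhk']) hhk₂.symm G.ke ke' G.kf G.ef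
  have R8 := matrix_ef' diffNum_regular G.kk hF hS
    (by rw [map_mul, ← mul_assoc, ← hhk₂, mul_assoc, mul_assoc, G.kk])
    (by rw [map_mul, ← mul_assoc, hhk₁, mul_assoc, mul_assoc, G.kk]) G.ke ke' G.kf kf' R7
  -- The same identity with the two points exchanged, which turns u - v into its negative.
  have R9 := matrix_ef reg' G.kk.symm hS hF (map_mul secondPt h k).symm
    (map_mul firstPt h k).symm
    (by rw [← map_mul, ← map_mul, hhk']) hhk₁
    (by linear_combination (norm := module) -ke') (by linear_combination (norm := module) -G.ke)
    (by linear_combination (norm := module) -kf') (current_ef_swap G.ef)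
  have e0 : ∀ s, ⁅coeff 1 k, coeff s e⁆ = -coeff s e := by
    intro s
    cases s with
    | zero => simp [he, Ring.lie_def, -coeff_zero_eq_constantCoeff]
    | succ s => simpa [hk, Ring.lie_def, -coeff_zero_eq_constantCoeff] using hke 0 s
  have f0 : ∀ s, ⁅coeff 1 k, coeff s f⁆ = coeff s f := by
    intro s
    cases s with
    | zero => simp [hf, Ring.lie_def, -coeff_zero_eq_constantCoeff]
    | succ s => simpa [hk, Ring.lie_def, -coeff_zero_eq_constantCoeff] using hkf 0 s
  have e1 : ∀ s, ⁅coeff 1 h, coeff s e⁆ = 2 * coeff s e := by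
    intro s
    cases s with
    | zero => simp [he, Ring.lie_def, -coeff_zero_eq_constantCoeff]
    | succ s => exact D.h0e s
  have f1 : ∀ s, ⁅coeff 1 h, coeff s f⁆ = -(2 * coeff s f) := by
    intro s
    cases s with
    | zero => simp [hf, Ring.lie_def, -coeff_zero_eq_constantCoeff]
    | succ s => exact D.h0f s
  have t1 : coeff 1 t = coeff 1 h + coeff 1 k := by
    have h1 : coeff 1 (f * k * e) = 0 := by
      rw [coeff_mul_range]
      simp [he, hf, coeff_mul, -coeff_zero_eq_constantCoeff]
    have h2 : coeff 1 (h * k) = coeff 1 h + coeff 1 k := by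
      rw [coeff_mul_range]
      simp [hh, hk, add_comm, -coeff_zero_eq_constantCoeff]
    rw [ht, map_add, h1, h2, add_zero]
  have lde : ∀ s, ⁅coeff 1 t, coeff s (k * e)⁆ = coeff s (k * e) := by
    intro s
    rw [t1, coeff_mul, Ring.lie_def, Finset.mul_sum, Finset.sum_mul, ← Finset.sum_sub_distrib]
    refine Finset.sum_congr rfl fun x _ => ?_
    have a1 := e0 x.2
    have a2 := e1 x.2
    have a3 := hhk 1 x.1
    have a4 := hkk 1 x.1
    simp only [Ring.lie_def] at a1 a2
    linear_combination (norm := noncomm_ring) a3 * coeff x.2 e + a4 * coeff x.2 e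
      + coeff x.1 k * a1 + coeff x.1 k * a2
  have ldf : ∀ s, ⁅coeff 1 t, coeff s (f * k)⁆ = -coeff s (f * k) := by
    intro s
    rw [t1, coeff_mul, Ring.lie_def, Finset.mul_sum, Finset.sum_mul, ← Finset.sum_sub_distrib,
      ← Finset.sum_neg_distrib]
    refine Finset.sum_congr rfl fun x _ => ?_
    have a1 := f0 x.1
    have a2 := f1 x.1
    have a3 := hhk 1 x.2
    have a4 := hkk 1 x.2
    simp only [Ring.lie_def] at a1 a2
    linear_combination (norm := noncomm_ring) coeff x.1 f * a3 + coeff x.1 f * a4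
      + a1 * coeff x.2 k + a2 * coeff x.2 k
  have comm_of : ∀ a : A⟦X⟧, firstPt a * secondPt a = secondPt a * firstPt a → ∀ r s,
      coeff r a * coeff s a = coeff s a * coeff r a := by
    intro a ha r s
    have := congrArg (coeff₂ r s) ha
    rwa [coeff₂_first_mul_second, coeff₂_second_mul_first] at this
  have S1 := commutator_of_diffNum_smul (a := k) (b := k * e) (c := k * e) (d := k)
    (by simpa only [map_mul] using R1)
  have S2 := commutator_of_diffNum_smul (a := k * e) (b := k) (c := k) (d := k * e)
    (by simpa only [map_mul] using R2)
  have S3 := commutator_of_diffNum_smul (a := k) (b := f * k) (c := k) (d := f * k)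
    (by simpa only [map_mul] using R3)
  have S4 := commutator_of_diffNum_smul (a := f * k) (b := k) (c := f * k) (d := k)
    (by simpa only [map_mul] using R4)
  have S8 := commutator_of_diffNum_smul (a := k * e) (b := f * k) (c := k) (d := t)
    (by simpa only [map_mul] using R8)
  have S9 := commutator_of_diffNum_smul (a := f * k) (b := k * e) (c := t) (d := k)
    (by simp only [map_mul]; linear_combination (norm := module) R9)
  have S5 := comm_of (k * e) (by simpa only [map_mul] using R5)
  have S6 := comm_of (f * k) (by simpa only [map_mul] using R6)
  have t0 : coeff 0 t = 1 := by
    simp [ht, coeff_mul_range, he, hf, hh, hk, -coeff_zero_eq_constantCoeff]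
  subst ht
  refine isRTT_of_entryRel ?_ hkk S5 S6 S1 S2 S3 S4 S8 S9 lde ldf
  intro i j
  fin_cases i <;> fin_cases j
  · exact t0
  · show coeff 0 (k * e) = 0
    simp [coeff_mul_range, he, -coeff_zero_eq_constantCoeff]
  · show coeff 0 (f * k) = 0
    simp [coeff_mul_range, hf, -coeff_zero_eq_constantCoeff]
  · exact hk

end GaussEntries
end YangianVerma

namespace YangianVerma
open PowerSeries Polynomial

noncomputable section

/-! ### Laurent series in u⁻¹, polynomials, and expansions of rational functions. -/

/-- The variable `u` at infinity. -/
def uInf : LaurentSeries ℂ := HahnSeries.single (-1 : ℤ) (1 : ℂ)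

/-- A constant as a Laurent series. -/
abbrev lconst (c : ℂ) : LaurentSeries ℂ := HahnSeries.C c

theorem polyAtInfinity_X : polyAtInfinity X = uInf := by
  simp [polyAtInfinity, uInf]

theorem polyAtInfinity_C (c : ℂ) : polyAtInfinity (Polynomial.C c) = lconst c := by
  rw [← Polynomial.algebraMap_eq, AlgHom.commutes, HahnSeries.algebraMap_apply']
  simp [lconst]

theorem uInf_pow (n : ℕ) : uInf ^ n = HahnSeries.single (-(n : ℤ)) (1 : ℂ) := by
  rw [uInf, HahnSeries.single_pow]
  simp

theorem polyAtInfinity_monomial (n : ℕ) (c : ℂ) :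
    polyAtInfinity (Polynomial.monomial n c) = HahnSeries.single (-(n : ℤ)) c := by
  rw [← Polynomial.C_mul_X_pow_eq_monomial, map_mul, map_pow, polyAtInfinity_X,
    polyAtInfinity_C, uInf_pow, lconst, HahnSeries.C_apply, HahnSeries.single_mul_single]
  simp

theorem coeff_polyAtInfinity (P : ℂ[X]) (n : ℕ) :
    (polyAtInfinity P).coeff (-(n : ℤ)) = P.coeff n := by
  induction P using Polynomial.induction_on' with
  | add p q hp hq => rw [map_add, HahnSeries.coeff_add, hp, hq, Polynomial.coeff_add]
  | monomial m c =>
    rw [polyAtInfinity_monomial, HahnSeries.coeff_single, Polynomial.coeff_monomial]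
    congr 1
    simp [eq_comm]

theorem coeff_polyAtInfinity_pos (P : ℂ[X]) (n : ℕ) :
    (polyAtInfinity P).coeff ((n : ℤ) + 1) = 0 := by
  induction P using Polynomial.induction_on' with
  | add p q hp hq => rw [map_add, HahnSeries.coeff_add, hp, hq, add_zero]
  | monomial m c =>
    rw [polyAtInfinity_monomial, HahnSeries.coeff_single_of_ne (by omega)]

theorem polyAtInfinity_eq_zero {P : ℂ[X]} (h : polyAtInfinity P = 0) : P = 0 := by
  ext n
  rw [← coeff_polyAtInfinity, h]
  simp

/-- A Laurent series in u⁻¹ has only finitely many positive powers of u, so without negative ones it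
is a polynomial; the order bounds its degree. -/
theorem exists_polyAtInfinity_eq {ψ : LaurentSeries ℂ} (h : ∀ n : ℕ, ψ.coeff ((n : ℤ) + 1) = 0) :
    ∃ P, polyAtInfinity P = ψ := by
  refine ⟨∑ i ∈ Finset.range ((-ψ.order).toNat + 1), Polynomial.monomial i (ψ.coeff (-(i : ℤ))), ?_⟩
  rw [map_sum]
  simp only [polyAtInfinity_monomial]
  ext m
  rw [HahnSeries.coeff_sum]
  rcases lt_or_ge 0 m with hm | hm
  · obtain ⟨n, rfl⟩ : ∃ n : ℕ, m = (n : ℤ) + 1 := ⟨(m - 1).toNat, by omega⟩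
    rw [h]
    exact Finset.sum_eq_zero fun i _ => HahnSeries.coeff_single_of_ne (by omega)
  · obtain ⟨n, rfl⟩ : ∃ n : ℕ, m = -(n : ℤ) := ⟨(-m).toNat, by omega⟩
    rcases lt_or_ge n ((-ψ.order).toNat + 1) with hn | hn
    · rw [Finset.sum_eq_single_of_mem n (Finset.mem_range.mpr hn)
        (fun i _ hi => HahnSeries.coeff_single_of_ne (by omega)), HahnSeries.coeff_single_same]
    · rw [HahnSeries.coeff_eq_zero_of_lt_order (by omega)]
      refine Finset.sum_eq_zero fun i hi => HahnSeries.coeff_single_of_ne ?_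
      have := Finset.mem_range.mp hi
      omega

/-- The function `g` coincides outside of `S` with a rational function without poles outside
of `S`, and `ψ` is the expansion at infinity of this rational function. -/
def RatExt (S : Finset ℂ) (g : ℂ → ℂ) (ψ : LaurentSeries ℂ) : Prop :=
  ∃ P Q : ℂ[X], (∀ b ∉ S, Q.eval b ≠ 0) ∧ ψ * polyAtInfinity Q = polyAtInfinity P ∧
    ∀ b ∉ S, g b * Q.eval b = P.eval b

namespace RatExt

variable {S T : Finset ℂ} {g g' : ℂ → ℂ} {ψ ψ' : LaurentSeries ℂ}

theorem const (S : Finset ℂ) (c : ℂ) : RatExt S (fun _ => c) (lconst c) :=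
  ⟨Polynomial.C c, 1, by simp, by rw [map_one, mul_one, polyAtInfinity_C], by simp⟩

theorem var (S : Finset ℂ) : RatExt S (fun b => b) uInf :=
  ⟨X, 1, by simp, by rw [map_one, mul_one, polyAtInfinity_X], by simp⟩

theorem add (h : RatExt S g ψ) (h' : RatExt S g' ψ') :
    RatExt S (fun b => g b + g' b) (ψ + ψ') := by
  obtain ⟨P, Q, h1, h2, h3⟩ := h
  obtain ⟨P', Q', h1', h2', h3'⟩ := h'
  refine ⟨P * Q' + P' * Q, Q * Q', fun b hb => ?_, ?_, fun b hb => ?_⟩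
  · rw [eval_mul]; exact mul_ne_zero (h1 b hb) (h1' b hb)
  · simp only [map_add, map_mul, ← h2, ← h2']; ring
  · simp only [eval_add, eval_mul, ← h3 b hb, ← h3' b hb]; ring

theorem mul (h : RatExt S g ψ) (h' : RatExt S g' ψ') :
    RatExt S (fun b => g b * g' b) (ψ * ψ') := by
  obtain ⟨P, Q, h1, h2, h3⟩ := h
  obtain ⟨P', Q', h1', h2', h3'⟩ := h'
  refine ⟨P * P', Q * Q', fun b hb => ?_, ?_, fun b hb => ?_⟩
  · rw [eval_mul]; exact mul_ne_zero (h1 b hb) (h1' b hb)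
  · simp only [map_mul, ← h2, ← h2']; ring
  · simp only [eval_mul, ← h3 b hb, ← h3' b hb]; ring

theorem pow_var (S : Finset ℂ) (n : ℕ) : RatExt S (fun b => b ^ n) (uInf ^ n) :=
  ⟨Polynomial.X ^ n, 1, by simp, by rw [map_one, mul_one, map_pow, polyAtInfinity_X], by simp⟩

theorem inv_sub {a : ℂ} (ha : a ∈ S) : RatExt S (fun b => (b - a)⁻¹) (uInf - lconst a)⁻¹ := by
  have h0 : polyAtInfinity (Polynomial.X - Polynomial.C a) = uInf - lconst a := by
    rw [map_sub, polyAtInfinity_X, polyAtInfinity_C]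
  have hne : ∀ b ∉ S, b - a ≠ 0 := fun b hb h => hb (by rwa [sub_eq_zero.mp h])
  refine ⟨1, Polynomial.X - Polynomial.C a, fun b hb => ?_, ?_, fun b hb => ?_⟩
  · simpa using hne b hb
  · rw [h0, map_one, inv_mul_cancel₀]
    intro h
    rw [← h0] at h
    exact X_sub_C_ne_zero a (polyAtInfinity_eq_zero h)
  · simpa using inv_mul_cancel₀ (hne b hb)

theorem congr (h : RatExt S g ψ) (hg : ∀ b ∉ S, g' b = g b) : RatExt S g' ψ := by
  obtain ⟨P, Q, h1, h2, h3⟩ := h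
  exact ⟨P, Q, h1, h2, fun b hb => by rw [hg b hb, h3 b hb]⟩

theorem mono (h : RatExt S g ψ) (hST : S ⊆ T) : RatExt T g ψ := by
  obtain ⟨P, Q, h1, h2, h3⟩ := h
  exact ⟨P, Q, fun b hb => h1 b fun hS => hb (hST hS), h2, fun b hb => h3 b fun hS => hb (hST hS)⟩

theorem sum {ι : Type*} (s : Finset ι) {g : ι → ℂ → ℂ} {ψ : ι → LaurentSeries ℂ}
    (h : ∀ i ∈ s, RatExt S (g i) (ψ i)) : RatExt S (fun b => ∑ i ∈ s, g i b) (∑ i ∈ s, ψ i) := by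
  classical
  induction s using Finset.induction_on with
  | empty => simpa using const S 0
  | insert i s hi ih =>
    simp only [Finset.sum_insert hi]
    exact (h i (Finset.mem_insert_self i s)).add
      (ih fun j hj => h j (Finset.mem_insert_of_mem hj))

theorem prod {ι : Type*} (s : Finset ι) {g : ι → ℂ → ℂ} {ψ : ι → LaurentSeries ℂ}
    (h : ∀ i ∈ s, RatExt S (g i) (ψ i)) : RatExt S (fun b => ∏ i ∈ s, g i b) (∏ i ∈ s, ψ i) := by
  classical
  induction s using Finset.induction_on with
  | empty => simpa using const S 1
  | insert i s hi ih =>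
    simp only [Finset.prod_insert hi]
    exact (h i (Finset.mem_insert_self i s)).mul
      (ih fun j hj => h j (Finset.mem_insert_of_mem hj))

theorem eq_zero_of_zero (h : RatExt S g 0) {b : ℂ} (hb : b ∉ S) : g b = 0 := by
  obtain ⟨P, Q, h1, h2, h3⟩ := h
  rw [zero_mul] at h2
  have := h3 b hb
  rw [polyAtInfinity_eq_zero h2.symm, eval_zero] at this
  exact (mul_eq_zero.mp this).resolve_right (h1 b hb)

theorem eq_zero_of_forall (h : RatExt S g ψ) (h0 : ∀ b ∉ S, g b = 0) : ψ = 0 := by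
  obtain ⟨P, Q, h1, h2, h3⟩ := h
  have hP : P = 0 := by
    refine Polynomial.eq_zero_of_infinite_isRoot P (Set.Infinite.mono (s := (↑S : Set ℂ)ᶜ) ?_
      S.finite_toSet.infinite_compl)
    intro b hb
    have hb' : b ∉ S := hb
    show P.eval b = 0
    rw [← h3 b hb', h0 b hb', zero_mul]
  have hQ : Q ≠ 0 := by
    obtain ⟨b, hb⟩ := S.exists_notMem
    rintro rfl
    exact h1 b hb (by simp)
  rw [hP, map_zero] at h2
  exact (mul_eq_zero.mp h2).resolve_right fun h => hQ (polyAtInfinity_eq_zero h)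

theorem const_mul (c : ℂ) (h : RatExt S g ψ) : RatExt S (fun b => c * g b) (lconst c * ψ) :=
  (const S c).mul h

theorem sub (h : RatExt S g ψ) (h' : RatExt S g' ψ') :
    RatExt S (fun b => g b - g' b) (ψ - ψ') := by
  have h1 : ψ - ψ' = ψ + lconst (-1) * ψ' := by
    rw [lconst, map_neg, map_one]
    ring
  rw [h1]
  exact (h.add (h'.const_mul (-1))).congr fun b _ => by ring

/-- A rational function is determined by its values off a finite set, so its expansion at infinity
is as well. This makes `hat` well defined. -/
theorem unique (h : RatExt S g ψ) (h' : RatExt S g ψ') : ψ = ψ' :=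
  sub_eq_zero.mp ((h.sub h').eq_zero_of_forall fun b _ => sub_self (g b))

/-- The expansion of a rational function is a quotient of two polynomials. -/
theorem exists_div (h : RatExt S g ψ) :
    ∃ P Q : ℂ[X], Q ≠ 0 ∧ ψ = polyAtInfinity P / polyAtInfinity Q := by
  obtain ⟨P, Q, h1, h2, -⟩ := h
  have hQ : Q ≠ 0 := by
    obtain ⟨b, hb⟩ := S.exists_notMem
    rintro rfl
    exact h1 b hb (by simp)
  exact ⟨P, Q, hQ, by rw [eq_div_iff fun h => hQ (polyAtInfinity_eq_zero h), h2]⟩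

end RatExt

/-! ### Operators on functions of finite sets: the lowering and Cartan currents. -/

/-- Functions of finite sets of complex numbers. -/
abbrev FinFun : Type := Finset ℂ → ℂ

/-- The factor with which `f` adds the point `a` to the points of `B`. -/
def fWeight (a : ℂ) (B : Finset ℂ) : ℂ := ∏ b ∈ B, (1 - (a - b)⁻¹)

/-- The operator `f^{(s)}`. -/
def fOp (s : ℕ) : FinFun →ₗ[ℂ] FinFun where
  toFun F A := ∑ a ∈ A, a ^ s * fWeight a (A.erase a) * F (A.erase a)
  map_add' F G := by
    funext A
    simp only [Pi.add_apply, mul_add, Finset.sum_add_distrib]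
  map_smul' c F := by
    funext A
    simp only [Pi.smul_apply, smul_eq_mul, RingHom.id_apply, Finset.mul_sum]
    exact Finset.sum_congr rfl fun a _ => by ring

theorem fOp_apply (s : ℕ) (F : FinFun) (A : Finset ℂ) :
    fOp s F A = ∑ a ∈ A, a ^ s * fWeight a (A.erase a) * F (A.erase a) := rfl

/-- The series `c(u) ∏ (u - a + α) / (u - a + β)` over the points `a` of `A`. -/
def cartanSeries (c : ℂ⟦X⟧) (α β : ℂ) (A : Finset ℂ) : ℂ⟦X⟧ :=
  c * ∏ a ∈ A, ((1 + PowerSeries.C (α - a) * PowerSeries.X) *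
    (1 + PowerSeries.C (β - a) * PowerSeries.X)⁻¹)

/-- The operator of multiplication by a coefficient of `cartanSeries`. -/
def cartanOp (c : ℂ⟦X⟧) (α β : ℂ) (n : ℕ) : FinFun →ₗ[ℂ] FinFun where
  toFun F A := coeff n (cartanSeries c α β A) * F A
  map_add' F G := by
    funext A
    simp only [Pi.add_apply, mul_add]
  map_smul' c F := by
    funext A
    simp only [Pi.smul_apply, smul_eq_mul, RingHom.id_apply]
    ring

theorem cartanOp_apply (c : ℂ⟦X⟧) (α β : ℂ) (n : ℕ) (F : FinFun) (A : Finset ℂ) :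
    cartanOp c α β n F A = coeff n (cartanSeries c α β A) * F A := rfl

theorem linearFactor_mul_inv (a : ℂ) :
    (1 + PowerSeries.C a * PowerSeries.X) * (1 + PowerSeries.C a * PowerSeries.X)⁻¹ = 1 :=
  PowerSeries.mul_inv_cancel _ (by simp)

theorem constantCoeff_cartanSeries (c : ℂ⟦X⟧) (α β : ℂ) (A : Finset ℂ) :
    coeff 0 (cartanSeries c α β A) = coeff 0 c := by
  simp only [cartanSeries, coeff_zero_eq_constantCoeff, map_mul, map_prod]
  rw [Finset.prod_eq_one, mul_one]
  intro a _
  simp [PowerSeries.constantCoeff_inv]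

/-- Multiplication by 1 + (β - a)X clears the denominator of the factor of the point a. -/
theorem coeff_cartanSeries_insert (c : ℂ⟦X⟧) (α β : ℂ) {a : ℂ} {A : Finset ℂ} (ha : a ∉ A) (n : ℕ) :
    coeff (n + 1) (cartanSeries c α β (insert a A)) +
        (β - a) * coeff n (cartanSeries c α β (insert a A)) =
      coeff (n + 1) (cartanSeries c α β A) + (α - a) * coeff n (cartanSeries c α β A) := by
  have key : cartanSeries c α β (insert a A) * (1 + PowerSeries.C (β - a) * PowerSeries.X) =
      cartanSeries c α β A * (1 + PowerSeries.C (α - a) * PowerSeries.X) := by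
    rw [cartanSeries, cartanSeries, Finset.prod_insert ha]
    linear_combination c * (∏ a ∈ A, ((1 + PowerSeries.C (α - a) * PowerSeries.X) *
      (1 + PowerSeries.C (β - a) * PowerSeries.X)⁻¹)) *
      (1 + PowerSeries.C (α - a) * PowerSeries.X) * linearFactor_mul_inv (β - a)
  have h1 : ∀ (s : ℂ⟦X⟧) (b : ℂ), PowerSeries.coeff (n + 1) (s * (1 + PowerSeries.C b * PowerSeries.X)) =
      PowerSeries.coeff (n + 1) s + b * PowerSeries.coeff n s := by
    intro s b
    rw [mul_add, mul_one, map_add, mul_left_comm, PowerSeries.coeff_C_mul,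
      PowerSeries.coeff_succ_mul_X]
  rw [← h1, ← h1, key]

/-- The parameters serve two currents: (-1, 1) for h and (1, 0) for k = t₂₂. Summand by summand, the
relation is `coeff_cartanSeries_insert` for the removed point, which also accounts for the extra
power of a. -/
theorem cartanOp_fOp (c : ℂ⟦X⟧) (α β : ℂ) (n s : ℕ) (F : FinFun) :
    cartanOp c α β (n + 1) (fOp s F) - fOp s (cartanOp c α β (n + 1) F) -
        (cartanOp c α β n (fOp (s + 1) F) - fOp (s + 1) (cartanOp c α β n F)) =
      α • fOp s (cartanOp c α β n F) - β • cartanOp c α β n (fOp s F) := by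
  funext A
  simp only [Pi.sub_apply, Pi.smul_apply, fOp_apply, cartanOp_apply, Finset.mul_sum, smul_eq_mul,
    ← Finset.sum_sub_distrib]
  refine Finset.sum_congr rfl fun a ha => ?_
  have h1 := coeff_cartanSeries_insert c α β (Finset.notMem_erase a A) n
  rw [Finset.insert_erase ha] at h1
  rw [pow_succ]
  linear_combination a ^ s * fWeight a (A.erase a) * F (A.erase a) * h1

theorem fOp_fOp (s t : ℕ) (F : FinFun) (A : Finset ℂ) :
    fOp s (fOp t F) A = ∑ x ∈ A.offDiag, x.1 ^ s * x.2 ^ t * (1 - (x.1 - x.2)⁻¹) *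
      (fWeight x.1 ((A.erase x.1).erase x.2) * fWeight x.2 ((A.erase x.1).erase x.2) *
        F ((A.erase x.1).erase x.2)) := by
  have h1 : A.offDiag = (A.sigma fun a => A.erase a).map
      (Equiv.sigmaEquivProd ℂ ℂ).toEmbedding := by
    ext x
    simp only [Finset.mem_offDiag, Finset.mem_map_equiv, Finset.mem_sigma, Finset.mem_erase]
    constructor
    · rintro ⟨h1, h2, h3⟩
      exact ⟨h1, fun h => h3 h.symm, h2⟩
    · rintro ⟨h1, h2, h3⟩
      exact ⟨h1, h3, fun h => h2 h.symm⟩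
  rw [h1, Finset.sum_map, Finset.sum_sigma, fOp_apply]
  refine Finset.sum_congr rfl fun a ha => ?_
  rw [fOp_apply, Finset.mul_sum]
  refine Finset.sum_congr rfl fun b hb => ?_
  have h2 : fWeight a (A.erase a) =
      (1 - (a - b)⁻¹) * fWeight a ((A.erase a).erase b) := by
    rw [fWeight, fWeight, Finset.mul_prod_erase (A.erase a) (fun c => 1 - (a - c)⁻¹) hb]
  simp only [Equiv.toEmbedding_apply, Equiv.sigmaEquivProd_apply]
  rw [h2]
  ring

/-- In the double sum over ordered pairs (a, b), the relation collects into (a^r b^s + a^s b^r)(a -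
b + 1)(1 - 1/(a - b)) times a symmetric factor. The product (a - b + 1)(1 - 1/(a - b)) equals (a -
b) - 1/(a - b), which is antisymmetric, so the pairs (a, b) and (b, a) cancel. -/
theorem fOp_relation (r s : ℕ) (F : FinFun) :
    fOp (r + 1) (fOp s F) - fOp s (fOp (r + 1) F) - (fOp r (fOp (s + 1) F) -
      fOp (s + 1) (fOp r F)) = -(fOp r (fOp s F) + fOp s (fOp r F)) := by
  funext A
  simp only [Pi.sub_apply, Pi.neg_apply, Pi.add_apply, fOp_fOp]
  rw [← sub_eq_zero, sub_neg_eq_add]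
  simp only [← Finset.sum_sub_distrib, ← Finset.sum_add_distrib]
  rw [← self_eq_neg, ← Finset.sum_neg_distrib]
  refine Finset.sum_nbij' Prod.swap Prod.swap (fun x hx => ?_) (fun x hx => ?_) (fun x _ => rfl)
    (fun x _ => rfl) (fun x hx => ?_)
  · have := Finset.mem_offDiag.mp hx
    exact Finset.mem_offDiag.mpr ⟨this.2.1, this.1, this.2.2.symm⟩
  · have := Finset.mem_offDiag.mp hx
    exact Finset.mem_offDiag.mpr ⟨this.2.1, this.1, this.2.2.symm⟩
  · obtain ⟨a, b⟩ := x
    have hne : a - b ≠ 0 := sub_ne_zero.mpr (Finset.mem_offDiag.mp hx).2.2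
    have h1 : (b - a)⁻¹ = -(a - b)⁻¹ := by rw [← neg_sub, inv_neg]
    have h2 : (a - b) * (a - b)⁻¹ = 1 := mul_inv_cancel₀ hne
    simp only [Prod.swap]
    rw [Finset.erase_right_comm (a := b) (b := a), h1]
    generalize (a - b)⁻¹ = i at h2
    generalize fWeight a ((A.erase a).erase b) = p
    generalize fWeight b ((A.erase a).erase b) = q
    generalize F ((A.erase a).erase b) = w
    simp only [pow_succ]
    linear_combination (-2 : ℂ) * (a ^ r * b ^ s + a ^ s * b ^ r) * p * q * w * h2

/-! ### Rational dependence on a point, and the raising operators. -/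

/-- The functions that are rational in each point of the set. -/
def IsRat (F : FinFun) : Prop := ∀ A, ∃ ψ, RatExt A (fun b => F (insert b A)) ψ

open Classical in
/-- The expansion at infinity of `F` as a function of a point that is added to `A`. -/
def hat (F : FinFun) (A : Finset ℂ) : LaurentSeries ℂ :=
  if h : ∃ ψ, RatExt A (fun b => F (insert b A)) ψ then h.choose else 0

theorem IsRat.ratExt {F : FinFun} (hF : IsRat F) (A : Finset ℂ) :
    RatExt A (fun b => F (insert b A)) (hat F A) := by
  rw [hat, dif_pos (hF A)]
  exact (hF A).choose_spec

theorem hat_eq {F : FinFun} {A : Finset ℂ} {ψ : LaurentSeries ℂ}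
    (h : RatExt A (fun b => F (insert b A)) ψ) : hat F A = ψ := by
  rw [hat, dif_pos ⟨ψ, h⟩]
  exact (Exists.choose_spec (p := RatExt A fun b => F (insert b A)) ⟨ψ, h⟩).unique h

theorem IsRat.add {F G : FinFun} (hF : IsRat F) (hG : IsRat G) : IsRat (F + G) := fun A =>
  ⟨_, (hF.ratExt A).add (hG.ratExt A)⟩

theorem IsRat.smul {F : FinFun} (c : ℂ) (hF : IsRat F) : IsRat (c • F) := fun A =>
  ⟨_, (hF.ratExt A).const_mul c⟩

theorem hat_add {F G : FinFun} (hF : IsRat F) (hG : IsRat G) (A : Finset ℂ) :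
    hat (F + G) A = hat F A + hat G A :=
  hat_eq ((hF.ratExt A).add (hG.ratExt A))

theorem hat_smul {F : FinFun} (c : ℂ) (hF : IsRat F) (A : Finset ℂ) :
    hat (c • F) A = lconst c * hat F A :=
  hat_eq ((hF.ratExt A).const_mul c)

/-- The expansion at infinity of `fWeight`. -/
def fWeightInf (A : Finset ℂ) : LaurentSeries ℂ := ∏ b ∈ A, (1 - (uInf - lconst b)⁻¹)

/-- The sum over A ∪ {b} splits into the term that removes b, with the full weight of b, and the
terms that remove a point a of A, whose weight contains the factor 1 - 1/(a - b) = 1 + 1/(b - a). -/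
theorem ratExt_fOp (s : ℕ) {F : FinFun} (hF : IsRat F) (A : Finset ℂ) :
    RatExt A (fun b => fOp s F (insert b A))
      (uInf ^ s * fWeightInf A * lconst (F A) + ∑ a ∈ A,
        lconst (a ^ s * fWeight a (A.erase a)) * (1 + (uInf - lconst a)⁻¹) * hat F (A.erase a)) := by
  have one : RatExt A (fun _ => 1) 1 := by simpa using RatExt.const A 1
  have h1 : RatExt A (fun b => b ^ s * (∏ c ∈ A, (1 - (b - c)⁻¹)) * F A)
      (uInf ^ s * fWeightInf A * lconst (F A)) :=
    ((RatExt.pow_var A s).mul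
      (RatExt.prod A fun a ha => one.sub (RatExt.inv_sub ha))).mul (RatExt.const A (F A))
  have h2 : RatExt A (fun b => ∑ a ∈ A, a ^ s * fWeight a (A.erase a) * (1 + (b - a)⁻¹) *
      F (insert b (A.erase a))) (∑ a ∈ A,
        lconst (a ^ s * fWeight a (A.erase a)) * (1 + (uInf - lconst a)⁻¹) * hat F (A.erase a)) :=
    RatExt.sum A fun a ha => ((RatExt.const A _).mul (one.add (RatExt.inv_sub ha))).mul
      ((hF.ratExt (A.erase a)).mono (Finset.erase_subset a A))
  refine (h1.add h2).congr fun b hb => ?_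
  rw [fOp_apply, Finset.sum_insert hb, Finset.erase_insert hb]
  congr 1
  refine Finset.sum_congr rfl fun a ha => ?_
  have hne : a ≠ b := fun h => hb (h ▸ ha)
  rw [Finset.erase_insert_of_ne hne.symm, fWeight, Finset.prod_insert
    (fun h => hb (Finset.mem_of_mem_erase h)), fWeight]
  rw [← neg_sub b a, inv_neg]
  ring

theorem IsRat.fOp (s : ℕ) {F : FinFun} (hF : IsRat F) : IsRat (fOp s F) := fun A =>
  ⟨_, ratExt_fOp s hF A⟩

theorem hat_fOp (s : ℕ) {F : FinFun} (hF : IsRat F) (A : Finset ℂ) :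
    hat (YangianVerma.fOp s F) A = uInf ^ s * fWeightInf A * lconst (F A) + ∑ a ∈ A,
        lconst (a ^ s * fWeight a (A.erase a)) * (1 + (uInf - lconst a)⁻¹) * hat F (A.erase a) :=
  hat_eq (ratExt_fOp s hF A)

/-- Expanding the denominator in powers of u⁻¹ makes each coefficient polynomial in the added point;
`coeff_cartanSeries_insert` gives this by recursion on n. -/
theorem IsRat.cartanOp (c : ℂ⟦X⟧) (α β : ℂ) (n : ℕ) {F : FinFun} (hF : IsRat F) :
    IsRat (cartanOp c α β n F) := by
  induction n with
  | zero =>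
    have h : YangianVerma.cartanOp c α β 0 F = coeff 0 c • F := by
      funext A
      rw [cartanOp_apply, constantCoeff_cartanSeries]
      rfl
    rw [h]
    exact hF.smul _
  | succ n ih =>
    intro A
    refine ⟨_, (((hF.ratExt A).const_mul (coeff (n + 1) (cartanSeries c α β A))).add
      ((((RatExt.const A α).sub (RatExt.var A)).mul
        (RatExt.const A (coeff n (cartanSeries c α β A)))).mul (hF.ratExt A)) |>.sub
      (((RatExt.const A β).sub (RatExt.var A)).mul (ih.ratExt A))).congr
        (g' := fun b => YangianVerma.cartanOp c α β (n + 1) F (insert b A)) fun b hb => ?_⟩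
    rw [cartanOp_apply, cartanOp_apply]
    linear_combination F (insert b A) * coeff_cartanSeries_insert c α β hb n

theorem hat_cartanOp (c : ℂ⟦X⟧) (α β : ℂ) (n : ℕ) {F : FinFun} (hF : IsRat F) (A : Finset ℂ) :
    hat (cartanOp c α β (n + 1) F) A + (lconst β - uInf) * hat (cartanOp c α β n F) A =
      lconst (coeff (n + 1) (cartanSeries c α β A)) * hat F A +
        (lconst α - uInf) * lconst (coeff n (cartanSeries c α β A)) * hat F A := by
  refine RatExt.unique (((hF.cartanOp c α β (n + 1)).ratExt A).add
    (((RatExt.const A β).sub (RatExt.var A)).mul ((hF.cartanOp c α β n).ratExt A)))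
    ((((hF.ratExt A).const_mul (coeff (n + 1) (cartanSeries c α β A))).add
      ((((RatExt.const A α).sub (RatExt.var A)).mul (RatExt.const A _)).mul
        (hF.ratExt A))).congr fun b hb => ?_)
  rw [cartanOp_apply, cartanOp_apply]
  linear_combination F (insert b A) * coeff_cartanSeries_insert c α β hb n

/-- The kernel of the operators `e^{(r)}`. -/
def eKernel (μ : ℂ⟦X⟧) (A : Finset ℂ) : LaurentSeries ℂ :=
  (μ : LaurentSeries ℂ) * ∏ a ∈ A, (1 + (uInf - lconst a)⁻¹)⁻¹

/-- The operator `e^{(r)}`. -/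
def eOp (μ : ℂ⟦X⟧) (r : ℕ) (F : FinFun) : FinFun := fun A =>
  (uInf ^ r * eKernel μ A * hat F A).coeff 1

theorem eOp_apply (μ : ℂ⟦X⟧) (r : ℕ) (F : FinFun) (A : Finset ℂ) :
    eOp μ r F A = (uInf ^ r * eKernel μ A * hat F A).coeff 1 := rfl

theorem coeff_lconst_mul (c : ℂ) (ψ : LaurentSeries ℂ) (n : ℤ) :
    (lconst c * ψ).coeff n = c * ψ.coeff n := by
  rw [lconst, HahnSeries.C_mul_eq_smul, HahnSeries.coeff_smul, smul_eq_mul]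

theorem eOp_add (μ : ℂ⟦X⟧) (r : ℕ) {F G : FinFun} (hF : IsRat F) (hG : IsRat G) :
    eOp μ r (F + G) = eOp μ r F + eOp μ r G := by
  funext A
  rw [Pi.add_apply, eOp_apply, hat_add hF hG, mul_add, HahnSeries.coeff_add]
  rfl

theorem eOp_smul (μ : ℂ⟦X⟧) (r : ℕ) (c : ℂ) {F : FinFun} (hF : IsRat F) :
    eOp μ r (c • F) = c • eOp μ r F := by
  funext A
  rw [Pi.smul_apply, eOp_apply, hat_smul c hF, mul_left_comm, coeff_lconst_mul]
  rfl

theorem uInf_sub_lconst_ne_zero (a : ℂ) : uInf - lconst a ≠ 0 := by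
  have h0 : polyAtInfinity (Polynomial.X - Polynomial.C a) = uInf - lconst a := by
    rw [map_sub, polyAtInfinity_X, polyAtInfinity_C]
  rw [← h0]
  exact fun h => X_sub_C_ne_zero a (polyAtInfinity_eq_zero h)

theorem one_add_inv_eq (a c : ℂ) :
    1 + lconst c * (uInf - lconst a)⁻¹ = (uInf - lconst (a - c)) * (uInf - lconst a)⁻¹ := by
  have h := mul_inv_cancel₀ (uInf_sub_lconst_ne_zero a)
  have h2 : lconst (a - c) = lconst a - lconst c := map_sub _ _ _
  rw [h2]
  linear_combination -h

theorem one_add_inv_ne_zero (a : ℂ) : 1 + (uInf - lconst a)⁻¹ ≠ 0 := by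
  have := one_add_inv_eq a 1
  rw [lconst, map_one, one_mul] at this
  rw [this]
  exact mul_ne_zero (uInf_sub_lconst_ne_zero _) (inv_ne_zero (uInf_sub_lconst_ne_zero _))

theorem uInf_mul_X : uInf * ((PowerSeries.X : ℂ⟦X⟧) : LaurentSeries ℂ) = 1 := by
  rw [PowerSeries.coe_X, uInf, HahnSeries.single_mul_single]
  simp

theorem uInf_ne_zero : uInf ≠ 0 := left_ne_zero_of_mul_eq_one uInf_mul_X

theorem coe_linearFactor (a c : ℂ) :
    uInf * ((1 + PowerSeries.C (c - a) * PowerSeries.X : ℂ⟦X⟧) : LaurentSeries ℂ) =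
      uInf - lconst (a - c) := by
  have h : lconst (a - c) = - lconst (c - a) := by rw [← map_neg, neg_sub]
  rw [h, PowerSeries.coe_add, PowerSeries.coe_mul, PowerSeries.coe_C, PowerSeries.coe_one]
  linear_combination lconst (c - a) * uInf_mul_X

theorem coe_cartanFactor (a : ℂ) :
    (((1 + PowerSeries.C (-1 - a) * PowerSeries.X) *
      (1 + PowerSeries.C (1 - a) * PowerSeries.X)⁻¹ : ℂ⟦X⟧) : LaurentSeries ℂ) =
      (1 + (uInf - lconst a)⁻¹)⁻¹ * (1 - (uInf - lconst a)⁻¹) := by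
  have h1 := coe_linearFactor a (-1)
  have h2 := coe_linearFactor a 1
  have h3 := one_add_inv_eq a 1
  have h4 := one_add_inv_eq a (-1)
  have h5 := congrArg (fun s : ℂ⟦X⟧ => (s : LaurentSeries ℂ)) (linearFactor_mul_inv (1 - a))
  have h6 : (1 - (uInf - lconst a)⁻¹) = 1 + lconst (-1) * (uInf - lconst a)⁻¹ := by
    have h : lconst (-1) = -1 := by rw [lconst, map_neg, map_one]
    rw [h]; ring
  rw [show lconst 1 = 1 from map_one _, one_mul] at h3
  simp only [PowerSeries.coe_mul, PowerSeries.coe_one] at h5 ⊢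
  rw [h6, h3, h4, ← h1, ← h2]
  have h7 := uInf_sub_lconst_ne_zero a
  have h8 := uInf_ne_zero
  have h9 := left_ne_zero_of_mul_eq_one h5
  rw [eq_inv_of_mul_eq_one_right h5]
  field_simp

theorem coe_cartanSeries (μ : ℂ⟦X⟧) (A : Finset ℂ) :
    ((cartanSeries μ (-1) 1 A : ℂ⟦X⟧) : LaurentSeries ℂ) = eKernel μ A * fWeightInf A := by
  rw [cartanSeries, PowerSeries.coe_mul, eKernel, fWeightInf, mul_assoc, ← Finset.prod_mul_distrib]
  congr 1
  rw [show ((∏ a ∈ A, ((1 + PowerSeries.C (-1 - a) * PowerSeries.X) *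
    (1 + PowerSeries.C (1 - a) * PowerSeries.X)⁻¹) : ℂ⟦X⟧) : LaurentSeries ℂ) = _ from
    map_prod (HahnSeries.ofPowerSeries ℤ ℂ) _ A]
  exact Finset.prod_congr rfl fun a _ => coe_cartanFactor a

theorem coeff_uInf_pow_mul (n : ℕ) (ψ : LaurentSeries ℂ) (m : ℤ) :
    (uInf ^ n * ψ).coeff m = ψ.coeff (m + n) := by
  rw [uInf_pow, HahnSeries.coeff_single_mul, one_mul, sub_neg_eq_add]

theorem coeff_natCast_coe (s : ℂ⟦X⟧) (n : ℕ) :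
    (s : LaurentSeries ℂ).coeff (n : ℤ) = PowerSeries.coeff n s := by
  rw [PowerSeries.coeff_coe]
  simp

/-- In the expansion of `fOp s F`, the factor 1 + 1/(u - a) of a term that removes a point a of A
cancels the factor of a in the kernel, which leaves f e. In the term that removes the new point, the
weight times the kernel is the series of h, whose coefficient of u^{-(r+s+1)} is extracted. -/
theorem eOp_fOp (μ : ℂ⟦X⟧) (r s : ℕ) {F : FinFun} (hF : IsRat F) :
    eOp μ r (fOp s F) = fOp s (eOp μ r F) + cartanOp μ (-1) 1 (r + s + 1) F := by
  funext A
  rw [Pi.add_apply, eOp_apply, hat_fOp s hF, mul_add, HahnSeries.coeff_add, add_comm]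
  congr 1
  · rw [fOp_apply, Finset.mul_sum, HahnSeries.coeff_sum]
    refine Finset.sum_congr rfl fun a ha => ?_
    have h1 : eKernel μ A * (1 + (uInf - lconst a)⁻¹) = eKernel μ (A.erase a) := by
      rw [eKernel, eKernel, ← Finset.mul_prod_erase A _ ha, mul_assoc, mul_right_comm,
        inv_mul_cancel₀ (one_add_inv_ne_zero a), one_mul]
    rw [eOp_apply, ← coeff_lconst_mul, ← h1]
    congr 1
    ring
  · rw [cartanOp_apply]
    have h1 : uInf ^ r * eKernel μ A * (uInf ^ s * fWeightInf A * lconst (F A)) =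
        lconst (F A) * (uInf ^ (r + s) * ((cartanSeries μ (-1) 1 A : ℂ⟦X⟧) : LaurentSeries ℂ)) := by
      rw [coe_cartanSeries, pow_add]
      ring
    rw [h1, coeff_lconst_mul, coeff_uInf_pow_mul, mul_comm, ← coeff_natCast_coe]
    congr 2
    push_cast
    ring

/-- This is the coefficient of u⁻¹ in `hat_cartanOp` multiplied by u^s times the kernel; the
variable u there raises the index s by one. -/
theorem eOp_cartanOp (μ c : ℂ⟦X⟧) (α β : ℂ) (n s : ℕ) {F : FinFun} (hF : IsRat F) :
    cartanOp c α β (n + 1) (eOp μ s F) - eOp μ s (cartanOp c α β (n + 1) F) -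
        (cartanOp c α β n (eOp μ (s + 1) F) - eOp μ (s + 1) (cartanOp c α β n F)) =
      β • eOp μ s (cartanOp c α β n F) - α • cartanOp c α β n (eOp μ s F) := by
  funext A
  have h1 := congrArg (fun ψ => (uInf ^ s * eKernel μ A * ψ).coeff 1) (hat_cartanOp c α β n hF A)
  simp only [Pi.sub_apply, Pi.smul_apply, smul_eq_mul, cartanOp_apply, eOp_apply,
    ← coeff_lconst_mul, ← HahnSeries.coeff_sub]
  rw [← sub_eq_zero, ← HahnSeries.coeff_sub] at h1 ⊢
  rw [← neg_eq_zero, ← HahnSeries.coeff_neg, ← h1]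
  congr 1
  rw [pow_succ]
  ring

/-- The indicator function of the empty set. -/
def vacFun : FinFun := fun A => if A = ∅ then 1 else 0

theorem vacFun_insert (b : ℂ) (A : Finset ℂ) : vacFun (insert b A) = 0 :=
  if_neg (Finset.insert_ne_empty b A)

theorem isRat_vacFun : IsRat vacFun := fun A =>
  ⟨_, (RatExt.const A 0).congr fun b _ => vacFun_insert b A⟩

theorem hat_vacFun (A : Finset ℂ) : hat vacFun A = 0 := by
  rw [hat_eq ((RatExt.const A 0).congr fun b _ => vacFun_insert b A), lconst, map_zero]

theorem eOp_vacFun (μ : ℂ⟦X⟧) (r : ℕ) : eOp μ r vacFun = 0 := by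
  funext A
  rw [eOp_apply, hat_vacFun, mul_zero]
  rfl

theorem cartanOp_vacFun (c : ℂ⟦X⟧) (α β : ℂ) (n : ℕ) :
    cartanOp c α β n vacFun = coeff n c • vacFun := by
  funext A
  rw [cartanOp_apply, Pi.smul_apply, smul_eq_mul, vacFun]
  split_ifs with h
  · rw [h, cartanSeries, Finset.prod_empty, mul_one c]
  · rw [mul_zero, mul_zero]

theorem cartanOp_zero (c : ℂ⟦X⟧) (α β : ℂ) (F : FinFun) :
    cartanOp c α β 0 F = coeff 0 c • F := by
  funext A
  rw [cartanOp_apply, constantCoeff_cartanSeries]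
  rfl

/-! ### The cyclic span of the vacuum as a module over the Yangian of sl₂. -/

/-- A product of operators `f^{(s)}` applied to the vacuum. -/
def fWord (l : List ℕ) : FinFun := l.foldr (fun s F => fOp s F) vacFun

theorem fWord_nil : fWord [] = vacFun := rfl

theorem fWord_cons (s : ℕ) (l : List ℕ) : fWord (s :: l) = fOp s (fWord l) := rfl

/-- The space that is generated from the vacuum by the operators `f^{(s)}`. -/
def fSpan : Submodule ℂ FinFun := Submodule.span ℂ (Set.range fWord)

theorem fWord_mem (l : List ℕ) : fWord l ∈ fSpan := Submodule.subset_span ⟨l, rfl⟩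

theorem mem_fSpan_of_forall_fWord (T : FinFun →ₗ[ℂ] FinFun) (h : ∀ l, T (fWord l) ∈ fSpan)
    {F : FinFun} (hF : F ∈ fSpan) : T F ∈ fSpan := by
  have : fSpan ≤ fSpan.comap T := Submodule.span_le.mpr (Set.range_subset_iff.mpr h)
  exact this hF

theorem fOp_mem (s : ℕ) {F : FinFun} (hF : F ∈ fSpan) : fOp s F ∈ fSpan :=
  mem_fSpan_of_forall_fWord (fOp s) (fun l => fWord_mem (s :: l)) hF

theorem isRat_fWord (l : List ℕ) : IsRat (fWord l) := by
  induction l with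
  | nil => exact isRat_vacFun
  | cons s l ih => exact ih.fOp s

theorem isRat_of_mem {F : FinFun} (hF : F ∈ fSpan) : IsRat F := by
  refine Submodule.span_induction (p := fun F _ => IsRat F) ?_ ?_ ?_ ?_ hF
  · rintro _ ⟨l, rfl⟩
    exact isRat_fWord l
  · simpa using isRat_vacFun.smul 0
  · exact fun F G _ _ hF hG => hF.add hG
  · exact fun c F _ hF => hF.smul c

theorem cartanOp_fWord_mem (c : ℂ⟦X⟧) (α β : ℂ) (l : List ℕ) (n : ℕ) :
    cartanOp c α β n (fWord l) ∈ fSpan := by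
  induction l generalizing n with
  | nil =>
    rw [fWord_nil, cartanOp_vacFun]
    exact fSpan.smul_mem _ (fWord_mem [])
  | cons s l ih =>
    induction n generalizing s with
    | zero =>
      rw [cartanOp_zero]
      exact fSpan.smul_mem _ (fWord_mem _)
    | succ n ihn =>
      have h : cartanOp c α β (n + 1) (fWord (s :: l)) =
          fOp s (cartanOp c α β (n + 1) (fWord l)) + cartanOp c α β n (fWord ((s + 1) :: l)) -
            fOp (s + 1) (cartanOp c α β n (fWord l)) + α • fOp s (cartanOp c α β n (fWord l)) -
            β • cartanOp c α β n (fWord (s :: l)) := by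
        simp only [fWord_cons]
        rw [add_sub_assoc, ← cartanOp_fOp]
        abel
      rw [h]
      exact fSpan.sub_mem (fSpan.add_mem (fSpan.sub_mem (fSpan.add_mem (fOp_mem s (ih _))
        (ihn _)) (fOp_mem _ (ih _))) (fSpan.smul_mem _ (fOp_mem _ (ih _))))
        (fSpan.smul_mem _ (ihn _))

theorem cartanOp_mem (c : ℂ⟦X⟧) (α β : ℂ) (n : ℕ) {F : FinFun} (hF : F ∈ fSpan) :
    cartanOp c α β n F ∈ fSpan :=
  mem_fSpan_of_forall_fWord _ (fun l => cartanOp_fWord_mem c α β l n) hF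

theorem eOp_fWord_mem (μ : ℂ⟦X⟧) (r : ℕ) (l : List ℕ) : eOp μ r (fWord l) ∈ fSpan := by
  induction l with
  | nil =>
    rw [fWord_nil, eOp_vacFun]
    exact fSpan.zero_mem
  | cons s l ih =>
    rw [fWord_cons, eOp_fOp μ r s (isRat_fWord l)]
    exact fSpan.add_mem (fOp_mem s ih) (cartanOp_fWord_mem _ _ _ _ _)

theorem eOp_mem (μ : ℂ⟦X⟧) (r : ℕ) {F : FinFun} (hF : F ∈ fSpan) : eOp μ r F ∈ fSpan := by
  refine Submodule.span_induction (p := fun F _ => eOp μ r F ∈ fSpan) ?_ ?_ ?_ ?_ hF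
  · rintro _ ⟨l, rfl⟩
    exact eOp_fWord_mem μ r l
  · have := eOp_smul μ r 0 isRat_vacFun
    rw [zero_smul, zero_smul] at this
    rw [this]
    exact fSpan.zero_mem
  · intro F G hF hG h1 h2
    rw [eOp_add μ r (isRat_of_mem hF) (isRat_of_mem hG)]
    exact fSpan.add_mem h1 h2
  · intro c F hF h1
    rw [eOp_smul μ r c (isRat_of_mem hF)]
    exact fSpan.smul_mem c h1

/-- The operator `f^{(s)}` on `fSpan`. -/
def fEnd (s : ℕ) : Module.End ℂ fSpan := (fOp s).restrict fun _ => fOp_mem s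

/-- The operator `cartanOp` on `fSpan`. -/
def cartanEnd (c : ℂ⟦X⟧) (α β : ℂ) (n : ℕ) : Module.End ℂ fSpan :=
  (cartanOp c α β n).restrict fun _ => cartanOp_mem c α β n

/-- The operator `e^{(r)}` on `fSpan`. -/
def eEnd (μ : ℂ⟦X⟧) (r : ℕ) : Module.End ℂ fSpan where
  toFun v := ⟨eOp μ r v, eOp_mem μ r v.2⟩
  map_add' v w := Subtype.ext (eOp_add μ r (isRat_of_mem v.2) (isRat_of_mem w.2))
  map_smul' c v := Subtype.ext (eOp_smul μ r c (isRat_of_mem v.2))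

/-- The operator `h^{(r)}` on `fSpan`. -/
def hEnd (μ : ℂ⟦X⟧) (r : ℕ) : Module.End ℂ fSpan := cartanEnd μ (-1) 1 (r + 1)

/-- The vacuum vector. -/
def vac : fSpan := ⟨vacFun, fWord_mem []⟩

theorem coe_fEnd (s : ℕ) (v : fSpan) : ((fEnd s v : fSpan) : FinFun) = fOp s v := rfl

theorem coe_cartanEnd (c : ℂ⟦X⟧) (α β : ℂ) (n : ℕ) (v : fSpan) :
    ((cartanEnd c α β n v : fSpan) : FinFun) = cartanOp c α β n v := rfl

theorem coe_eEnd (μ : ℂ⟦X⟧) (r : ℕ) (v : fSpan) :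
    ((eEnd μ r v : fSpan) : FinFun) = eOp μ r v := rfl

theorem eEnd_vac (μ : ℂ⟦X⟧) (r : ℕ) : eEnd μ r vac = 0 := Subtype.ext (eOp_vacFun μ r)

theorem cartanEnd_vac (c : ℂ⟦X⟧) (α β : ℂ) (n : ℕ) : cartanEnd c α β n vac = coeff n c • vac :=
  Subtype.ext (cartanOp_vacFun c α β n)

theorem cartanEnd_zero (c : ℂ⟦X⟧) (α β : ℂ) : cartanEnd c α β 0 = coeff 0 c • 1 :=
  LinearMap.ext fun v => Subtype.ext (cartanOp_zero c α β v)

theorem cartanEnd_comm (c c' : ℂ⟦X⟧) (α β α' β' : ℂ) (m n : ℕ) :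
    cartanEnd c α β m * cartanEnd c' α' β' n = cartanEnd c' α' β' n * cartanEnd c α β m := by
  refine LinearMap.ext fun v => Subtype.ext (funext fun A => ?_)
  simp only [Module.End.mul_apply, coe_cartanEnd, cartanOp_apply]
  ring

theorem lie_cartanEnd_fEnd (c : ℂ⟦X⟧) (α β : ℂ) (n s : ℕ) :
    ⁅cartanEnd c α β (n + 1), fEnd s⁆ - ⁅cartanEnd c α β n, fEnd (s + 1)⁆ =
      α • (fEnd s * cartanEnd c α β n) - β • (cartanEnd c α β n * fEnd s) :=
  LinearMap.ext fun v => Subtype.ext (cartanOp_fOp c α β n s v)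

theorem lie_cartanEnd_eEnd (μ c : ℂ⟦X⟧) (α β : ℂ) (n s : ℕ) :
    ⁅cartanEnd c α β (n + 1), eEnd μ s⁆ - ⁅cartanEnd c α β n, eEnd μ (s + 1)⁆ =
      β • (eEnd μ s * cartanEnd c α β n) - α • (cartanEnd c α β n * eEnd μ s) :=
  LinearMap.ext fun v => Subtype.ext (eOp_cartanOp μ c α β n s (isRat_of_mem v.2))

theorem fSpan_induction {p : fSpan → Prop} (h0 : p vac) (hf : ∀ s v, p v → p (fEnd s v))
    (hadd : ∀ v w, p v → p w → p (v + w)) (hsmul : ∀ (c : ℂ) v, p v → p (c • v)) (v : fSpan) :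
    p v := by
  obtain ⟨F, hF⟩ := v
  have key : ∀ l, p ⟨fWord l, fWord_mem l⟩ := fun l => by
    induction l with
    | nil => exact h0
    | cons s l ih => exact hf s _ ih
  refine Submodule.span_induction (p := fun F hF => p ⟨F, hF⟩) ?_ ?_ ?_ ?_ hF
  · rintro _ ⟨l, rfl⟩
    exact key l
  · have := hsmul 0 _ h0
    rwa [zero_smul] at this
  · exact fun F G hF hG h1 h2 => hadd ⟨F, hF⟩ ⟨G, hG⟩ h1 h2
  · exact fun c F hF h1 => hsmul c ⟨F, hF⟩ h1

/-- The space is generated from the vacuum by the operators f. -/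
theorem eq_zero_of_commute_fEnd {T : Module.End ℂ fSpan} (h : ∀ s, T * fEnd s = fEnd s * T)
    (h0 : T vac = 0) : T = 0 := by
  refine LinearMap.ext fun v => ?_
  rw [LinearMap.zero_apply]
  refine fSpan_induction (p := fun v => T v = 0) h0 (fun s v hv => ?_) (fun v w h1 h2 => ?_) (fun c v h1 => ?_) v
  · rw [← Module.End.mul_apply, h, Module.End.mul_apply, hv, map_zero]
  · rw [map_add, h1, h2, add_zero]
  · rw [map_smul, h1, smul_zero]

/-- The bracket of the defect of the e–e relation with f t is the sum of two defects of the h–e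
relation, which vanish. Since the defect also kills the vacuum, `eq_zero_of_commute_fEnd` proves the
e–e relation without iterated expansions at infinity. -/
theorem eEnd_relation_comm {A : Type*} [Ring A] {e h f : ℕ → A}
    (ef : ∀ r s, ⁅e r, f s⁆ = h (r + s))
    (he : ∀ r s, ⁅h (r + 1), e s⁆ - ⁅h r, e (s + 1)⁆ = h r * e s + e s * h r) (r s t : ℕ) :
    (⁅e (r + 1), e s⁆ - ⁅e r, e (s + 1)⁆ - (e r * e s + e s * e r)) * f t =
      f t * (⁅e (r + 1), e s⁆ - ⁅e r, e (s + 1)⁆ - (e r * e s + e s * e r)) := by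
  have h1 := he (r + t) s
  have h2 := he (s + t) r
  have e1 := ef r t
  have e2 := ef s t
  have e3 := ef (r + 1) t
  have e4 := ef (s + 1) t
  rw [add_right_comm] at e3 e4
  simp only [Ring.lie_def] at h1 h2 e1 e2 e3 e4 ⊢
  rw [← e1, ← e3] at h1
  rw [← e2, ← e4] at h2
  linear_combination (norm := noncomm_ring) h1 + h2

/-- Putting H 0 = 1 in front of the h's lets the recursion at index 0 supply the relations of h 0
with e and f. -/
theorem IsDrinfeld.of_shift_relations {A : Type*} [Ring A] [Algebra ℂ A] {e h f : ℕ → A} {H : ℕ → A}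
    (hH : ∀ r, H (r + 1) = h r) (H0 : H 0 = 1) (hh : ∀ r s, ⁅h r, h s⁆ = 0)
    (ef : ∀ r s, ⁅e r, f s⁆ = h (r + s))
    (he : ∀ n s, ⁅H (n + 1), e s⁆ - ⁅H n, e (s + 1)⁆ =
      (1 : ℂ) • (e s * H n) - (-1 : ℂ) • (H n * e s))
    (hf : ∀ n s, ⁅H (n + 1), f s⁆ - ⁅H n, f (s + 1)⁆ =
      (-1 : ℂ) • (f s * H n) - (1 : ℂ) • (H n * f s))
    (ee : ∀ r s, ⁅e (r + 1), e s⁆ - ⁅e r, e (s + 1)⁆ - (e r * e s + e s * e r) = 0)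
    (ff : ∀ r s, ⁅f (r + 1), f s⁆ - ⁅f r, f (s + 1)⁆ = -(f r * f s + f s * f r)) :
    IsDrinfeld e h f where
  hh := hh
  ef := ef
  h0e s := by
    have := he 0 s
    rw [hH, H0, Ring.lie_def 1, one_mul, mul_one, mul_one, one_mul, sub_self, sub_zero] at this
    rw [this, two_mul]
    module
  h0f s := by
    have := hf 0 s
    rw [hH, H0, Ring.lie_def 1, one_mul, mul_one, mul_one, one_mul, sub_self, sub_zero] at this
    rw [this, two_mul]
    module
  he r s := by
    rw [← hH, ← hH, he]
    module
  hf r s := by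
    rw [← hH, ← hH, hf]
    module
  ee r s := sub_eq_zero.mp (ee r s)
  ff := ff

theorem lie_eEnd_fEnd (μ : ℂ⟦X⟧) (r s : ℕ) : ⁅eEnd μ r, fEnd s⁆ = hEnd μ (r + s) :=
  LinearMap.ext fun v => Subtype.ext (by
    have := eOp_fOp μ r s (isRat_of_mem v.2)
    rw [← sub_eq_iff_eq_add'] at this
    exact this)

theorem lie_hEnd_eEnd (μ : ℂ⟦X⟧) (r s : ℕ) :
    ⁅hEnd μ (r + 1), eEnd μ s⁆ - ⁅hEnd μ r, eEnd μ (s + 1)⁆ =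
      hEnd μ r * eEnd μ s + eEnd μ s * hEnd μ r := by
  rw [hEnd, hEnd, lie_cartanEnd_eEnd]
  module

theorem isDrinfeld_fSpan {μ : ℂ⟦X⟧} (hμ : coeff 0 μ = 1) :
    IsDrinfeld (eEnd μ) (hEnd μ) fEnd :=
  IsDrinfeld.of_shift_relations (H := cartanEnd μ (-1) 1) (fun _ => rfl)
    (by rw [cartanEnd_zero, hμ, one_smul])
    (fun r s => sub_eq_zero.mpr (cartanEnd_comm _ _ _ _ _ _ _ _))
    (lie_eEnd_fEnd μ) (lie_cartanEnd_eEnd μ μ (-1) 1) (lie_cartanEnd_fEnd μ (-1) 1)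
    (fun r s => eq_zero_of_commute_fEnd
      (eEnd_relation_comm (lie_eEnd_fEnd μ) (lie_hEnd_eEnd μ) r s) (by
        simp only [Ring.lie_def, LinearMap.sub_apply, LinearMap.add_apply, Module.End.mul_apply,
          eEnd_vac, map_zero, sub_zero, add_zero]))
    (fun r s => LinearMap.ext fun v => Subtype.ext (fOp_relation r s v))

/-! ### Leading coefficients at infinity and linear independence of the ordered words. -/

/-- The Laurent series `ψ` in `u⁻¹` has degree at most `m` in `u`, and `c` is its coefficient of
`u ^ m`. -/
def HasLead (m : ℕ) (ψ : LaurentSeries ℂ) (c : ℂ) : Prop :=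
  ∃ g : ℂ⟦X⟧, ψ = uInf ^ m * (g : LaurentSeries ℂ) ∧ coeff 0 g = c

namespace HasLead

variable {m n : ℕ} {ψ ψ' : LaurentSeries ℂ} {c c' : ℂ}

theorem coeff_eq (h : HasLead m ψ c) : ψ.coeff (-(m : ℤ)) = c := by
  obtain ⟨g, rfl, rfl⟩ := h
  rw [coeff_uInf_pow_mul, neg_add_cancel]
  exact coeff_natCast_coe g 0

theorem add (h : HasLead m ψ c) (h' : HasLead m ψ' c') : HasLead m (ψ + ψ') (c + c') := by
  obtain ⟨g, rfl, rfl⟩ := h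
  obtain ⟨g', rfl, rfl⟩ := h'
  exact ⟨g + g', by rw [PowerSeries.coe_add, mul_add], map_add _ _ _⟩

theorem mul (h : HasLead m ψ c) (h' : HasLead n ψ' c') : HasLead (m + n) (ψ * ψ') (c * c') := by
  obtain ⟨g, rfl, rfl⟩ := h
  obtain ⟨g', rfl, rfl⟩ := h'
  refine ⟨g * g', by rw [PowerSeries.coe_mul, pow_add]; ring, ?_⟩
  simp only [coeff_zero_eq_constantCoeff, map_mul]

theorem const (c : ℂ) : HasLead 0 (lconst c) c :=
  ⟨PowerSeries.C c, by rw [PowerSeries.coe_C, pow_zero, one_mul], by simp⟩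

theorem pow (n : ℕ) : HasLead n (uInf ^ n) 1 :=
  ⟨1, by rw [PowerSeries.coe_one, mul_one], by simp⟩

theorem pow_of_lt (h : n < m) : HasLead m (uInf ^ n) 0 := by
  obtain ⟨k, rfl⟩ := Nat.exists_eq_add_of_lt h
  refine ⟨PowerSeries.X ^ (k + 1), ?_, by simp⟩
  rw [PowerSeries.coe_pow, add_assoc, pow_add, mul_assoc, ← mul_pow, uInf_mul_X, one_pow, mul_one]

theorem zero (m : ℕ) : HasLead m 0 0 := ⟨0, by rw [PowerSeries.coe_zero, mul_zero], by simp⟩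

theorem sum {ι : Type*} (s : Finset ι) {ψ : ι → LaurentSeries ℂ} {c : ι → ℂ}
    (h : ∀ i ∈ s, HasLead m (ψ i) (c i)) : HasLead m (∑ i ∈ s, ψ i) (∑ i ∈ s, c i) := by
  classical
  induction s using Finset.induction_on with
  | empty => simpa using zero m
  | insert i s hi ih =>
    rw [Finset.sum_insert hi, Finset.sum_insert hi]
    exact (h i (Finset.mem_insert_self i s)).add
      (ih fun j hj => h j (Finset.mem_insert_of_mem hj))

theorem prod_one {ι : Type*} (s : Finset ι) {ψ : ι → LaurentSeries ℂ}
    (h : ∀ i ∈ s, HasLead 0 (ψ i) 1) : HasLead 0 (∏ i ∈ s, ψ i) 1 := by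
  classical
  induction s using Finset.induction_on with
  | empty => simpa using const 1
  | insert i s hi ih =>
    rw [Finset.prod_insert hi]
    simpa using (h i (Finset.mem_insert_self i s)).mul
      (ih fun j hj => h j (Finset.mem_insert_of_mem hj))

theorem one_add_inv (a c : ℂ) : HasLead 0 (1 + lconst c * (uInf - lconst a)⁻¹) 1 := by
  refine ⟨(1 + PowerSeries.C (c - a) * PowerSeries.X) *
      (1 + PowerSeries.C (0 - a) * PowerSeries.X)⁻¹, ?_, ?_⟩
  · have h1 := coe_linearFactor a c
    have h2 := coe_linearFactor a 0
    have h5 := congrArg (fun s : ℂ⟦X⟧ => (s : LaurentSeries ℂ)) (linearFactor_mul_inv (0 - a))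
    simp only [PowerSeries.coe_mul, PowerSeries.coe_one] at h5 ⊢
    rw [sub_zero] at h2
    rw [one_add_inv_eq, ← h1, ← h2, eq_inv_of_mul_eq_one_right h5, pow_zero, one_mul]
    have h8 := uInf_ne_zero
    have h9 := left_ne_zero_of_mul_eq_one h5
    field_simp
  · simp only [coeff_zero_eq_constantCoeff, map_mul]
    simp [PowerSeries.constantCoeff_inv]

theorem one_add (a : ℂ) : HasLead 0 (1 + (uInf - lconst a)⁻¹) 1 := by
  have := one_add_inv a 1
  rwa [show lconst 1 = 1 from map_one _, one_mul] at this

theorem one_sub (a : ℂ) : HasLead 0 (1 - (uInf - lconst a)⁻¹) 1 := by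
  have := one_add_inv a (-1)
  have h : 1 - (uInf - lconst a)⁻¹ = 1 + lconst (-1) * (uInf - lconst a)⁻¹ := by
    have h : lconst (-1) = -1 := by rw [lconst, map_neg, map_one]
    rw [h]; ring
  rwa [h]

end HasLead

/-- The coefficient of `u ^ m` in the expansion at infinity of `fWord l` in one point, when all
letters are at most `m`. -/
def leadWord (m : ℕ) : List ℕ → FinFun
  | [] => 0
  | s :: l => (if s = m then fWord l else 0) + fOp s (leadWord m l)

theorem hasLead_hat_fWord {m : ℕ} {l : List ℕ} (hl : ∀ s ∈ l, s ≤ m) (A : Finset ℂ) :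
    HasLead m (hat (fWord l) A) (leadWord m l A) := by
  induction l generalizing A with
  | nil =>
    rw [fWord_nil, hat_vacFun]
    exact HasLead.zero m
  | cons s l ih =>
    have ih := ih fun t ht => hl t (List.mem_cons_of_mem s ht)
    rw [fWord_cons, hat_fOp s (isRat_fWord l), leadWord, Pi.add_apply, fOp_apply]
    refine HasLead.add ?_ (HasLead.sum A fun a _ => ?_)
    · have h1 : HasLead m (uInf ^ s) (if s = m then 1 else 0) := by
        split_ifs with h
        · rw [h]
          exact HasLead.pow m
        · exact HasLead.pow_of_lt (lt_of_le_of_ne (hl s List.mem_cons_self) h)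
      have := (h1.mul (HasLead.prod_one A fun a _ => HasLead.one_sub a)).mul
        (HasLead.const (fWord l A))
      rw [add_zero, add_zero] at this
      convert this using 1
      · rfl
      · split_ifs <;> simp
    · have := ((HasLead.const (a ^ s * fWeight a (A.erase a))).mul (HasLead.one_add a)).mul
        (ih (A.erase a))
      rwa [mul_one, add_zero, zero_add] at this

theorem leadWord_eq_zero {m : ℕ} {l : List ℕ} (h : m ∉ l) : leadWord m l = 0 := by
  induction l with
  | nil => rfl
  | cons s l ih =>
    rw [List.mem_cons, not_or] at h
    rw [leadWord, ih h.2, map_zero, if_neg (Ne.symm h.1), add_zero]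

/-- All weights tend to 1 at infinity, so the point at infinity is absorbed by one letter equal to m
at a time. In a decreasing word these letters stand at the front, and removing any one of them gives
the same word. -/
theorem leadWord_eq {m : ℕ} {l : List ℕ} (hs : l.Pairwise (· ≥ ·)) (hl : ∀ s ∈ l, s ≤ m) :
    leadWord m l = (l.count m : ℂ) • fWord (l.erase m) := by
  by_cases hm : m ∈ l
  swap
  · rw [leadWord_eq_zero hm, List.count_eq_zero_of_not_mem hm, Nat.cast_zero, zero_smul]
  induction l with
  | nil => simp at hm
  | cons s l ih =>
    rw [List.pairwise_cons] at hs
    have hsm : s = m := by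
      refine le_antisymm (hl s List.mem_cons_self) ?_
      rcases List.mem_cons.mp hm with h | h
      · exact h.le
      · exact hs.1 m h
    subst hsm
    rw [leadWord, if_pos rfl, List.erase_cons_head, List.count_cons_self]
    by_cases hl' : s ∈ l
    · rw [ih hs.2 (fun t ht => hl t (List.mem_cons_of_mem s ht)) hl', map_smul]
      have : fOp s (fWord (l.erase s)) = fWord l := by
        cases l with
        | nil => simp at hl'
        | cons t l =>
          have : t = s := le_antisymm (hl t (by simp)) (by
            rcases List.mem_cons.mp hl' with h | h
            · exact h.le
            · exact (List.pairwise_cons.mp hs.2).1 s h)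
          rw [this, List.erase_cons_head, fWord_cons]
      rw [this]
      push_cast
      module
    · rw [leadWord_eq_zero hl', List.count_eq_zero_of_not_mem hl']
      simp

/-- The word with the letters of a multiset in decreasing order. -/
def sortedWord (x : Multiset ℕ) : fSpan := ⟨fWord (x.sort (· ≥ ·)), fWord_mem _⟩

/-- The coefficient of `u ^ m` of the expansion at infinity. -/
def hatCoeff (m : ℕ) (A : Finset ℂ) : fSpan →ₗ[ℂ] ℂ where
  toFun v := (hat v A).coeff (-(m : ℤ))
  map_add' v w := by
    rw [Submodule.coe_add, hat_add (isRat_of_mem v.2) (isRat_of_mem w.2), HahnSeries.coeff_add]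
  map_smul' c v := by
    rw [Submodule.coe_smul, hat_smul c (isRat_of_mem v.2), coeff_lconst_mul]
    rfl

theorem sort_erase (x : Multiset ℕ) (m : ℕ) :
    (x.sort (· ≥ ·)).erase m = (x.erase m).sort (· ≥ ·) := by
  refine List.Perm.eq_of_pairwise' (r := (· ≥ ·)) ?_ ?_ ?_
  · exact (Multiset.pairwise_sort x _).sublist List.erase_sublist
  · exact Multiset.pairwise_sort _ _
  · rw [← Multiset.coe_eq_coe, ← Multiset.coe_erase, Multiset.sort_eq, Multiset.sort_eq]

theorem hatCoeff_sortedWord {m : ℕ} {x : Multiset ℕ} (hx : ∀ s ∈ x, s ≤ m) (A : Finset ℂ) :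
    hatCoeff m A (sortedWord x) = x.count m * (sortedWord (x.erase m) : FinFun) A := by
  have hx' : ∀ s ∈ x.sort (· ≥ ·), s ≤ m := fun s hs => hx s ((Multiset.mem_sort _).mp hs)
  have h := (hasLead_hat_fWord hx' A).coeff_eq
  rw [leadWord_eq (Multiset.pairwise_sort x _) hx', sort_erase] at h
  rw [← Multiset.coe_count, Multiset.sort_eq] at h
  exact h

/-- The derivation of the combinations of multisets that removes a letter `m`. -/
def eraseLetter (m : ℕ) : (Multiset ℕ →₀ ℂ) →ₗ[ℂ] (Multiset ℕ →₀ ℂ) :=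
  Finsupp.linearCombination ℂ fun x => Finsupp.single (x.erase m) (x.count m : ℂ)

theorem eraseLetter_apply (m : ℕ) (c : Multiset ℕ →₀ ℂ) (y : Multiset ℕ) :
    eraseLetter m c y = (y.count m + 1) * c (m ::ₘ y) := by
  induction c using Finsupp.induction_linear with
  | zero => simp
  | add c d hc hd => rw [map_add, Finsupp.add_apply, hc, hd, Finsupp.add_apply, mul_add]
  | single x a =>
    rw [eraseLetter, Finsupp.linearCombination_single, Finsupp.smul_apply, smul_eq_mul,
      Finsupp.single_apply, Finsupp.single_apply]
    by_cases hm : m ∈ x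
    · have h : x.erase m = y ↔ x = m ::ₘ y :=
        ⟨fun h => by rw [← h, Multiset.cons_erase hm], fun h => by
          rw [h, Multiset.erase_cons_head]⟩
      by_cases hy : x = m ::ₘ y
      · rw [if_pos (h.mpr hy), if_pos hy, hy, Multiset.count_cons_self]
        push_cast
        ring
      · rw [if_neg (fun h' => hy (h.mp h')), if_neg hy, mul_zero, mul_zero]
    · have hy : x ≠ m ::ₘ y := fun h => hm (h ▸ Multiset.mem_cons_self m y)
      rw [if_neg hy, Multiset.count_eq_zero_of_notMem hm]
      simp

theorem linearCombination_eraseLetter {m : ℕ} {c : Multiset ℕ →₀ ℂ}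
    (hc : ∀ x, c x ≠ 0 → ∀ s ∈ x, s ≤ m)
    (h0 : Finsupp.linearCombination ℂ sortedWord c = 0) :
    Finsupp.linearCombination ℂ sortedWord (eraseLetter m c) = 0 := by
  refine Subtype.ext (funext fun A => ?_)
  have h1 := congrArg (hatCoeff m A) h0
  rw [map_zero, Finsupp.linearCombination_apply, map_finsuppSum] at h1
  have h2 : ∀ c : Multiset ℕ →₀ ℂ,
      ((Finsupp.linearCombination ℂ sortedWord (eraseLetter m c) : fSpan) : FinFun) A =
      c.sum fun x a => a * (x.count m * (sortedWord (x.erase m) : FinFun) A) := by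
    intro c
    induction c using Finsupp.induction_linear with
    | zero => simp
    | add c d hc hd =>
      rw [Finsupp.sum_add_index' (by simp) (by intros; ring), ← hc, ← hd, map_add, map_add]
      rfl
    | single x a =>
      rw [Finsupp.sum_single_index (by simp), eraseLetter, Finsupp.linearCombination_single,
        map_smul, Finsupp.linearCombination_single]
      rfl
  rw [h2]
  refine Eq.trans (Finsupp.sum_congr fun x hx => ?_) h1
  rw [map_smul, hatCoeff_sortedWord (hc x (Finsupp.mem_support_iff.mp hx)), smul_eq_mul]

/-- Differentiating a linear relation by its largest possible letter m gives a relation of smaller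
sum plus length, hence the zero one. As the multiplicities are nonzero in ℂ, no word of the relation
contains m; descending in m leaves the empty word, whose value at ∅ is 1. The length enters the
bound since the letter 0 does not change the sum. -/
theorem eq_zero_of_linearCombination_sortedWord (B : ℕ) (c : Multiset ℕ →₀ ℂ)
    (hc : ∀ x, c x ≠ 0 → x.sum + x.card < B)
    (h0 : Finsupp.linearCombination ℂ sortedWord c = 0) : c = 0 := by
  induction B generalizing c with
  | zero =>
    ext x
    by_contra h
    exact absurd (hc x h) (Nat.not_lt_zero _)
  | succ B ihB =>
    have key : ∀ (m : ℕ) (c : Multiset ℕ →₀ ℂ), (∀ x, c x ≠ 0 → x.sum + x.card < B + 1) →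
        (∀ x, c x ≠ 0 → ∀ s ∈ x, s < m) → Finsupp.linearCombination ℂ sortedWord c = 0 →
        c = 0 := by
      intro m
      induction m with
      | zero =>
        intro c _ hc h0
        have h1 : c = Finsupp.single 0 (c 0) := by
          ext x
          rw [Finsupp.single_apply]
          split_ifs with h
          · rw [h]
          · by_contra hx
            exact h (Multiset.eq_zero_of_forall_notMem fun s hs =>
              absurd (hc x hx s hs) (Nat.not_lt_zero _)).symm
        rw [h1, Finsupp.linearCombination_single] at h0
        have h2 : c 0 * fWord ((0 : Multiset ℕ).sort (· ≥ ·)) ∅ = 0 :=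
          congrFun (congrArg Subtype.val h0) ∅
        rw [Multiset.sort_zero, fWord_nil, vacFun, if_pos rfl, mul_one] at h2
        rw [h1, h2, Finsupp.single_zero]
      | succ m ihm =>
        intro c hB hc h0
        have h1 := ihB (eraseLetter m c) (fun y hy => by
          rw [eraseLetter_apply] at hy
          have := hB _ (right_ne_zero_of_mul hy)
          rw [Multiset.sum_cons, Multiset.card_cons] at this
          omega) (linearCombination_eraseLetter (fun x hx s hs => Nat.lt_succ_iff.mp (hc x hx s hs)) h0)
        refine ihm c hB (fun x hx s hs => lt_of_le_of_ne (Nat.lt_succ_iff.mp (hc x hx s hs)) ?_) h0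
        rintro rfl
        have h2 := DFunLike.congr_fun h1 (x.erase s)
        rw [eraseLetter_apply, Multiset.cons_erase hs, Finsupp.zero_apply, mul_eq_zero] at h2
        exact h2.elim (Nat.cast_add_one_ne_zero _) hx
    refine key (B + 1) c hc (fun x hx s hs => ?_) h0
    have := Multiset.le_sum_of_mem hs
    have := hc x hx
    omega

theorem linearIndependent_sortedWord : LinearIndependent ℂ sortedWord := by
  rw [linearIndependent_iff]
  intro c h0
  refine eq_zero_of_linearCombination_sortedWord (c.support.sup (fun x => x.sum + x.card) + 1) c
    (fun x hx => ?_) h0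
  exact Nat.lt_succ_of_le (Finset.le_sup (f := fun x : Multiset ℕ => x.sum + x.card)
    (Finsupp.mem_support_iff.mpr hx))

/-! ### Closure under the lowering operators and spanning by ordered words. -/

section Closure

variable {M : Type*} [AddCommGroup M] [Module ℂ M]

/-- The smallest subspace that contains `N` and is stable under the operators `f s`. -/
def fClosure (f : ℕ → Module.End ℂ M) (N : Submodule ℂ M) : Submodule ℂ M :=
  sInf {P | N ≤ P ∧ ∀ s, ∀ m ∈ P, f s m ∈ P}

variable {f : ℕ → Module.End ℂ M} {N : Submodule ℂ M}

theorem le_fClosure : N ≤ fClosure f N := le_sInf fun _ hP => hP.1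

theorem map_mem_fClosure (s : ℕ) {m : M} (hm : m ∈ fClosure f N) : f s m ∈ fClosure f N := by
  rw [fClosure, Submodule.mem_sInf] at hm ⊢
  exact fun P hP => hP.2 s m (hm P hP)

theorem fClosure_le {P : Submodule ℂ M} (h : N ≤ P) (hf : ∀ s, ∀ m ∈ P, f s m ∈ P) :
    fClosure f N ≤ P := sInf_le ⟨h, hf⟩

/-- The vectors of the closure that all g n send into the closure form an f-stable subspace: the
shift relation writes g (n + 1) f s in terms of g n f (s + 1), g n f s and terms that begin with an
f, so induction on n for all s at once suffices. -/
theorem map_fClosure_of_shift {g : ℕ → Module.End ℂ M} {α β γ : ℂ}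
    (h0 : ∀ s m, g 0 (f s m) = f s (g 0 m) + γ • f s m)
    (h : ∀ n s m, g (n + 1) (f s m) = f s (g (n + 1) m) + (g n (f (s + 1) m) - f (s + 1) (g n m)) +
      α • f s (g n m) + β • g n (f s m))
    (hN : ∀ n, ∀ m ∈ N, g n m ∈ fClosure f N) (n : ℕ) {m : M} (hm : m ∈ fClosure f N) :
    g n m ∈ fClosure f N := by
  have key : fClosure f N ≤ fClosure f N ⊓ ⨅ n, (fClosure f N).comap (g n) := by
    refine fClosure_le (le_inf le_fClosure (le_iInf fun n m hm => hN n m hm)) fun s m hm => ?_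
    rw [Submodule.mem_inf, Submodule.mem_iInf] at hm ⊢
    refine ⟨map_mem_fClosure s hm.1, fun n => ?_⟩
    rw [Submodule.mem_comap]
    have hm2 : ∀ n, g n m ∈ fClosure f N := hm.2
    induction n generalizing s with
    | zero =>
      rw [h0]
      exact add_mem (map_mem_fClosure s (hm2 0)) (Submodule.smul_mem _ _ (map_mem_fClosure s hm.1))
    | succ n ih =>
      rw [h]
      exact add_mem (add_mem (add_mem (map_mem_fClosure s (hm2 _))
        (sub_mem (ih _) (map_mem_fClosure _ (hm2 n))))
        (Submodule.smul_mem _ _ (map_mem_fClosure s (hm2 n)))) (Submodule.smul_mem _ _ (ih s))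
  exact (Submodule.mem_iInf _).mp (key hm).2 n

variable {e h : ℕ → Module.End ℂ M}

theorem IsDrinfeld.h_shift_zero (D : IsDrinfeld e h f) (s : ℕ) (m : M) :
    h 0 (f s m) = f s (h 0 m) + (-2 : ℂ) • f s m := by
  have := LinearMap.congr_fun (D.h0f s) m
  simp only [Ring.lie_def, two_mul] at this
  have h2 : h 0 (f s m) - f s (h 0 m) = -(f s m + f s m) := this
  rw [sub_eq_iff_eq_add'.mp h2]
  module

theorem IsDrinfeld.h_shift_succ (D : IsDrinfeld e h f) (n s : ℕ) (m : M) :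
    h (n + 1) (f s m) = f s (h (n + 1) m) + (h n (f (s + 1) m) - f (s + 1) (h n m)) +
      (-1 : ℂ) • f s (h n m) + (-1 : ℂ) • h n (f s m) := by
  have := LinearMap.congr_fun (D.hf n s) m
  simp only [Ring.lie_def] at this
  have h2 : h (n + 1) (f s m) - f s (h (n + 1) m) - (h n (f (s + 1) m) - f (s + 1) (h n m)) =
    -(h n (f s m) + f s (h n m)) := this
  rw [sub_eq_iff_eq_add, sub_eq_iff_eq_add'] at h2
  rw [h2]
  module

theorem IsDrinfeld.h_mem_fClosure (D : IsDrinfeld e h f)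
    (hN : ∀ n, ∀ m ∈ N, h n m ∈ fClosure f N) (n : ℕ) {m : M} (hm : m ∈ fClosure f N) :
    h n m ∈ fClosure f N :=
  map_fClosure_of_shift D.h_shift_zero D.h_shift_succ hN n hm

theorem IsDrinfeld.e_mem_fClosure (D : IsDrinfeld e h f)
    (hN : ∀ n, ∀ m ∈ N, h n m ∈ fClosure f N) (heN : ∀ n, ∀ m ∈ N, e n m ∈ fClosure f N)
    (n : ℕ) {m : M} (hm : m ∈ fClosure f N) : e n m ∈ fClosure f N := by
  have key : fClosure f N ≤ fClosure f N ⊓ (fClosure f N).comap (e n) := by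
    refine fClosure_le (le_inf le_fClosure (heN n)) fun s m hm => ?_
    rw [Submodule.mem_inf] at hm ⊢
    refine ⟨map_mem_fClosure s hm.1, ?_⟩
    have h2 : e n (f s m) - f s (e n m) = h (n + s) m := LinearMap.congr_fun (D.ef n s) m
    rw [Submodule.mem_comap, sub_eq_iff_eq_add'.mp h2]
    exact add_mem (map_mem_fClosure s hm.2) (D.h_mem_fClosure hN _ hm.1)
  exact (key hm).2

/-- A product of operators `f s` applied to `v`. -/
def opWord (f : ℕ → Module.End ℂ M) (v : M) (l : List ℕ) : M := l.foldr (fun s m => f s m) v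

theorem fClosure_span_singleton_le (v : M) :
    fClosure f (ℂ ∙ v) ≤ Submodule.span ℂ (Set.range (opWord f v)) := by
  refine fClosure_le ?_ fun s m hm => ?_
  · rw [Submodule.span_singleton_le_iff_mem]
    exact Submodule.subset_span ⟨[], rfl⟩
  · have : Submodule.span ℂ (Set.range (opWord f v)) ≤
        (Submodule.span ℂ (Set.range (opWord f v))).comap (f s) := by
      rw [Submodule.span_le]
      rintro _ ⟨l, rfl⟩
      exact Submodule.subset_span ⟨s :: l, rfl⟩
    exact this hm

/-- The span of the words with sum of letters less than `n`. -/
def lowWords (f : ℕ → Module.End ℂ M) (v : M) (n : ℕ) : Submodule ℂ M :=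
  Submodule.span ℂ (opWord f v '' {l | l.sum < n})

theorem map_mem_lowWords (v : M) (s n : ℕ) {m : M} (hm : m ∈ lowWords f v n) :
    f s m ∈ lowWords f v (s + n) := by
  have : lowWords f v n ≤ (lowWords f v (s + n)).comap (f s) := by
    rw [lowWords, Submodule.span_le]
    rintro _ ⟨l, hl, rfl⟩
    refine Submodule.subset_span ⟨s :: l, ?_, rfl⟩
    rw [Set.mem_ofPred_eq, List.sum_cons]
    exact Nat.add_lt_add_left hl s
  exact this hm

/-- Modulo words of smaller sum, the f–f relation moves one unit of index between the two letters of
a commutator. So both [f a, f b] and [f b, f a] agree with [f 0, f (a + b)], and half of their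
difference is [f a, f b]. -/
theorem opWord_swap_sub_mem
    (hff : ∀ r s, ⁅f (r + 1), f s⁆ - ⁅f r, f (s + 1)⁆ = -(f r * f s + f s * f r))
    (v : M) (l : List ℕ) (a b : ℕ) :
    opWord f v (a :: b :: l) - opWord f v (b :: a :: l) ∈ lowWords f v (a + b + l.sum) := by
  have shift : ∀ r s, (opWord f v ((r + 1) :: s :: l) - opWord f v (s :: (r + 1) :: l)) -
      (opWord f v (r :: (s + 1) :: l) - opWord f v ((s + 1) :: r :: l)) ∈
        lowWords f v (r + 1 + s + l.sum) := by
    intro r s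
    have h1 : opWord f v ((r + 1) :: s :: l) - opWord f v (s :: (r + 1) :: l) -
      (opWord f v (r :: (s + 1) :: l) - opWord f v ((s + 1) :: r :: l)) =
      -(opWord f v (r :: s :: l) + opWord f v (s :: r :: l)) :=
        LinearMap.congr_fun (hff r s) (opWord f v l)
    rw [h1]
    refine neg_mem (add_mem (Submodule.subset_span ⟨_, ?_, rfl⟩)
      (Submodule.subset_span ⟨_, ?_, rfl⟩)) <;>
    · simp only [Set.mem_ofPred_eq, List.sum_cons]
      omega
  have shift0 : ∀ r s, (opWord f v (r :: s :: l) - opWord f v (s :: r :: l)) -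
      (opWord f v (0 :: (r + s) :: l) - opWord f v ((r + s) :: 0 :: l)) ∈
        lowWords f v (r + s + l.sum) := by
    intro r
    induction r with
    | zero =>
      intro s
      rw [zero_add, sub_self]
      exact zero_mem _
    | succ r ih =>
      intro s
      have h1 := ih (s + 1)
      have h2 := shift r s
      rw [← add_assoc, add_right_comm r s 1] at h1
      simpa only [sub_add_sub_cancel] using add_mem h2 h1
  have h1 := shift0 a b
  have h2 := shift0 b a
  rw [add_comm b a] at h2
  have h3 := (lowWords f v (a + b + l.sum)).smul_mem (2⁻¹ : ℂ) (sub_mem h1 h2)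
  convert h3 using 1
  module

theorem opWord_perm_sub_mem
    (hff : ∀ r s, ⁅f (r + 1), f s⁆ - ⁅f r, f (s + 1)⁆ = -(f r * f s + f s * f r))
    (v : M) {l l' : List ℕ} (h : l.Perm l') :
    opWord f v l - opWord f v l' ∈ lowWords f v l.sum := by
  induction h with
  | nil =>
    rw [sub_self]
    exact zero_mem _
  | cons s h ih =>
    have := map_mem_lowWords v s _ ih
    rw [map_sub] at this
    rw [List.sum_cons]
    exact this
  | swap a b l =>
    rw [List.sum_cons, List.sum_cons, ← add_assoc]
    exact opWord_swap_sub_mem hff v l b a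
  | trans h1 h2 ih1 ih2 =>
    rw [← h1.sum_eq] at ih2
    simpa only [sub_add_sub_cancel] using add_mem ih1 ih2

theorem opWord_mem_span_sorted
    (hff : ∀ r s, ⁅f (r + 1), f s⁆ - ⁅f r, f (s + 1)⁆ = -(f r * f s + f s * f r))
    (v : M) (l : List ℕ) :
    opWord f v l ∈ Submodule.span ℂ
      (Set.range fun x : Multiset ℕ => opWord f v (x.sort (· ≥ ·))) := by
  induction hn : l.sum using Nat.strong_induction_on generalizing l with
  | _ n ih =>
  have h1 : lowWords f v l.sum ≤ Submodule.span ℂ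
      (Set.range fun x : Multiset ℕ => opWord f v (x.sort (· ≥ ·))) := by
    rw [lowWords, Submodule.span_le]
    rintro _ ⟨l', hl', rfl⟩
    exact ih _ (hn ▸ hl') l' rfl
  have hp : l.Perm ((l : Multiset ℕ).sort (· ≥ ·)) := by
    rw [← Multiset.coe_eq_coe, Multiset.sort_eq]
  have h2 := h1 (opWord_perm_sub_mem hff v hp)
  have h3 := Submodule.subset_span (R := ℂ)
    (Set.mem_range_self (f := fun x : Multiset ℕ => opWord f v (x.sort (· ≥ ·))) (l : Multiset ℕ))
  simpa using add_mem h2 h3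

end Closure

/-! ### Cyclic modules, and the embedding of the Verma module over the Yangian of sl₂ into the
model. -/

theorem IsDrinfeld.map {A B : Type*} [Ring A] [Ring B] {e h f : ℕ → A} (D : IsDrinfeld e h f)
    (φ : A →+* B) : IsDrinfeld (fun r => φ (e r)) (fun r => φ (h r)) (fun r => φ (f r)) where
  hh r s := by simpa [Ring.lie_def] using congrArg φ (D.hh r s)
  ef r s := by simpa [Ring.lie_def] using congrArg φ (D.ef r s)
  h0e s := by simpa [Ring.lie_def, two_mul] using congrArg φ (D.h0e s)
  h0f s := by simpa [Ring.lie_def, two_mul] using congrArg φ (D.h0f s)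
  he r s := by simpa [Ring.lie_def] using congrArg φ (D.he r s)
  hf r s := by simpa [Ring.lie_def] using congrArg φ (D.hf r s)
  ee r s := by simpa [Ring.lie_def] using congrArg φ (D.ee r s)
  ff r s := by simpa [Ring.lie_def] using congrArg φ (D.ff r s)

theorem ySl_induction {p : YSl → Prop} (gen : ∀ x, p (slGen x)) (alg : ∀ c, p (algebraMap ℂ YSl c))
    (add : ∀ y z, p y → p z → p (y + z)) (mul : ∀ y z, p y → p z → p (y * z)) (y : YSl) : p y := by
  obtain ⟨a, rfl⟩ := RingQuot.mkAlgHom_surjective ℂ SlRel y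
  induction a using FreeAlgebra.induction with
  | grade0 c => rw [AlgHom.commutes]; exact alg c
  | grade1 x => exact gen x
  | mul a b ha hb => rw [map_mul]; exact mul _ _ ha hb
  | add a b ha hb => rw [map_add]; exact add _ _ ha hb

theorem yGl_induction {p : YGl → Prop} (gen : ∀ i j r, p (glT i j r))
    (alg : ∀ c, p (algebraMap ℂ YGl c))
    (add : ∀ y z, p y → p z → p (y + z)) (mul : ∀ y z, p y → p z → p (y * z)) (y : YGl) : p y := by
  obtain ⟨a, rfl⟩ := RingQuot.mkAlgHom_surjective ℂ GlRel y
  induction a using FreeAlgebra.induction with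
  | grade0 c => rw [AlgHom.commutes]; exact alg c
  | grade1 x => exact gen x.1 x.2.1 (x.2.2 + 1)
  | mul a b ha hb => rw [map_mul]; exact mul _ _ ha hb
  | add a b ha hb => rw [map_add]; exact add _ _ ha hb

section Cyclic

variable {Y W : Type} [Ring Y] [Algebra ℂ Y] [AddCommGroup W] [Module ℂ W]

/-- The map from a cyclic module that is given by a vector that the left ideal annihilates. -/
def cyclicMap (ρ : Y →ₐ[ℂ] Module.End ℂ W) (v : W) (I : Submodule Y Y) (h : ∀ y ∈ I, ρ y v = 0) :
    (Y ⧸ I) →ₗ[ℂ] W where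
  __ := QuotientAddGroup.lift I.toAddSubgroup
    ((LinearMap.applyₗ v).toAddMonoidHom.comp ρ.toRingHom.toAddMonoidHom) fun y hy => h y hy
  map_smul' c y := by
    obtain ⟨y, rfl⟩ := Submodule.Quotient.mk_surjective I y
    exact LinearMap.congr_fun (map_smul ρ c y) v

variable {ρ : Y →ₐ[ℂ] Module.End ℂ W} {v : W} {I : Submodule Y Y} {h : ∀ y ∈ I, ρ y v = 0}

theorem cyclicMap_mk (y : Y) : cyclicMap ρ v I h (Submodule.Quotient.mk y) = ρ y v := rfl

theorem cyclicMap_smul (y : Y) (m : Y ⧸ I) :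
    cyclicMap ρ v I h (y • m) = ρ y (cyclicMap ρ v I h m) := by
  obtain ⟨z, rfl⟩ := Submodule.Quotient.mk_surjective I m
  rw [← Submodule.Quotient.mk_smul, cyclicMap_mk, cyclicMap_mk, smul_eq_mul, map_mul]
  rfl

theorem annihilates_of_span {S : Set Y} (hS : ∀ y ∈ S, ρ y v = 0) (y : Y)
    (hy : y ∈ Submodule.span Y S) : ρ y v = 0 := by
  induction hy using Submodule.span_induction with
  | mem y hy => exact hS y hy
  | zero => rw [map_zero, LinearMap.zero_apply]
  | add y z _ _ hy hz => rw [map_add, LinearMap.add_apply, hy, hz, add_zero]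
  | smul a y _ hy => rw [smul_eq_mul, map_mul, Module.End.mul_apply, hy, map_zero]

end Cyclic

theorem slE_smul_slHighest (μ : ℂ⟦X⟧) (r : ℕ) : slE r • slHighest μ = 0 := by
  rw [slHighest, ← Submodule.Quotient.mk_smul, smul_eq_mul, mul_one, Submodule.Quotient.mk_eq_zero]
  exact Submodule.subset_span (Or.inl ⟨r, rfl⟩)

theorem slH_smul_slHighest (μ : ℂ⟦X⟧) (r : ℕ) :
    slH r • slHighest μ = coeff (r + 1) μ • slHighest μ := by
  have h : Submodule.Quotient.mk (p := slVermaIdeal μ)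
      (slH r - algebraMap ℂ YSl (coeff (r + 1) μ)) = 0 := by
    rw [Submodule.Quotient.mk_eq_zero]
    exact Submodule.subset_span (Or.inr ⟨r, rfl⟩)
  rw [Submodule.Quotient.mk_sub, sub_eq_zero] at h
  rw [slHighest, ← Submodule.Quotient.mk_smul, smul_eq_mul, mul_one, h,
    Algebra.algebraMap_eq_smul_one, Submodule.Quotient.mk_smul]

/-- The representation of `Y(sl₂)` on `fSpan`. -/
def slRep {μ : ℂ⟦X⟧} (hμ : coeff 0 μ = 1) : YSl →ₐ[ℂ] Module.End ℂ fSpan :=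
  slLift (isDrinfeld_fSpan hμ)

theorem slRep_slE {μ : ℂ⟦X⟧} (hμ : coeff 0 μ = 1) (r : ℕ) : slRep hμ (slE r) = eEnd μ r :=
  slLift_slE _ r

theorem slRep_slH {μ : ℂ⟦X⟧} (hμ : coeff 0 μ = 1) (r : ℕ) : slRep hμ (slH r) = hEnd μ r :=
  slLift_slH _ r

theorem slRep_slF {μ : ℂ⟦X⟧} (hμ : coeff 0 μ = 1) (r : ℕ) : slRep hμ (slF r) = fEnd r :=
  slLift_slF _ r

theorem slRep_vac {μ : ℂ⟦X⟧} (hμ : coeff 0 μ = 1) : ∀ y ∈ slVermaIdeal μ, slRep hμ y vac = 0 := by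
  refine annihilates_of_span ?_
  rintro _ (⟨r, rfl⟩ | ⟨r, rfl⟩)
  · rw [slRep_slE, eEnd_vac]
  · rw [map_sub, slRep_slH, AlgHom.commutes, LinearMap.sub_apply, hEnd, cartanEnd_vac,
      Module.algebraMap_end_apply, sub_self]

/-- The map from the Verma module to `fSpan`. -/
def slVermaMap {μ : ℂ⟦X⟧} (hμ : coeff 0 μ = 1) : SlVerma μ →ₗ[ℂ] fSpan :=
  cyclicMap (slRep hμ) vac (slVermaIdeal μ) (slRep_vac hμ)

theorem slVermaMap_slHighest {μ : ℂ⟦X⟧} (hμ : coeff 0 μ = 1) :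
    slVermaMap hμ (slHighest μ) = vac := by
  rw [slHighest, slVermaMap, cyclicMap_mk, map_one, Module.End.one_apply]

theorem slVermaMap_slE {μ : ℂ⟦X⟧} (hμ : coeff 0 μ = 1) (r : ℕ) (m : SlVerma μ) :
    slVermaMap hμ (slE r • m) = eEnd μ r (slVermaMap hμ m) := by
  rw [slVermaMap, cyclicMap_smul, slRep_slE]

theorem slVermaMap_slF {μ : ℂ⟦X⟧} (hμ : coeff 0 μ = 1) (r : ℕ) (m : SlVerma μ) :
    slVermaMap hμ (slF r • m) = fEnd r (slVermaMap hμ m) := by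
  rw [slVermaMap, cyclicMap_smul, slRep_slF]

section SlAction

variable (M : Type*) [AddCommGroup M] [Module ℂ M] [Module YSl M] [IsScalarTower ℂ YSl M]

/-- The operator of an element of `Y(sl₂)` on a module. -/
abbrev slAct (y : YSl) : Module.End ℂ M := Algebra.lsmul ℂ ℂ M y

theorem isDrinfeld_slAct : IsDrinfeld (fun r => slAct M (slE r)) (fun r => slAct M (slH r))
    (fun r => slAct M (slF r)) :=
  isDrinfeld_slGen.map (Algebra.lsmul ℂ ℂ M : YSl →ₐ[ℂ] Module.End ℂ M).toRingHom

variable {M}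

/-- A subspace that is stable under the generators is a submodule. -/
def slSubmodule (P : Submodule ℂ M) (he : ∀ r, ∀ m ∈ P, slE r • m ∈ P)
    (hh : ∀ r, ∀ m ∈ P, slH r • m ∈ P) (hf : ∀ r, ∀ m ∈ P, slF r • m ∈ P) : Submodule YSl M where
  __ := P.toAddSubmonoid
  smul_mem' y := by
    have key : ∀ m ∈ P, y • m ∈ P := by
      induction y using ySl_induction with
      | gen x =>
        cases x with
        | e r => exact he r
        | h r => exact hh r
        | f r => exact hf r
      | alg c =>
        intro m hm
        rw [algebraMap_smul]
        exact P.smul_mem c hm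
      | add y z hy hz =>
        intro m hm
        rw [add_smul]
        exact add_mem (hy m hm) (hz m hm)
      | mul y z hy hz =>
        intro m hm
        rw [mul_smul]
        exact hy _ (hz m hm)
    exact fun {m} hm => key m hm

end SlAction

theorem eq_top_of_slHighest_mem {μ : ℂ⟦X⟧} {N : Submodule YSl (SlVerma μ)} (h : slHighest μ ∈ N) :
    N = ⊤ := by
  rw [eq_top_iff]
  intro m _
  obtain ⟨y, rfl⟩ := Submodule.Quotient.mk_surjective _ m
  have := N.smul_mem y h
  rwa [slHighest, ← Submodule.Quotient.mk_smul, smul_eq_mul, mul_one] at this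

/-- The f-closure of the highest vector is stable under e and h as well, so it is a submodule that
contains a generator. -/
theorem mem_fClosure_slHighest {μ : ℂ⟦X⟧} (m : SlVerma μ) :
    m ∈ fClosure (fun s => slAct (SlVerma μ) (slF s)) (ℂ ∙ slHighest μ) := by
  have D := isDrinfeld_slAct (SlVerma μ)
  have hh : ∀ n, ∀ m ∈ (ℂ ∙ slHighest μ), slH n • m ∈
      fClosure (fun s => slAct (SlVerma μ) (slF s)) (ℂ ∙ slHighest μ) := by
    intro n m hm
    obtain ⟨c, rfl⟩ := Submodule.mem_span_singleton.mp hm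
    refine le_fClosure ?_
    rw [smul_comm, slH_smul_slHighest]
    exact Submodule.smul_mem _ _ (Submodule.smul_mem _ _ (Submodule.mem_span_singleton_self _))
  have he : ∀ n, ∀ m ∈ (ℂ ∙ slHighest μ), slE n • m ∈
      fClosure (fun s => slAct (SlVerma μ) (slF s)) (ℂ ∙ slHighest μ) := by
    intro n m hm
    obtain ⟨c, rfl⟩ := Submodule.mem_span_singleton.mp hm
    rw [smul_comm, slE_smul_slHighest, smul_zero]
    exact zero_mem _
  have h1 : slSubmodule (fClosure (fun s => slAct (SlVerma μ) (slF s)) (ℂ ∙ slHighest μ))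
      (fun r m hm => D.e_mem_fClosure hh he r hm) (fun r m hm => D.h_mem_fClosure hh r hm)
      (fun r m hm => map_mem_fClosure r hm) = ⊤ :=
    eq_top_of_slHighest_mem (le_fClosure (Submodule.mem_span_singleton_self _))
  exact (h1 ▸ Submodule.mem_top : m ∈ slSubmodule _ _ _ _)

/-- The ordered words span the Verma module and their images are linearly independent. -/
theorem slVermaMap_injective {μ : ℂ⟦X⟧} (hμ : coeff 0 μ = 1) :
    Function.Injective (slVermaMap hμ) := by
  rw [← LinearMap.ker_eq_bot, LinearMap.ker_eq_bot']
  intro m hm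
  have h1 := fClosure_span_singleton_le _ (mem_fClosure_slHighest m)
  have h2 : Submodule.span ℂ (Set.range (opWord (fun s => slAct (SlVerma μ) (slF s))
      (slHighest μ))) ≤ Submodule.span ℂ (Set.range fun x : Multiset ℕ =>
        opWord (fun s => slAct (SlVerma μ) (slF s)) (slHighest μ) (x.sort (· ≥ ·))) := by
    rw [Submodule.span_le]
    rintro _ ⟨l, rfl⟩
    exact opWord_mem_span_sorted (isDrinfeld_slAct (SlVerma μ)).ff _ l
  obtain ⟨c, rfl⟩ := (Finsupp.mem_span_range_iff_exists_finsupp).mp (h2 h1)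
  have h3 : ∀ l, slVermaMap hμ (opWord (fun s => slAct (SlVerma μ) (slF s)) (slHighest μ) l) =
      ⟨fWord l, fWord_mem l⟩ := by
    intro l
    induction l with
    | nil => exact slVermaMap_slHighest hμ
    | cons s l ih =>
      have : slVermaMap hμ (slF s • opWord (fun s => slAct (SlVerma μ) (slF s)) (slHighest μ) l) =
        ⟨fWord (s :: l), fWord_mem (s :: l)⟩ := by
        rw [slVermaMap_slF, ih]
        rfl
      exact this
  have h4 : Finsupp.linearCombination ℂ sortedWord c = 0 := by
    rw [map_finsuppSum] at hm
    rw [← hm, Finsupp.linearCombination_apply]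
    refine Finsupp.sum_congr fun x _ => ?_
    rw [map_smul, h3]
    rfl
  rw [linearIndependent_iff.mp linearIndependent_sortedWord c h4, Finsupp.sum_zero_index]

/-! ### Reducibility implies rationality. -/

/-- The Laurent series is the expansion at infinity of a rational function. -/
def IsRatInf (ψ : LaurentSeries ℂ) : Prop :=
  ∃ P Q : ℂ[X], Q ≠ 0 ∧ ψ = polyAtInfinity P / polyAtInfinity Q

theorem polyAtInfinity_ne_zero {P : ℂ[X]} (h : P ≠ 0) : polyAtInfinity P ≠ 0 :=
  fun h' => h (polyAtInfinity_eq_zero h')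

theorem IsRatInf.mul {ψ ψ' : LaurentSeries ℂ} (h : IsRatInf ψ) (h' : IsRatInf ψ') :
    IsRatInf (ψ * ψ') := by
  obtain ⟨P, Q, hQ, rfl⟩ := h
  obtain ⟨P', Q', hQ', rfl⟩ := h'
  exact ⟨P * P', Q * Q', mul_ne_zero hQ hQ', by rw [map_mul, map_mul, div_mul_div_comm]⟩

theorem IsRatInf.inv {ψ : LaurentSeries ℂ} (h : IsRatInf ψ) : IsRatInf ψ⁻¹ := by
  obtain ⟨P, Q, hQ, rfl⟩ := h
  by_cases hP : P = 0
  · exact ⟨0, 1, one_ne_zero, by rw [hP, map_zero, zero_div, zero_div, inv_zero]⟩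
  · exact ⟨Q, P, hP, inv_div _ _⟩

theorem isRatInf_polyAtInfinity (P : ℂ[X]) : IsRatInf (polyAtInfinity P) :=
  ⟨P, 1, one_ne_zero, by rw [map_one, div_one]⟩

theorem isRatInf_one_add_inv (a : ℂ) : IsRatInf (1 + (uInf - lconst a)⁻¹) := by
  refine ⟨Polynomial.X - Polynomial.C a + 1, Polynomial.X - Polynomial.C a, X_sub_C_ne_zero a, ?_⟩
  rw [map_add, map_sub, polyAtInfinity_X, polyAtInfinity_C, map_one, add_div,
    div_self (uInf_sub_lconst_ne_zero a), one_div]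

theorem isRatInf_prod_one_add_inv (A : Finset ℂ) :
    IsRatInf (∏ a ∈ A, (1 + (uInf - lconst a)⁻¹)) := by
  induction A using Finset.induction_on with
  | empty => exact ⟨1, 1, one_ne_zero, by simp⟩
  | insert a A ha ih =>
    rw [Finset.prod_insert ha]
    exact (isRatInf_one_add_inv a).mul ih

/-- The vanishing for all r says that kernel times expansion has no negative powers of u, hence is a
polynomial; μ is recovered by dividing by rational functions. -/
theorem isRationalSeries_of_eOp_eq_zero {μ : ℂ⟦X⟧} {F : FinFun} (hF : IsRat F) {A : Finset ℂ}
    (h0 : hat F A ≠ 0) (h : ∀ r, eOp μ r F A = 0) : IsRationalSeries μ := by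
  obtain ⟨P, hP⟩ := exists_polyAtInfinity_eq (ψ := eKernel μ A * hat F A) fun n => by
    have := h n
    rw [eOp_apply, mul_assoc, coeff_uInf_pow_mul] at this
    rwa [add_comm]
  have h1 : (∏ a ∈ A, (1 + (uInf - lconst a)⁻¹)) ≠ 0 :=
    Finset.prod_ne_zero_iff.mpr fun a _ => one_add_inv_ne_zero a
  have h2 : (μ : LaurentSeries ℂ) =
      polyAtInfinity P * (∏ a ∈ A, (1 + (uInf - lconst a)⁻¹)) * (hat F A)⁻¹ := by
    rw [hP, eKernel, Finset.prod_inv_distrib]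
    have h3 : ∀ a p x : LaurentSeries ℂ, p ≠ 0 → x ≠ 0 → a = a * p⁻¹ * x * p * x⁻¹ := by
      intro a p x hp hx
      field_simp
    exact h3 _ _ _ h1 h0
  have h3 : IsRatInf (hat F A) := (hF.ratExt A).exists_div
  have h4 : IsRatInf (μ : LaurentSeries ℂ) := by
    rw [h2]
    exact ((isRatInf_polyAtInfinity P).mul (isRatInf_prod_one_add_inv A)).mul h3.inv
  exact h4

/-- The function vanishes on the sets of more than `m` points. -/
def VanishesAbove (m : ℕ) (F : FinFun) : Prop := ∀ A : Finset ℂ, m < A.card → F A = 0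

theorem exists_vanishesAbove (v : fSpan) : ∃ m, VanishesAbove m v := by
  refine fSpan_induction (p := fun v => ∃ m, VanishesAbove m v) ⟨0, fun A hA => ?_⟩ ?_ ?_ ?_ v
  · exact if_neg (fun h => by rw [h] at hA; exact absurd hA (lt_irrefl 0))
  · rintro s v ⟨m, hm⟩
    refine ⟨m + 1, fun A hA => ?_⟩
    rw [coe_fEnd, fOp_apply]
    refine Finset.sum_eq_zero fun a ha => ?_
    rw [hm, mul_zero]
    rw [Finset.card_erase_of_mem ha]
    omega
  · rintro v w ⟨m, hm⟩ ⟨n, hn⟩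
    refine ⟨max m n, fun A hA => ?_⟩
    rw [Submodule.coe_add, Pi.add_apply, hm A (lt_of_le_of_lt (le_max_left _ _) hA),
      hn A (lt_of_le_of_lt (le_max_right _ _) hA), add_zero]
  · rintro c v ⟨m, hm⟩
    refine ⟨m, fun A hA => ?_⟩
    rw [Submodule.coe_smul, Pi.smul_apply, hm A hA, smul_zero]

theorem VanishesAbove.hat_eq_zero {m : ℕ} {F : FinFun} (h : VanishesAbove m F) {A : Finset ℂ}
    (hA : m ≤ A.card) : hat F A = 0 := by
  have : RatExt A (fun b => F (insert b A)) (lconst 0) := (RatExt.const A 0).congr fun b hb =>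
    h _ (by rw [Finset.card_insert_of_notMem hb]; omega)
  rw [hat_eq this, lconst, map_zero]

theorem eq_smul_vac_of_hat {v : fSpan} (h : ∀ A, hat v A = 0) : v = (v : FinFun) ∅ • vac := by
  refine Subtype.ext (funext fun A => ?_)
  rw [Submodule.coe_smul, Pi.smul_apply, smul_eq_mul]
  rcases A.eq_empty_or_nonempty with rfl | ⟨a, ha⟩
  · exact (mul_one _).symm
  · have h1 := (isRat_of_mem v.2).ratExt (A.erase a)
    rw [h] at h1
    have h2 := h1.eq_zero_of_zero (Finset.notMem_erase a A)
    rw [Finset.insert_erase ha] at h2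
    have h3 : vacFun A = 0 := if_neg (Finset.ne_empty_of_mem ha)
    rw [h2]
    exact (mul_eq_zero_of_right _ h3).symm

/-- A nonzero vector of N is chosen whose function vanishes on sets of more than m points, with m
minimal. If some expansion of it is nonzero, minimality forces all e^{(r)} to annihilate it and μ is
rational; if all expansions vanish, it is a multiple of the highest vector and N is everything. -/
theorem isRationalSeries_of_isReducible {μ : ℂ⟦X⟧} (hμ : coeff 0 μ = 1)
    (h : IsReducible YSl (SlVerma μ)) : IsRationalSeries μ := by
  classical
  by_contra hrat
  obtain ⟨N, hN0, hN1⟩ := h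
  have hex : ∃ m, ∃ x ∈ N, x ≠ 0 ∧ VanishesAbove m (slVermaMap hμ x) := by
    obtain ⟨x, hx, hx0⟩ := N.exists_mem_ne_zero_of_ne_bot hN0
    obtain ⟨m, hm⟩ := exists_vanishesAbove (slVermaMap hμ x)
    exact ⟨m, x, hx, hx0, hm⟩
  obtain ⟨x, hx, hx0, hm⟩ := Nat.find_spec hex
  have hmin := fun k hk => Nat.find_min hex (m := k) hk
  generalize Nat.find hex = m at hm hmin
  have hhat : ∀ A, hat (slVermaMap hμ x) A = 0 := by
    intro A
    by_contra hA
    have hcard : A.card < m := by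
      by_contra hc
      exact hA (hm.hat_eq_zero (not_lt.mp hc))
    refine hrat (isRationalSeries_of_eOp_eq_zero (isRat_of_mem (slVermaMap hμ x).2) hA fun r => ?_)
    have he : slE r • x = 0 := by
      by_contra he
      -- On sets of at least m points the expansion in one more point vanishes, so e^{(r)} x has
      -- support bound m - 1. The nonzero expansion at A gives m > 0, so this is a strict decrease.
      refine hmin (m - 1) (by omega) ⟨_, N.smul_mem _ hx, he, fun B hB => ?_⟩
      rw [slVermaMap_slE, coe_eEnd, eOp_apply, hm.hat_eq_zero (by omega), mul_zero]
      rfl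
    have h1 := slVermaMap_slE hμ r x
    rw [he, map_zero] at h1
    exact (congrFun (congrArg Subtype.val h1) A).symm
  have h1 := eq_smul_vac_of_hat hhat
  set c := ((slVermaMap hμ x : fSpan) : FinFun) ∅
  have hc : c ≠ 0 := by
    intro h
    rw [h, zero_smul] at h1
    exact hx0 (slVermaMap_injective hμ (h1.trans (map_zero _).symm))
  have h2 : c⁻¹ • x = slHighest μ := by
    apply slVermaMap_injective hμ
    rw [map_smul, h1, slVermaMap_slHighest, smul_smul, inv_mul_cancel₀ hc, one_smul]
  refine hN1 (eq_top_of_slHighest_mem ?_)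
  rw [← h2]
  exact N.smul_of_tower_mem c⁻¹ hx

/-! ### Vectors annihilated by the raising operators, and the submodule they generate. -/

section SingularVectors

variable {M : Type*} [AddCommGroup M] [Module ℂ M]

/-- The vectors `∑ qⱼ f^{(j)} v`. -/
def fVec (f : ℕ → Module.End ℂ M) (v : M) : ℂ[X] →ₗ[ℂ] M :=
  Polynomial.lsum fun j => LinearMap.toSpanSingleton ℂ _ (f j v)

/-- The vectors `∑ qⱼ f^{(j)} v` for the polynomials in an ideal. -/
def fVecIdeal (f : ℕ → Module.End ℂ M) (v : M) (I : Ideal ℂ[X]) : Submodule ℂ M :=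
  (I.restrictScalars ℂ).map (fVec f v)

variable {f : ℕ → Module.End ℂ M} {v : M}

theorem fVec_monomial (j : ℕ) (q : ℂ) : fVec f v (Polynomial.monomial j q) = q • f j v := by
  rw [fVec, Polynomial.lsum_apply, Polynomial.sum_monomial_index (hf := LinearMap.map_zero _)]
  rfl

theorem fVec_eq_sum {Q : ℂ[X]} (hQ : Q.Monic) {s : ℕ} (hs : Q.natDegree = s) :
    fVec f v Q = ∑ k : Fin s, Q.coeff k • f k v + f s v := by
  have hsum : fVec f v Q = Q.sum fun j q => q • f j v := rfl
  rw [hsum, Polynomial.sum_over_range _ (fun j => zero_smul ℂ (f j v)), hs,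
    Finset.sum_range_succ, Finset.sum_range, ← hs, hQ.coeff_natDegree, one_smul]

theorem fVec_mem {I : Ideal ℂ[X]} {Q : ℂ[X]} (hQ : Q ∈ I) : fVec f v Q ∈ fVecIdeal f v I :=
  ⟨Q, hQ, rfl⟩

/-- On ∑ qⱼ f^{(j)} v the operator g 0 is a scalar, and the recursion in n brings in only scalars, g
n, and multiplication of the polynomial by X, under which an ideal is stable. -/
theorem map_fVecIdeal_of_shift {g : ℕ → Module.End ℂ M} {α β γ : ℂ}
    (h0 : ∀ s m, g 0 (f s m) = f s (g 0 m) + γ • f s m)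
    (h : ∀ n s m, g (n + 1) (f s m) = f s (g (n + 1) m) + (g n (f (s + 1) m) - f (s + 1) (g n m)) +
      α • f s (g n m) + β • g n (f s m))
    {c : ℕ → ℂ} (hv : ∀ n, g n v = c n • v) {I : Ideal ℂ[X]} (n : ℕ) {m : M}
    (hm : m ∈ fVecIdeal f v I) : g n m ∈ fVecIdeal f v I := by
  have h1 : ∀ Q, g 0 (fVec f v Q) = (c 0 + γ) • fVec f v Q := by
    intro Q
    induction Q using Polynomial.induction_on' with
    | add P Q hP hQ => rw [map_add, map_add, hP, hQ, smul_add]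
    | monomial j q =>
      rw [fVec_monomial, map_smul, h0, hv, map_smul]
      module
  have h2 : ∀ n Q, g (n + 1) (fVec f v Q) = (c (n + 1) + α * c n) • fVec f v Q +
      g n (fVec f v (Polynomial.X * Q)) - c n • fVec f v (Polynomial.X * Q) +
        β • g n (fVec f v Q) := by
    intro n Q
    induction Q using Polynomial.induction_on' with
    | add P Q hP hQ =>
      rw [mul_add, map_add, map_add, map_add, hP, hQ, map_add, map_add]
      module
    | monomial j q =>
      rw [Polynomial.X_mul_monomial, fVec_monomial, fVec_monomial, map_smul, map_smul, map_smul, h,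
        hv, hv, map_smul, map_smul, map_smul]
      module
  obtain ⟨Q, hQ, rfl⟩ := hm
  induction n generalizing Q with
  | zero =>
    rw [h1]
    exact Submodule.smul_mem _ _ (fVec_mem hQ)
  | succ n ih =>
    have hX : Polynomial.X * Q ∈ I := I.mul_mem_left _ hQ
    rw [h2]
    exact add_mem (sub_mem (add_mem (Submodule.smul_mem _ _ (fVec_mem hQ)) (ih _ hX))
      (Submodule.smul_mem _ _ (fVec_mem hX))) (Submodule.smul_mem _ _ (ih _ hQ))

variable {e h : ℕ → Module.End ℂ M} {μ : ℂ⟦X⟧}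

/-- Since e r kills v, each f^{(j)} v goes to h (r + j) v, that is, to a coefficient of μ.
Multiplication by u^j shifts the coefficients accordingly. -/
theorem IsDrinfeld.e_fVec (D : IsDrinfeld e h f) (hev : ∀ r, e r v = 0)
    (hhv : ∀ r, h r v = coeff (r + 1) μ • v) (r : ℕ) (Q : ℂ[X]) : e r (fVec f v Q) =
    ((μ : LaurentSeries ℂ) * polyAtInfinity Q).coeff ((r : ℤ) + 1) • v := by
  induction Q using Polynomial.induction_on' with
  | add P Q hP hQ => rw [map_add, map_add, hP, hQ, map_add, mul_add, HahnSeries.coeff_add, add_smul]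
  | monomial j q =>
    have h2 : e r (f j v) - f j (e r v) = h (r + j) v := LinearMap.congr_fun (D.ef r j) v
    rw [hev, map_zero, sub_zero, hhv] at h2
    rw [fVec_monomial, map_smul, h2, smul_smul, polyAtInfinity_monomial,
      mul_comm (μ : LaurentSeries ℂ), HahnSeries.coeff_single_mul, ← coeff_natCast_coe]
    congr 3
    push_cast
    ring

theorem IsDrinfeld.e_fVec_eq_zero (D : IsDrinfeld e h f) (hev : ∀ r, e r v = 0)
    (hhv : ∀ r, h r v = coeff (r + 1) μ • v) {P Q R : ℂ[X]} (hPQ : IsExpansionAtInfinity μ P Q)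
    (hR : Q ∣ R) (r : ℕ) : e r (fVec f v R) = 0 := by
  obtain ⟨S, rfl⟩ := hR
  rw [D.e_fVec hev hhv, hPQ.2, map_mul, ← mul_assoc, div_mul_cancel₀ _
    (polyAtInfinity_ne_zero hPQ.1), ← map_mul, coeff_polyAtInfinity_pos, zero_smul]

theorem IsDrinfeld.h_mem_fClosure_fVecIdeal (D : IsDrinfeld e h f)
    (hhv : ∀ r, h r v = coeff (r + 1) μ • v) {I : Ideal ℂ[X]} (n : ℕ) {m : M}
    (hm : m ∈ fClosure f (fVecIdeal f v I)) : h n m ∈ fClosure f (fVecIdeal f v I) :=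
  D.h_mem_fClosure (fun n _ hm => le_fClosure
    (map_fVecIdeal_of_shift D.h_shift_zero D.h_shift_succ hhv n hm)) n hm

theorem IsDrinfeld.e_mem_fClosure_fVecIdeal (D : IsDrinfeld e h f) (hev : ∀ r, e r v = 0)
    (hhv : ∀ r, h r v = coeff (r + 1) μ • v) {P Q : ℂ[X]} (hPQ : IsExpansionAtInfinity μ P Q)
    (n : ℕ) {m : M} (hm : m ∈ fClosure f (fVecIdeal f v (Ideal.span {Q}))) :
    e n m ∈ fClosure f (fVecIdeal f v (Ideal.span {Q})) := by
  refine D.e_mem_fClosure (fun n _ hm => le_fClosure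
    (map_fVecIdeal_of_shift D.h_shift_zero D.h_shift_succ hhv n hm)) ?_ n hm
  rintro n _ ⟨R, hR, rfl⟩
  rw [D.e_fVec_eq_zero hev hhv hPQ (Ideal.mem_span_singleton.mp hR)]
  exact zero_mem _

/-- A functional that vanishes on all images of the f's detects properness; the value at ∅ in the
model is such a functional. -/
theorem fClosure_fVecIdeal_le_ker {ε : M →ₗ[ℂ] ℂ} (hε : ∀ s m, ε (f s m) = 0) (I : Ideal ℂ[X]) :
    fClosure f (fVecIdeal f v I) ≤ LinearMap.ker ε := by
  refine fClosure_le ?_ fun s m _ => hε s m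
  rintro _ ⟨R, -, rfl⟩
  rw [LinearMap.mem_ker]
  induction R using Polynomial.induction_on' with
  | add P Q hP hQ => rw [map_add, map_add, hP, hQ, add_zero]
  | monomial j q => rw [fVec_monomial, map_smul, hε, smul_zero]

theorem fVec_ne_zero (L : M →ₗ[ℂ] fSpan) (hL : ∀ s m, L (f s m) = fEnd s (L m)) (hv : L v = vac)
    {Q : ℂ[X]} (hQ : Q ≠ 0) : fVec f v Q ≠ 0 := by
  -- On one-point sets the vector is the polynomial itself.
  have key : ∀ (Q : ℂ[X]) a, ((L (fVec f v Q) : fSpan) : FinFun) {a} = Q.eval a := by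
    intro Q a
    induction Q using Polynomial.induction_on' with
    | add P Q hP hQ =>
      rw [map_add, map_add, Submodule.coe_add, Pi.add_apply, hP, hQ, Polynomial.eval_add]
    | monomial j q =>
      rw [fVec_monomial, map_smul, hL, hv, Submodule.coe_smul, Pi.smul_apply, coe_fEnd, fOp_apply,
        Finset.sum_singleton, Finset.erase_singleton, fWeight, Finset.prod_empty, mul_one,
        Polynomial.eval_monomial, smul_eq_mul]
      exact congrArg _ (mul_one _)
  intro h
  refine hQ (Polynomial.funext fun a => ?_)
  rw [← key, h, map_zero, Polynomial.eval_zero]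
  rfl

/-- The value at the empty set. -/
def vacCoeff : fSpan →ₗ[ℂ] ℂ := (LinearMap.proj (∅ : Finset ℂ)).comp fSpan.subtype

theorem vacCoeff_fEnd (s : ℕ) (v : fSpan) : vacCoeff (fEnd s v) = 0 := rfl

theorem vacCoeff_vac : vacCoeff vac = 1 := by
  have : vacCoeff vac = if (∅ : Finset ℂ) = ∅ then 1 else 0 := rfl
  rw [this, if_pos rfl]

theorem ne_zero_of_map_vac (L : M →ₗ[ℂ] fSpan) (hL : ∀ s m, L (f s m) = fEnd s (L m))
    (hv : L v = vac) (I : Ideal ℂ[X]) : v ∉ fClosure f (fVecIdeal f v I) := by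
  intro h
  have h1 := fClosure_fVecIdeal_le_ker (ε := vacCoeff.comp L)
    (fun s m => by rw [LinearMap.comp_apply, hL, vacCoeff_fEnd]) I h
  rw [LinearMap.mem_ker, LinearMap.comp_apply, hv, vacCoeff_vac] at h1
  exact one_ne_zero h1

end SingularVectors

theorem isReducible_slVerma {μ : ℂ⟦X⟧} (hμ : coeff 0 μ = 1) (h : IsRationalSeries μ) :
    IsReducible YSl (SlVerma μ) := by
  obtain ⟨P, Q, h⟩ := h
  have D := isDrinfeld_slAct (SlVerma μ)
  have hQ : fVec (fun s => slAct (SlVerma μ) (slF s)) (slHighest μ) Q ∈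
      fClosure (fun s => slAct (SlVerma μ) (slF s)) (fVecIdeal _ _ (Ideal.span {Q})) :=
    le_fClosure (fVec_mem (Ideal.mem_span_singleton_self Q))
  refine ⟨slSubmodule _
    (fun r m hm => D.e_mem_fClosure_fVecIdeal (slE_smul_slHighest μ) (slH_smul_slHighest μ) h r hm)
    (fun r m hm => D.h_mem_fClosure_fVecIdeal (slH_smul_slHighest μ) r hm)
    (fun r m hm => map_mem_fClosure r hm), fun h0 => ?_, fun h1 => ?_⟩
  · exact fVec_ne_zero (slVermaMap hμ) (slVermaMap_slF hμ) (slVermaMap_slHighest hμ) h.1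
      ((Submodule.mem_bot YSl).mp (h0.le hQ))
  · exact ne_zero_of_map_vac (slVermaMap hμ) (slVermaMap_slF hμ) (slVermaMap_slHighest hμ)
      (Ideal.span {Q}) (h1.ge (Submodule.mem_top (x := slHighest μ)))

theorem exists_singular_vector {μ : ℂ⟦X⟧} {P Q : ℂ[X]} {p : ℕ} (hμ : coeff 0 μ = 1) (hQ : Q.Monic)
    (hp : Q.natDegree = p) (h : IsExpansionAtInfinity μ P Q) (s : ℕ) (hs : p ≤ s) :
    ∃ c : Fin s → ℂ, ∃ ζ : SlVerma μ,
      ζ = ∑ k : Fin s, c k • slF k • slHighest μ + slF s • slHighest μ ∧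
        ζ ≠ 0 ∧ ∀ r : ℕ, slE r • ζ = 0 := by
  -- For s ≥ p the polynomial u^{s-p} Q(u) is the required monic multiple of Q of degree s; its
  -- lower coefficients are the constants.
  have hRm : (Polynomial.X ^ (s - p) * Q).Monic := (monic_X_pow _).mul hQ
  have hRd : (Polynomial.X ^ (s - p) * Q).natDegree = s := by
    rw [(monic_X_pow _).natDegree_mul hQ, natDegree_X_pow, hp, Nat.sub_add_cancel hs]
  exact ⟨fun k => (Polynomial.X ^ (s - p) * Q).coeff k,
    fVec (fun s => slAct (SlVerma μ) (slF s)) (slHighest μ) (Polynomial.X ^ (s - p) * Q),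
    fVec_eq_sum hRm hRd,
    fVec_ne_zero (slVermaMap hμ) (slVermaMap_slF hμ) (slVermaMap_slHighest hμ) hRm.ne_zero,
    (isDrinfeld_slAct (SlVerma μ)).e_fVec_eq_zero (slE_smul_slHighest μ) (slH_smul_slHighest μ) h
      (Dvd.intro_left _ rfl)⟩

theorem hasLead_polyAtInfinity {Q : ℂ[X]} {d : ℕ} (hd : Q.natDegree = d) :
    HasLead d (polyAtInfinity Q) (Q.coeff d) := by
  have h1 : polyAtInfinity Q = ∑ j ∈ Finset.range (d + 1), lconst (Q.coeff j) * uInf ^ j := by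
    conv_lhs => rw [Polynomial.as_sum_range_C_mul_X_pow Q, hd]
    simp only [map_sum, map_mul, map_pow, polyAtInfinity_C, polyAtInfinity_X]
  have h2 : Q.coeff d = ∑ j ∈ Finset.range (d + 1), Q.coeff j * if j = d then 1 else 0 := by
    simp
  rw [h1, h2]
  refine HasLead.sum _ fun j hj => ?_
  have h3 : HasLead d (uInf ^ j) (if j = d then 1 else 0) := by
    split_ifs with h
    · rw [h]
      exact HasLead.pow d
    · exact HasLead.pow_of_lt (lt_of_le_of_ne (Nat.lt_succ_iff.mp (Finset.mem_range.mp hj)) h)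
  simpa using (HasLead.const (Q.coeff j)).mul h3

theorem coeff_zero_of_isExpansionAtInfinity {μ : ℂ⟦X⟧} {P Q : ℂ[X]} {p : ℕ} (hP : P.Monic)
    (hQ : Q.Monic) (hPd : P.natDegree = p) (hQd : Q.natDegree = p)
    (h : IsExpansionAtInfinity μ P Q) : coeff 0 μ = 1 := by
  have h1 := h.2
  rw [eq_div_iff (polyAtInfinity_ne_zero h.1)] at h1
  have h2 : HasLead 0 (μ : LaurentSeries ℂ) (coeff 0 μ) :=
    ⟨μ, by rw [pow_zero, one_mul], rfl⟩
  have h3 := h2.mul (hasLead_polyAtInfinity hQd)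
  rw [h1, zero_add] at h3
  have h4 := h3.coeff_eq
  rw [(hasLead_polyAtInfinity hPd).coeff_eq] at h4
  rw [← hPd, hP.coeff_natDegree, hPd, ← hQd, hQ.coeff_natDegree, mul_one] at h4
  exact h4.symm

/-! ### Action of series of operators on vectors and subspaces. -/

section SeriesAction

variable {Y M : Type*} [Ring Y] [AddCommGroup M] [Module ℂ M] [Module Y M]

/-- The coefficients of the series `a` act on `w` by the coefficients of `α`. -/
def ActsBy (a : Y⟦X⟧) (w : M) (α : ℂ⟦X⟧) : Prop := ∀ n, coeff n a • w = coeff n α • w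

variable {a b : Y⟦X⟧} {w : M} {α β : ℂ⟦X⟧}

theorem ActsBy.mul [Algebra ℂ Y] [IsScalarTower ℂ Y M] (ha : ActsBy a w α) (hb : ActsBy b w β) : ActsBy (a * b) w (α * β) := by
  intro n
  rw [PowerSeries.coeff_mul, PowerSeries.coeff_mul, Finset.sum_smul, Finset.sum_smul]
  refine Finset.sum_congr rfl fun p _ => ?_
  rw [mul_smul, hb, smul_algebra_smul_comm, ha, smul_smul, mul_comm]

theorem ActsBy.mul_zero (a : Y⟦X⟧) (hb : ActsBy b w 0) : ActsBy (a * b) w 0 := by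
  intro n
  rw [PowerSeries.coeff_mul, Finset.sum_smul, map_zero, zero_smul]
  refine Finset.sum_eq_zero fun p _ => ?_
  rw [mul_smul, hb, map_zero, zero_smul, smul_zero]

theorem ActsBy.add (ha : ActsBy a w α) (hb : ActsBy b w β) : ActsBy (a + b) w (α + β) := by
  intro n
  rw [map_add, map_add, add_smul, add_smul, ha, hb]

theorem ActsBy.sub (ha : ActsBy a w α) (hb : ActsBy b w β) : ActsBy (a - b) w (α - β) := by
  intro n
  rw [map_sub, map_sub, sub_smul, sub_smul, ha, hb]

/-- The constant term of β is 1, so the action of the coefficients of a is found recursively. This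
yields the action of h(u) from that of h(u) t₂₂(u), with no separate computation for the inverse
series. -/
theorem ActsBy.of_mul [Algebra ℂ Y] [IsScalarTower ℂ Y M]
    (hab : ActsBy (a * b) w (α * β)) (hb : ActsBy b w β)
    (hβ : coeff 0 β = 1) : ActsBy a w α := by
  intro n
  induction n using Nat.strong_induction_on with
  | _ n ih =>
  have h1 := hab n
  rw [coeff_mul_range, coeff_mul_range, add_smul, add_smul, Finset.sum_smul, Finset.sum_smul] at h1
  have h2 : ∀ i ∈ Finset.range n, (coeff i a * coeff (n - i) b) • w =
      (coeff i α * coeff (n - i) β) • w := fun i hi => by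
    rw [mul_smul, hb, smul_algebra_smul_comm, ih i (Finset.mem_range.mp hi), smul_smul, mul_comm]
  rw [Finset.sum_congr rfl h2, add_right_inj, hβ, mul_one, mul_smul, hb, hβ, one_smul] at h1
  exact h1

/-- The coefficients of the series preserve the subspace. -/
def Preserves (a : Y⟦X⟧) (P : Submodule ℂ M) : Prop := ∀ n, ∀ m ∈ P, coeff n a • m ∈ P

variable {P : Submodule ℂ M}

theorem Preserves.mul (ha : Preserves a P) (hb : Preserves b P) : Preserves (a * b) P := by
  intro n m hm
  rw [PowerSeries.coeff_mul, Finset.sum_smul]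
  refine Submodule.sum_mem _ fun p _ => ?_
  rw [mul_smul]
  exact ha _ _ (hb _ _ hm)

theorem Preserves.add (ha : Preserves a P) (hb : Preserves b P) : Preserves (a + b) P := by
  intro n m hm
  rw [map_add, add_smul]
  exact add_mem (ha n m hm) (hb n m hm)

end SeriesAction

/-! ### The representation of `Y(gl₂)` on `fSpan` -/

/-- The series of the operators `f^{(s)}` on `fSpan`. -/
def fSeries : (Module.End ℂ fSpan)⟦X⟧ := PowerSeries.X * PowerSeries.mk fEnd

/-- The series of the operators `e^{(r)}` on `fSpan`. -/
def eSeries (μ : ℂ⟦X⟧) : (Module.End ℂ fSpan)⟦X⟧ := PowerSeries.X * PowerSeries.mk (eEnd μ)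

theorem coeff_zero_X_mul_mk {A : Type*} [Ring A] (g : ℕ → A) :
    coeff 0 (PowerSeries.X * PowerSeries.mk g) = 0 := by
  simp

theorem coeff_succ_X_mul_mk {A : Type*} [Ring A] (g : ℕ → A) (n : ℕ) :
    coeff (n + 1) (PowerSeries.X * PowerSeries.mk g) = g n := by
  rw [PowerSeries.coeff_succ_X_mul, coeff_mk]

/-- The series of the operators `t_{ij}^{(r)}` on `fSpan`. -/
def glEntry (μ l : ℂ⟦X⟧) : Fin 2 → Fin 2 → (Module.End ℂ fSpan)⟦X⟧ :=
  gaussEntry (PowerSeries.mk (cartanEnd l 1 0)) (PowerSeries.mk (cartanEnd μ (-1) 1)) (eSeries μ)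
    fSeries

/-- The parameters (1, 0) make k act by l(u) ∏ (u - a + 1)/(u - a), and the general Cartan relations
specialize to those of t₂₂ with e and f. Both k and h are multiplication operators and commute. -/
theorem isRTT_glEntry {μ l : ℂ⟦X⟧} (hμ : coeff 0 μ = 1) (hl : coeff 0 l = 1) :
    IsRTT fun i j r => coeff r (glEntry μ l i j) := by
  have hke : ∀ n s, ⁅cartanEnd l 1 0 (n + 1), eEnd μ s⁆ - ⁅cartanEnd l 1 0 n, eEnd μ (s + 1)⁆ =
      -(cartanEnd l 1 0 n * eEnd μ s) := fun n s => by
    rw [lie_cartanEnd_eEnd]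
    module
  have hkf : ∀ n s, ⁅cartanEnd l 1 0 (n + 1), fEnd s⁆ - ⁅cartanEnd l 1 0 n, fEnd (s + 1)⁆ =
      fEnd s * cartanEnd l 1 0 n := fun n s => by
    rw [lie_cartanEnd_fEnd]
    module
  refine isRTT_gaussEntry ?_ ?_ (coeff_zero_X_mul_mk _) (coeff_zero_X_mul_mk _) ?_ ?_ ?_ ?_ ?_
  · rw [coeff_mk, cartanEnd_zero, hl, one_smul]
  · rw [coeff_mk, cartanEnd_zero, hμ, one_smul]
  · intro r s
    rw [coeff_mk, coeff_mk, cartanEnd_comm]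
  · intro r s
    rw [coeff_mk, coeff_mk, cartanEnd_comm]
  · intro n s
    rw [coeff_mk, coeff_mk, eSeries, coeff_succ_X_mul_mk, coeff_succ_X_mul_mk, hke]
  · intro n s
    rw [coeff_mk, coeff_mk, fSeries, coeff_succ_X_mul_mk, coeff_succ_X_mul_mk, hkf]
  · simp only [eSeries, fSeries, coeff_succ_X_mul_mk, coeff_mk]
    exact isDrinfeld_fSpan hμ

/-- The representation of `Y(gl₂)` on `fSpan`. -/
def glRep {μ l : ℂ⟦X⟧} (hμ : coeff 0 μ = 1) (hl : coeff 0 l = 1) : YGl →ₐ[ℂ] Module.End ℂ fSpan :=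
  glLift (isRTT_glEntry hμ hl)

theorem glRep_glT {μ l : ℂ⟦X⟧} (hμ : coeff 0 μ = 1) (hl : coeff 0 l = 1) (i j : Fin 2) (r : ℕ) :
    glRep hμ hl (glT i j r) = coeff r (glEntry μ l i j) :=
  glLift_glT (isRTT_glEntry hμ hl) i j r

theorem glRep_coeff_glSeriesF {μ l : ℂ⟦X⟧} (hμ : coeff 0 μ = 1) (hl : coeff 0 l = 1) (s : ℕ) :
    glRep hμ hl (coeff (s + 1) glSeriesF) = fEnd s := by
  set φ := PowerSeries.map (glRep hμ hl : YGl →+* Module.End ℂ fSpan) with hφ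
  have h1 : ∀ i j, φ (glSeries i j) = glEntry μ l i j := by
    intro i j
    ext1 n
    rw [hφ, PowerSeries.coeff_map, glSeries, coeff_mk]
    exact glRep_glT hμ hl i j n
  have h2 : φ glSeriesF = fSeries := by
    rw [glSeriesF, map_mul, h1]
    have h3 : glEntry μ l 1 0 = fSeries * φ (glSeries 1 1) := by
      rw [h1]
      rfl
    rw [h3, mul_assoc, ← map_mul, glSeries_mul_inv, map_one, mul_one]
  have h4 := congrArg (PowerSeries.coeff (s + 1)) h2
  rw [hφ, PowerSeries.coeff_map] at h4
  exact h4.trans (coeff_succ_X_mul_mk fEnd s)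

theorem actsBy_cartanEnd_vac (c : ℂ⟦X⟧) (α β : ℂ) :
    ActsBy (PowerSeries.mk (cartanEnd c α β)) vac c := by
  intro n
  rw [coeff_mk]
  exact cartanEnd_vac c α β n

theorem actsBy_eSeries_vac (μ : ℂ⟦X⟧) : ActsBy (eSeries μ) vac 0 := by
  intro n
  rw [eSeries, map_zero, zero_smul]
  cases n with
  | zero => rw [coeff_zero_X_mul_mk, zero_smul]
  | succ n =>
    rw [coeff_succ_X_mul_mk]
    exact eEnd_vac μ n

theorem glRep_vac {μ l₁ l₂ : ℂ⟦X⟧} (hμ : coeff 0 μ = 1) (hl : coeff 0 l₂ = 1) (h : μ * l₂ = l₁) :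
    ∀ y ∈ glVermaIdeal l₁ l₂, glRep hμ hl y vac = 0 := by
  have h12 : ActsBy (glEntry μ l₂ 0 1) vac 0 := (actsBy_eSeries_vac μ).mul_zero _
  have h22 : ActsBy (glEntry μ l₂ 1 1) vac l₂ := actsBy_cartanEnd_vac l₂ 1 0
  have h11 : ActsBy (glEntry μ l₂ 0 0) vac l₁ := by
    have := ((actsBy_cartanEnd_vac μ (-1) 1).mul (actsBy_cartanEnd_vac l₂ 1 0)).add
      ((actsBy_eSeries_vac μ).mul_zero (fSeries * PowerSeries.mk (cartanEnd l₂ 1 0)))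
    rwa [h, add_zero] at this
  refine annihilates_of_span ?_
  rintro _ ((⟨r, rfl⟩ | ⟨r, rfl⟩) | ⟨r, rfl⟩)
  · have := h12 (r + 1)
    rw [map_zero, zero_smul] at this
    rw [glRep_glT]
    exact this
  · rw [map_sub, glRep_glT, AlgHom.commutes, LinearMap.sub_apply, Module.algebraMap_end_apply,
      sub_eq_zero]
    exact h11 (r + 1)
  · rw [map_sub, glRep_glT, AlgHom.commutes, LinearMap.sub_apply, Module.algebraMap_end_apply,
      sub_eq_zero]
    exact h22 (r + 1)

/-- The map from the Verma module over `Y(gl₂)` to `fSpan`. -/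
def glVermaMap {μ l₁ l₂ : ℂ⟦X⟧} (hμ : coeff 0 μ = 1) (hl : coeff 0 l₂ = 1) (h : μ * l₂ = l₁) :
    GlVerma l₁ l₂ →ₗ[ℂ] fSpan :=
  cyclicMap (glRep hμ hl) vac (glVermaIdeal l₁ l₂) (glRep_vac hμ hl h)

section

variable {μ l₁ l₂ : ℂ⟦X⟧} (hμ : coeff 0 μ = 1) (hl : coeff 0 l₂ = 1) (h : μ * l₂ = l₁)

theorem glVermaMap_glHighest : glVermaMap hμ hl h (glHighest l₁ l₂) = vac := by
  rw [glHighest, glVermaMap, cyclicMap_mk, map_one, Module.End.one_apply]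

theorem glVermaMap_glSeriesF (s : ℕ) (m : GlVerma l₁ l₂) :
    glVermaMap hμ hl h (coeff (s + 1) glSeriesF • m) = fEnd s (glVermaMap hμ hl h m) := by
  rw [glVermaMap, cyclicMap_smul, glRep_coeff_glSeriesF]

end

/-! ### The Verma modules over `Y(gl₂)` -/

theorem actsBy_glSeries_diag {l₁ l₂ l : ℂ⟦X⟧} (hl : coeff 0 l = 1) {i : Fin 2}
    (h : ∀ r, glT i i (r + 1) - algebraMap ℂ YGl (coeff (r + 1) l) ∈ glVermaIdeal l₁ l₂) :
    ActsBy (glSeries i i) (glHighest l₁ l₂) l := by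
  intro n
  rw [glSeries, coeff_mk]
  cases n with
  | zero => rw [isRTT_glT.zero, if_pos rfl, hl, one_smul, one_smul]
  | succ r =>
    have h1 := (Submodule.Quotient.mk_eq_zero (glVermaIdeal l₁ l₂)).mpr (h r)
    rw [Submodule.Quotient.mk_sub, sub_eq_zero] at h1
    rw [glHighest, ← Submodule.Quotient.mk_smul, smul_eq_mul, mul_one, h1,
      Algebra.algebraMap_eq_smul_one, Submodule.Quotient.mk_smul]

theorem actsBy_glSeries_zero_one (l₁ l₂ : ℂ⟦X⟧) : ActsBy (glSeries 0 1) (glHighest l₁ l₂) 0 := by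
  intro n
  rw [glSeries, coeff_mk, map_zero]
  refine Eq.trans ?_ (zero_smul ℂ (glHighest l₁ l₂)).symm
  cases n with
  | zero => rw [isRTT_glT.zero, if_neg (by decide), zero_smul]
  | succ r =>
    rw [glHighest, ← Submodule.Quotient.mk_smul, smul_eq_mul, mul_one,
      Submodule.Quotient.mk_eq_zero]
    exact Submodule.subset_span (Or.inl (Or.inl ⟨r, rfl⟩))

section GlHighest

variable {l₁ l₂ : ℂ⟦X⟧}

theorem actsBy_glSeries_one_one (h2 : coeff 0 l₂ = 1) :
    ActsBy (glSeries 1 1) (glHighest l₁ l₂) l₂ :=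
  actsBy_glSeries_diag h2 fun r => Submodule.subset_span (Or.inr ⟨r, rfl⟩)

theorem actsBy_glSeriesE (l₁ l₂ : ℂ⟦X⟧) : ActsBy glSeriesE (glHighest l₁ l₂) 0 :=
  (actsBy_glSeries_zero_one l₁ l₂).mul_zero _

theorem actsBy_glSeriesH (h1 : coeff 0 l₁ = 1) (h2 : coeff 0 l₂ = 1) {μ : ℂ⟦X⟧}
    (h : μ * l₂ = l₁) : ActsBy glSeriesH (glHighest l₁ l₂) μ := by
  have h3 : ActsBy (glSeries 0 0) (glHighest l₁ l₂) l₁ :=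
    actsBy_glSeries_diag h1 fun r => Submodule.subset_span (Or.inl (Or.inr ⟨r, rfl⟩))
  have h4 : glSeriesH * glSeries 1 1 = glSeries 0 0 - glSeries 1 0 * glSeriesInv * glSeries 0 1 := by
    rw [glSeriesH, sub_mul, mul_assoc, glSeriesInv_mul, mul_one, mul_assoc _ glSeriesInv (glSeries 1 1),
      glSeriesInv_mul, mul_one]
  refine ActsBy.of_mul ?_ (actsBy_glSeries_one_one h2) h2
  rw [h4, h]
  simpa using h3.sub ((actsBy_glSeries_zero_one l₁ l₂).mul_zero (glSeries 1 0 * glSeriesInv))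

end GlHighest

section GlAction

variable (M : Type*) [AddCommGroup M] [Module ℂ M] [Module YGl M] [IsScalarTower ℂ YGl M]

/-- The operator of an element of `Y(gl₂)` on a module. -/
abbrev glAct (y : YGl) : Module.End ℂ M := Algebra.lsmul ℂ ℂ M y

theorem isDrinfeld_glAct : IsDrinfeld (fun r => glAct M (coeff (r + 1) glSeriesE))
    (fun r => glAct M (coeff (r + 1) glSeriesH)) (fun r => glAct M (coeff (r + 1) glSeriesF)) :=
  isDrinfeld_glSeries.map (Algebra.lsmul ℂ ℂ M : YGl →ₐ[ℂ] Module.End ℂ M).toRingHom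

variable {M}

/-- A subspace that is preserved by the series of the Gauss decomposition is a submodule. -/
def glSubmodule (P : Submodule ℂ M) (hk : ∀ r, ∀ m ∈ P, glT 1 1 r • m ∈ P)
    (he : ∀ r, ∀ m ∈ P, coeff (r + 1) glSeriesE • m ∈ P)
    (hh : ∀ r, ∀ m ∈ P, coeff (r + 1) glSeriesH • m ∈ P)
    (hf : ∀ r, ∀ m ∈ P, coeff (r + 1) glSeriesF • m ∈ P) : Submodule YGl M where
  __ := P.toAddSubmonoid
  smul_mem' y := by
    have kp : Preserves (glSeries 1 1) P := fun n m hm => by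
      rw [glSeries, coeff_mk]
      exact hk n m hm
    have ep : Preserves glSeriesE P := fun n m hm => by
      cases n with
      | zero => simp [glSeriesE, constantCoeff_glSeries]
      | succ n => exact he n m hm
    have fp : Preserves glSeriesF P := fun n m hm => by
      cases n with
      | zero => simp [glSeriesF, constantCoeff_glSeries]
      | succ n => exact hf n m hm
    have hp : Preserves glSeriesH P := fun n m hm => by
      cases n with
      | zero =>
        have : coeff 0 glSeriesH = 1 := by
          simp [glSeriesH, constantCoeff_glSeries, constantCoeff_glSeriesInv]
        rwa [this, one_smul]
      | succ n => exact hh n m hm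
    have h01 : glSeries 0 1 = glSeries 1 1 * glSeriesE := by
      rw [glSeriesE, ← mul_assoc, glSeries_mul_inv, one_mul]
    have h10 : glSeries 1 0 = glSeriesF * glSeries 1 1 := by
      rw [glSeriesF, mul_assoc, glSeriesInv_mul, mul_one]
    have h00 : glSeries 0 0 = glSeriesH * glSeries 1 1 + glSeriesF * (glSeries 1 1 * glSeriesE) := by
      rw [← h01, glSeriesH, sub_mul, mul_assoc, glSeriesInv_mul, mul_one,
        mul_assoc _ glSeriesInv (glSeries 1 1), glSeriesInv_mul, mul_one, glSeriesF, sub_add_cancel]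
    -- Every entry of t(u) is a sum of products of k, e, f and h, so no stability under the inverse
    -- of k is needed.
    have hall : ∀ i j, Preserves (glSeries i j) P := by
      intro i j
      fin_cases i <;> fin_cases j
      · exact h00 ▸ (hp.mul kp).add (fp.mul (kp.mul ep))
      · exact h01 ▸ kp.mul ep
      · exact h10 ▸ fp.mul kp
      · exact kp
    have key : ∀ m ∈ P, y • m ∈ P := by
      induction y using yGl_induction with
      | gen i j r =>
        intro m hm
        have := hall i j r m hm
        rwa [glSeries, coeff_mk] at this
      | alg c =>
        intro m hm
        rw [algebraMap_smul]
        exact P.smul_mem c hm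
      | add y z hy hz =>
        intro m hm
        rw [add_smul]
        exact add_mem (hy m hm) (hz m hm)
      | mul y z hy hz =>
        intro m hm
        rw [mul_smul]
        exact hy _ (hz m hm)
    exact fun {m} hm => key m hm

theorem glT_shift_zero (s : ℕ) (m : M) : glAct M (glT 1 1 0) (glAct M (coeff (s + 1) glSeriesF) m) =
    glAct M (coeff (s + 1) glSeriesF) (glAct M (glT 1 1 0) m) +
      (0 : ℂ) • glAct M (coeff (s + 1) glSeriesF) m := by
  rw [isRTT_glT.zero, if_pos rfl, zero_smul, add_zero]
  simp only [Algebra.lsmul_coe, one_smul]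

theorem glT_shift_succ (n s : ℕ) (m : M) :
    glAct M (glT 1 1 (n + 1)) (glAct M (coeff (s + 1) glSeriesF) m) =
      glAct M (coeff (s + 1) glSeriesF) (glAct M (glT 1 1 (n + 1)) m) +
        (glAct M (glT 1 1 n) (glAct M (coeff (s + 1 + 1) glSeriesF) m) -
          glAct M (coeff (s + 1 + 1) glSeriesF) (glAct M (glT 1 1 n) m)) +
      (1 : ℂ) • glAct M (coeff (s + 1) glSeriesF) (glAct M (glT 1 1 n) m) +
      (0 : ℂ) • glAct M (glT 1 1 n) (glAct M (coeff (s + 1) glSeriesF) m) := by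
  have h1 := congrArg (fun y => y • m) (isGaussCurrents_glSeries.coeff_kf n s)
  simp only [glSeries, coeff_mk, Ring.lie_def, sub_smul, mul_smul] at h1
  rw [sub_eq_iff_eq_add, sub_eq_iff_eq_add'] at h1
  simp only [Algebra.lsmul_coe]
  rw [h1, one_smul, zero_smul]
  abel

end GlAction

theorem eq_top_of_glHighest_mem {l₁ l₂ : ℂ⟦X⟧} {N : Submodule YGl (GlVerma l₁ l₂)}
    (h : glHighest l₁ l₂ ∈ N) : N = ⊤ := by
  rw [eq_top_iff]
  intro m _
  obtain ⟨y, rfl⟩ := Submodule.Quotient.mk_surjective _ m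
  have := N.smul_mem y h
  rwa [glHighest, ← Submodule.Quotient.mk_smul, smul_eq_mul, mul_one] at this

section GlVermaStructure

variable {μ l₁ l₂ : ℂ⟦X⟧}

theorem mem_fClosure_glHighest (h1 : coeff 0 l₁ = 1) (h2 : coeff 0 l₂ = 1) (h : μ * l₂ = l₁)
    (m : GlVerma l₁ l₂) :
    m ∈ fClosure (fun s => glAct (GlVerma l₁ l₂) (coeff (s + 1) glSeriesF)) (ℂ ∙ glHighest l₁ l₂) := by
  have D := isDrinfeld_glAct (GlVerma l₁ l₂)
  have key : ∀ (y : YGl) (c : ℂ), y • glHighest l₁ l₂ = c • glHighest l₁ l₂ →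
      ∀ m ∈ (ℂ ∙ glHighest l₁ l₂), glAct (GlVerma l₁ l₂) y m ∈
      fClosure (fun s => glAct (GlVerma l₁ l₂) (coeff (s + 1) glSeriesF)) (ℂ ∙ glHighest l₁ l₂) := by
    intro y c hy m hm
    obtain ⟨d, rfl⟩ := Submodule.mem_span_singleton.mp hm
    refine le_fClosure ?_
    rw [map_smul]
    have : glAct (GlVerma l₁ l₂) y (glHighest l₁ l₂) = c • glHighest l₁ l₂ := hy
    rw [this]
    exact Submodule.smul_mem _ _ (Submodule.smul_mem _ _ (Submodule.mem_span_singleton_self _))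
  have hk := fun n => key (glT 1 1 n) _ (by
    have := actsBy_glSeries_one_one (l₁ := l₁) h2 n
    rwa [glSeries, coeff_mk] at this)
  have hh := fun n => key _ _ (actsBy_glSeriesH h1 h2 h (n + 1))
  have he := fun n => key _ _ (actsBy_glSeriesE l₁ l₂ (n + 1))
  have h1 : glSubmodule (fClosure (fun s => glAct (GlVerma l₁ l₂) (coeff (s + 1) glSeriesF))
      (ℂ ∙ glHighest l₁ l₂))
      (fun r m hm => map_fClosure_of_shift (g := fun n => glAct (GlVerma l₁ l₂) (glT 1 1 n))
        glT_shift_zero glT_shift_succ hk r hm)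
      (fun r m hm => D.e_mem_fClosure hh he r hm) (fun r m hm => D.h_mem_fClosure hh r hm)
      (fun r m hm => map_mem_fClosure r hm) = ⊤ :=
    eq_top_of_glHighest_mem (le_fClosure (Submodule.mem_span_singleton_self _))
  exact (h1 ▸ Submodule.mem_top : m ∈ glSubmodule _ _ _ _ _)

/-- A submodule over the Yangian of sl₂ need not be visibly stable under t₂₂, so the submodule
generated by the vectors of the ideal (Q) is built directly. Its stability under t₂₂ follows from
the same shift argument as for h. -/
theorem isReducible_glVerma (hμ : coeff 0 μ = 1) (h1 : coeff 0 l₁ = 1) (h2 : coeff 0 l₂ = 1)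
    (hl : μ * l₂ = l₁) (h : IsRationalSeries μ) : IsReducible YGl (GlVerma l₁ l₂) := by
  obtain ⟨P, Q, h⟩ := h
  have D := isDrinfeld_glAct (GlVerma l₁ l₂)
  have hev : ∀ r, glAct (GlVerma l₁ l₂) (coeff (r + 1) glSeriesE) (glHighest l₁ l₂) = 0 :=
    fun r => (actsBy_glSeriesE l₁ l₂ (r + 1)).trans (by rw [map_zero]; exact zero_smul ℂ (glHighest l₁ l₂))
  have hhv : ∀ r, glAct (GlVerma l₁ l₂) (coeff (r + 1) glSeriesH) (glHighest l₁ l₂) =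
      coeff (r + 1) μ • glHighest l₁ l₂ := fun r => actsBy_glSeriesH h1 h2 hl (r + 1)
  have hkv : ∀ n, glAct (GlVerma l₁ l₂) (glT 1 1 n) (glHighest l₁ l₂) =
      coeff n l₂ • glHighest l₁ l₂ := fun n => by
    have := actsBy_glSeries_one_one (l₁ := l₁) h2 n
    rwa [glSeries, coeff_mk] at this
  have hQ : fVec (fun s => glAct (GlVerma l₁ l₂) (coeff (s + 1) glSeriesF)) (glHighest l₁ l₂) Q ∈
      fClosure (fun s => glAct (GlVerma l₁ l₂) (coeff (s + 1) glSeriesF))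
        (fVecIdeal _ _ (Ideal.span {Q})) :=
    le_fClosure (fVec_mem (Ideal.mem_span_singleton_self Q))
  refine ⟨glSubmodule _
    (fun r m hm => map_fClosure_of_shift (g := fun n => glAct (GlVerma l₁ l₂) (glT 1 1 n))
      glT_shift_zero glT_shift_succ (fun n _ hm => le_fClosure (map_fVecIdeal_of_shift
        (g := fun n => glAct (GlVerma l₁ l₂) (glT 1 1 n)) glT_shift_zero glT_shift_succ hkv n hm))
      r hm)
    (fun r m hm => D.e_mem_fClosure_fVecIdeal hev hhv h r hm)
    (fun r m hm => D.h_mem_fClosure_fVecIdeal hhv r hm)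
    (fun r m hm => map_mem_fClosure r hm), fun h0 => ?_, fun h1 => ?_⟩
  · exact fVec_ne_zero (glVermaMap hμ h2 hl) (glVermaMap_glSeriesF hμ h2 hl)
      (glVermaMap_glHighest hμ h2 hl) h.1 ((Submodule.mem_bot YGl).mp (h0.le hQ))
  · exact ne_zero_of_map_vac (glVermaMap hμ h2 hl) (glVermaMap_glSeriesF hμ h2 hl)
      (glVermaMap_glHighest hμ h2 hl) (Ideal.span {Q})
      (h1.ge (Submodule.mem_top (x := glHighest l₁ l₂)))

end GlVermaStructure

/-! ### Verma modules over the Yangian of gl₂ as restrictions. -/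

section Restriction

variable {μ l₁ l₂ : ℂ⟦X⟧}

theorem slToGl_smul_glHighest (h1 : coeff 0 l₁ = 1) (h2 : coeff 0 l₂ = 1) (h : μ * l₂ = l₁) :
    ∀ y ∈ slVermaIdeal μ, ((Algebra.lsmul ℂ ℂ (GlVerma l₁ l₂)).comp slToGl) y
      (glHighest l₁ l₂) = 0 := by
  refine annihilates_of_span ?_
  rintro _ (⟨r, rfl⟩ | ⟨r, rfl⟩)
  · have := actsBy_glSeriesE l₁ l₂ (r + 1)
    rw [← slToGl_slE, map_zero] at this
    exact this.trans (zero_smul ℂ (glHighest l₁ l₂))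
  · have := actsBy_glSeriesH h1 h2 h (r + 1)
    rw [← slToGl_slH] at this
    rw [map_sub, AlgHom.commutes, LinearMap.sub_apply, Module.algebraMap_end_apply, sub_eq_zero]
    exact this

/-- The map from the Verma module over `Y(sl₂)` to the Verma module over `Y(gl₂)`. -/
def restrictionMap (h1 : coeff 0 l₁ = 1) (h2 : coeff 0 l₂ = 1) (h : μ * l₂ = l₁) :
    SlVerma μ →ₗ[ℂ] GlVerma l₁ l₂ :=
  cyclicMap ((Algebra.lsmul ℂ ℂ (GlVerma l₁ l₂)).comp slToGl) (glHighest l₁ l₂) (slVermaIdeal μ)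
    (slToGl_smul_glHighest h1 h2 h)

theorem restrictionMap_slHighest (h1 : coeff 0 l₁ = 1) (h2 : coeff 0 l₂ = 1) (h : μ * l₂ = l₁)
    : restrictionMap h1 h2 h (slHighest μ) = glHighest l₁ l₂ := by
  rw [slHighest, restrictionMap, cyclicMap_mk, map_one, Module.End.one_apply]

theorem restrictionMap_smul (h1 : coeff 0 l₁ = 1) (h2 : coeff 0 l₂ = 1) (h : μ * l₂ = l₁)
    (y : YSl) (m : SlVerma μ) :
    restrictionMap h1 h2 h (y • m) = slToGl y • restrictionMap h1 h2 h m :=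
  cyclicMap_smul y m

/-- Both sides send the highest vector to the vacuum and intertwine the lowering operators, which
generate the module. -/
theorem glVermaMap_restrictionMap (h1 : coeff 0 l₁ = 1) (h2 : coeff 0 l₂ = 1) (h : μ * l₂ = l₁)
    (hμ : coeff 0 μ = 1) (m : SlVerma μ) :
    glVermaMap hμ h2 h (restrictionMap h1 h2 h m) = slVermaMap hμ m := by
  have key : fClosure (fun s => slAct (SlVerma μ) (slF s)) (ℂ ∙ slHighest μ) ≤
      LinearMap.eqLocus ((glVermaMap hμ h2 h).comp (restrictionMap h1 h2 h)) (slVermaMap hμ) := by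
    refine fClosure_le ?_ fun s m hm => ?_
    · rw [Submodule.span_singleton_le_iff_mem, LinearMap.mem_eqLocus, LinearMap.comp_apply,
        restrictionMap_slHighest, glVermaMap_glHighest, slVermaMap_slHighest]
    · rw [LinearMap.mem_eqLocus, LinearMap.comp_apply] at hm ⊢
      have h3 : slAct (SlVerma μ) (slF s) m = slF s • m := rfl
      rw [h3, restrictionMap_smul, slToGl_slF, glVermaMap_glSeriesF, hm, slVermaMap_slF]
  exact key (mem_fClosure_slHighest m)

theorem restrictionMap_injective (h1 : coeff 0 l₁ = 1) (h2 : coeff 0 l₂ = 1) (h : μ * l₂ = l₁)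
    (hμ : coeff 0 μ = 1) :
    Function.Injective (restrictionMap h1 h2 h) := by
  intro m n hmn
  apply slVermaMap_injective hμ
  rw [← glVermaMap_restrictionMap h1 h2 h, hmn, glVermaMap_restrictionMap]

theorem restrictionMap_surjective (h1 : coeff 0 l₁ = 1) (h2 : coeff 0 l₂ = 1) (h : μ * l₂ = l₁)
    : Function.Surjective (restrictionMap h1 h2 h) := by
  have key : fClosure (fun s => glAct (GlVerma l₁ l₂) (coeff (s + 1) glSeriesF))
      (ℂ ∙ glHighest l₁ l₂) ≤ LinearMap.range (restrictionMap h1 h2 h) := by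
    refine fClosure_le ?_ ?_
    · rw [Submodule.span_singleton_le_iff_mem]
      exact ⟨_, restrictionMap_slHighest h1 h2 h⟩
    · rintro s _ ⟨m, rfl⟩
      refine ⟨slF s • m, ?_⟩
      rw [restrictionMap_smul, slToGl_slF]
      rfl
  exact fun m => key (mem_fClosure_glHighest h1 h2 h m)

/-- The preimage of a proper nonzero submodule is one again: surjectivity of the map gives nonzero
vectors, and the highest vector stays outside. -/
theorem isReducible_slVerma_of_glVerma (h1 : coeff 0 l₁ = 1) (h2 : coeff 0 l₂ = 1) (h : μ * l₂ = l₁)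
    (hr : IsReducible YGl (GlVerma l₁ l₂)) : IsReducible YSl (SlVerma μ) := by
  obtain ⟨N, hN0, hN1⟩ := hr
  let N' : Submodule YSl (SlVerma μ) :=
    { carrier := {m | restrictionMap h1 h2 h m ∈ N}
      add_mem' := fun {a b} ha hb => by
        rw [Set.mem_ofPred_eq] at *
        rw [map_add]
        exact add_mem ha hb
      zero_mem' := by
        rw [Set.mem_ofPred_eq, map_zero]
        exact zero_mem N
      smul_mem' := fun y m hm => by
        rw [Set.mem_ofPred_eq] at *
        rw [restrictionMap_smul]
        exact N.smul_mem _ hm }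
  refine ⟨N', fun h0 => ?_, fun h0 => ?_⟩
  · obtain ⟨x, hx, hx0⟩ := N.exists_mem_ne_zero_of_ne_bot hN0
    obtain ⟨m, rfl⟩ := restrictionMap_surjective h1 h2 h x
    have h3 : m ∈ N' := hx
    rw [h0, Submodule.mem_bot] at h3
    rw [h3, map_zero] at hx0
    exact hx0 rfl
  · refine hN1 (eq_top_of_glHighest_mem ?_)
    have h3 : slHighest μ ∈ N' := h0 ▸ Submodule.mem_top
    rw [← restrictionMap_slHighest h1 h2 h]
    exact h3

end Restriction

end

end YangianVerma

open YangianVerma PowerSeries in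
theorem corollary3p6 :
    -- reducibility over the Yangian of sl₂
    (∀ μ : PowerSeries ℂ, constantCoeff μ = 1 →
      (IsReducible YSl (SlVerma μ) ↔ IsRationalSeries μ)) ∧
    -- reducibility over the Yangian of gl₂
    (∀ l₁ l₂ : PowerSeries ℂ, constantCoeff l₁ = 1 → constantCoeff l₂ = 1 →
      (IsReducible YGl (GlVerma l₁ l₂) ↔ IsRationalSeries (l₁ * l₂⁻¹))) ∧
    -- the Verma modules over the Yangian of sl₂ as restrictions
    (∃ φ : YSl →ₐ[ℂ] YGl,
      (∀ r : ℕ, φ (slE r) = coeff (r + 1) glSeriesE ∧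
        φ (slF r) = coeff (r + 1) glSeriesF ∧
        φ (slH r) = coeff (r + 1) glSeriesH) ∧
      ∀ l₁ l₂ : PowerSeries ℂ, constantCoeff l₁ = 1 → constantCoeff l₂ = 1 →
        ∃ Φ : SlVerma (l₁ * l₂⁻¹) ≃ₗ[ℂ] GlVerma l₁ l₂,
          Φ (slHighest (l₁ * l₂⁻¹)) = glHighest l₁ l₂ ∧
          ∀ (y : YSl) (m : SlVerma (l₁ * l₂⁻¹)), Φ (y • m) = φ y • Φ m) ∧
    -- vectors annihilated by e(u) in the rational case
    (∀ (μ : PowerSeries ℂ) (P Q : Polynomial ℂ) (p : ℕ), P.Monic → Q.Monic →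
      P.natDegree = p → Q.natDegree = p → IsExpansionAtInfinity μ P Q →
      ∀ s : ℕ, p ≤ s → ∃ c : Fin s → ℂ,
        ∃ ζ : SlVerma μ,
          ζ = ∑ k : Fin s, c k • slF k • slHighest μ + slF s • slHighest μ ∧
          ζ ≠ 0 ∧ ∀ r : ℕ, slE r • ζ = 0) := by
  have key : ∀ l₁ l₂ : PowerSeries ℂ, constantCoeff l₁ = 1 → constantCoeff l₂ = 1 →
      coeff 0 (l₁ * l₂⁻¹) = 1 ∧ coeff 0 l₁ = 1 ∧ coeff 0 l₂ = 1 ∧ l₁ * l₂⁻¹ * l₂ = l₁ := by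
    intro l₁ l₂ h1 h2
    have h0 : constantCoeff l₂ ≠ 0 := by
      rw [h2]
      exact one_ne_zero
    refine ⟨?_, by rwa [coeff_zero_eq_constantCoeff_apply],
      by rwa [coeff_zero_eq_constantCoeff_apply], ?_⟩
    · rw [coeff_zero_eq_constantCoeff_apply, map_mul, PowerSeries.constantCoeff_inv, h1, h2,
        inv_one, one_mul]
    · rw [mul_assoc, PowerSeries.inv_mul_cancel _ h0, mul_one]
  refine ⟨fun μ hμ => ?_, fun l₁ l₂ h1 h2 => ?_, ⟨slToGl, fun r => ⟨slToGl_slE r, slToGl_slF r, slToGl_slH r⟩,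
    fun l₁ l₂ h1 h2 => ?_⟩, fun μ P Q p hP hQ hPd hQd h s hs => ?_⟩
  · rw [← coeff_zero_eq_constantCoeff_apply] at hμ
    exact ⟨isRationalSeries_of_isReducible hμ, isReducible_slVerma hμ⟩
  · obtain ⟨hμ, h1, h2, h⟩ := key l₁ l₂ h1 h2
    exact ⟨fun hr => isRationalSeries_of_isReducible hμ
      (isReducible_slVerma_of_glVerma h1 h2 h hr), isReducible_glVerma hμ h1 h2 h⟩
  · obtain ⟨hμ, h1, h2, h⟩ := key l₁ l₂ h1 h2
    exact ⟨LinearEquiv.ofBijective (restrictionMap h1 h2 h)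
      ⟨restrictionMap_injective h1 h2 h hμ, restrictionMap_surjective h1 h2 h⟩,
      restrictionMap_slHighest h1 h2 h, restrictionMap_smul h1 h2 h⟩
  · exact exists_singular_vector (coeff_zero_of_isExpansionAtInfinity hP hQ hPd hQd h) hQ hQd h s hs
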